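/- For $z\in\mathbb C$ and $k\in\mathbb Z$ let $(z)_k=\Gamma(z+k)/\Gamma(z)$, i.e. $(z)_k=z(z+1)\cdots(z+k-1)$ and $(z)_{-k}=\frac1{(z-1)(z-2)\cdots(z-k)}$ for $k\ge 0$. Let $a,b,c\in\mathbb C$ be generic: $a,\ c,\ c-b\notin\{0,-1,-2,\dots\}$ and $b,\ c-a,\ c-a-b\notin\mathbb Z$. Horn's function is $$H_5(a,b,c;x,y)=\sum_{m,n\ge0}\frac{(a)_{2m+n}(b)_{n-m}}{(c)_n}\frac{x^my^n}{m!\,n!}.$$ Let $D\subset\mathbb C^2$ be the set of $(x,y)$ with $|x|<\frac14$, $|y|<1$ and $|y|<\beta(|x|)$, where for $r>0$ $$\gamma(r)=\frac{(1+12r)^{3/2}-36r+1}{54r},\qquad \beta(r)=\min\Big(\frac{-(1-12r)^{3/2}+36r+1}{54r},\frac{(1-12r)^{3/2}+36r+1}{54r},\gamma(r)\Big)\ \text{if } \sqrt r<\tfrac1{2\sqrt3},\qquad \beta(r)=\gamma(r)\ \text{otherwise}.$$ Put $$S_1(x,y)=\frac{\Gamma(c)\Gamma(c-a-b)}{\Gamma(c-a)\Gamma(c-b)}\sum_{m,n\ge0}\frac{(a-c+1)_{2m}(a)_{2m+n}(b)_{n-m}}{(c-b)_m(a+b-c+1)_{m+n}}\frac{(-x)^m(1-y)^n}{m!\,n!},$$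 $$S_2(x,y)=\frac{\Gamma(c)\Gamma(a+b-c)}{\Gamma(a)\Gamma(b)}\sum_{m,n\ge0}\frac{(a-c+1)_{2m}(c-a)_{n-2m}(c-b)_{m+n}}{m!\,n!\,(c-b)_m(c-a-b+1)_{n-m}}\Big(-\frac{x}{1-y}\Big)^m(1-y)^n .$$ Let $R_1$ be the set of $(x,y)\in\mathbb C^2$ with $|x|<\frac1{16}$, $|1-y|<1$ and $|1-y|<\frac{(1-12|x|)^{3/2}-18|x|+1}{54|x|}$. Let $R_2$ be the set of $(x,y)\in\mathbb C^2$ with $y\ne1$, $\left|\frac{x}{y-1}\right|<1$, $|1-y|<1$ and $|1-y|<\delta(|x|,|1-y|)$, where for $r,s>0$ $$\varepsilon(r,s)=\frac1{27}\Big(\frac{(4r+3s)^{3/2}}{\sqrt r\,s}-\frac{8r}{s}-9\Big),\qquad \delta(r,s)=\min\Big(\frac1{27}\Big(-\frac{(4r-3s)^{3/2}}{\sqrt r\,s}-\frac{8r}{s}+9\Big),\varepsilon(r,s)\Big)\ \text{if } \tfrac{4r}{s}>3,\qquad \delta(r,s)=\varepsilon(r,s)\ \text{otherwise}.$$ (For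 $x=0$ the bounds with a vanishing denominator are read as their limits for $|x|\to0$: $1$ for $\beta$, and $+\infty$ in $R_1$ and $R_2$.) Then: 1. The series of $H_5$, of $S_1$ and of $S_2$ converge absolutely on $D$, on $R_1$ and on $R_2$, respectively. 2. $D\cap R_1\cap R_2\neq\emptyset$, and on this set, with the principal branch of the power, $$H_5(a,b,c;x,y)=S_1(x,y)+(1-y)^{c-a-b}\,S_2(x,y).\qquad(*)$$ 3. Let $R'=\{(x,y)\in R_1\cap R_2: y\notin[1,\infty)\}$. On $R'$ the right-hand side of $(*)$, with the principal branch, is the analytic continuation of $H_5$: there is an analytic function on $D\cup R'$ that equals $H_5$ on $D$ and the right-hand side of $(*)$ on $R'$, and every analytic function on $D\cup R'$ that equals $H_5$ on $D$ equals the right-hand side of $(*)$ on $R'$. 4. The same holds on all of $R_1\cap R_2$ for all branches of the power. Let $U=\{(x,w)\in\mathbb C^2:(x,1-e^w)\in R_1\cap R_2\}$. The function $\Psi(x,w)=S_1(x,1-e^w)+e^{(c-a-b)w}S_2(x,1-e^w)$ is analytic on $U$. It equals $H_5(a,b,c;x,1-e^w)$ at all $(x,w)\in U$ with $|\operatorname{Im}w|<\pi$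 and $(x,1-e^w)\in D$, and it is the only analytic function on $U$ (as regards its values on $U$) with this property. -/

import Mathlib

open Complex Set

noncomputable section

/-- The Pochhammer symbol `(z)_k` for an integer index `k`: it is `z (z + 1) ⋯ (z + k - 1)` for
`k ≥ 0`, and `(z)_{-k} = 1 / ((z - 1) (z - 2) ⋯ (z - k))` for `k > 0`, so that
`(z)_k = Γ(z + k) / Γ(z)` whenever the right-hand side makes sense. -/
def poch (z : ℂ) : ℤ → ℂ
  | Int.ofNat n => (ascPochhammer ℂ n).eval z
  | Int.negSucc n => ((ascPochhammer ℂ (n + 1)).eval (z - (n + 1)))⁻¹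

/-- General term, with index `p = (m, n)`, of the double series that defines Horn's `H₅`. -/
def hornH5Term (a b c x y : ℂ) (p : ℕ × ℕ) : ℂ :=
  poch a (2 * p.1 + p.2) * poch b ((p.2 : ℤ) - p.1) / poch c p.2
    * (x ^ p.1 * y ^ p.2 / (p.1.factorial * p.2.factorial))

/-- Horn's double series `H₅(a, b, c; x, y)`. -/
def hornH5 (a b c x y : ℂ) : ℂ := ∑' p : ℕ × ℕ, hornH5Term a b c x y p

/-- General term, with index `p = (m, n)`, of the first double series around `(0, 1)`. -/
def firstTerm (a b c x y : ℂ) (p : ℕ × ℕ) : ℂ :=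
  poch (a - c + 1) (2 * p.1) * poch a (2 * p.1 + p.2) * poch b ((p.2 : ℤ) - p.1)
    / (poch (c - b) p.1 * poch (a + b - c + 1) (p.1 + p.2))
    * ((-x) ^ p.1 * (1 - y) ^ p.2 / (p.1.factorial * p.2.factorial))

/-- General term, with index `p = (m, n)`, of the second double series around `(0, 1)`. -/
def secondTerm (a b c x y : ℂ) (p : ℕ × ℕ) : ℂ :=
  poch (a - c + 1) (2 * p.1) * poch (c - a) ((p.2 : ℤ) - 2 * p.1) * poch (c - b) (p.1 + p.2)
    / (p.1.factorial * p.2.factorial * poch (c - b) p.1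
        * poch (-a - b + c + 1) ((p.2 : ℤ) - p.1))
    * ((-(x / (1 - y))) ^ p.1 * (1 - y) ^ p.2)

/-- The first Gamma-weighted double series. -/
def firstPart (a b c x y : ℂ) : ℂ :=
  Gamma c * Gamma (-a - b + c) / (Gamma (c - a) * Gamma (c - b))
    * ∑' p : ℕ × ℕ, firstTerm a b c x y p

/-- The second Gamma-weighted double series, without its prefactor `(1 - y)^(c - a - b)`. -/
def secondPart (a b c x y : ℂ) : ℂ :=
  Gamma c * Gamma (a + b - c) / (Gamma a * Gamma b)
    * ∑' p : ℕ × ℕ, secondTerm a b c x y p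

/-- The right-hand side of the continuation formula around `(0, 1)`, with the principal branch of
the power `(1 - y)^(c - a - b)`. -/
def hornH5At01 (a b c x y : ℂ) : ℂ :=
  firstPart a b c x y + (1 - y) ^ (-a - b + c) * secondPart a b c x y

/-- The bound on `|y|`, as a function of `r = |x| > 0`, in the region of convergence of `H₅`. -/
def hornH5Bound (r : ℝ) : ℝ :=
  if √r < 1 / (2 * √3) then
    min (min ((-(1 - 12 * r) ^ (3 / 2 : ℝ) + 36 * r + 1) / (54 * r))
        (((1 - 12 * r) ^ (3 / 2 : ℝ) + 36 * r + 1) / (54 * r)))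
      (((12 * r + 1) ^ (3 / 2 : ℝ) - 36 * r + 1) / (54 * r))
  else ((12 * r + 1) ^ (3 / 2 : ℝ) - 36 * r + 1) / (54 * r)

/-- The defining region of convergence of `H₅`. For `x = 0` the bound, whose denominator
vanishes, is read as its limit for `|x| → 0`, which is `1`. -/
def hornH5Region : Set (ℂ × ℂ) :=
  {p | ‖p.1‖ < 1 / 4 ∧ ‖p.2‖ < 1 ∧ (p.1 ≠ 0 → ‖p.2‖ < hornH5Bound ‖p.1‖)}

/-- The region of convergence of the first series. For `x = 0` the last bound is read as its
limit for `|x| → 0`, which is `+∞`. -/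
def firstRegion : Set (ℂ × ℂ) :=
  {p | ‖p.1‖ < 1 / 16 ∧ ‖1 - p.2‖ < 1 ∧
    (p.1 ≠ 0 →
      ‖1 - p.2‖ < ((1 - 12 * ‖p.1‖) ^ (3 / 2 : ℝ) - 18 * ‖p.1‖ + 1) / (54 * ‖p.1‖))}

/-- The bound on `s = |1 - y| > 0` in the region of convergence of the second series, as a function
of `r = |x| > 0` and `s`. -/
def secondBound (r s : ℝ) : ℝ :=
  if 4 * (r / s) > 3 then
    min (1 / 27 * (-((4 * r - 3 * s) ^ (3 / 2 : ℝ) / (√r * s)) - 8 * r / s + 9))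
      (1 / 27 * ((4 * r + 3 * s) ^ (3 / 2 : ℝ) / (√r * s) - 8 * r / s - 9))
  else 1 / 27 * ((4 * r + 3 * s) ^ (3 / 2 : ℝ) / (√r * s) - 8 * r / s - 9)

/-- The region of convergence of the second series, a series in `-x / (1 - y)` and `1 - y`. For
`x = 0` the last bound is read as its limit for `|x| → 0`, which is `+∞`. -/
def secondRegion : Set (ℂ × ℂ) :=
  {p | p.2 ≠ 1 ∧ ‖p.1 / (p.2 - 1)‖ < 1 ∧ ‖1 - p.2‖ < 1 ∧
    (p.1 ≠ 0 → ‖1 - p.2‖ < secondBound ‖p.1‖ ‖1 - p.2‖)}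

/-- The common region of convergence of the two series. -/
def commonRegion : Set (ℂ × ℂ) := firstRegion ∩ secondRegion

/-- The common region, cut along `y ∈ [1, ∞)`, where the principal branch of
`(1 - y)^(c - a - b)` is holomorphic. -/
def cutRegion : Set (ℂ × ℂ) := commonRegion ∩ {p | 1 - p.2 ∈ slitPlane}

/-- The covering of the common region by the pairs `(x, w)` with `exp w = 1 - y`: a point is a point
of the common region together with a choice of a logarithm of `1 - y`. -/
def coverRegion : Set (ℂ × ℂ) := {q | (q.1, 1 - exp q.2) ∈ commonRegion}

/-- The right-hand side of the continuation formula on the covering: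
`(1 - y)^(c - a - b) = exp ((c - a - b) w)`, where `exp w = 1 - y`. -/
def hornH5At01Cover (a b c x w : ℂ) : ℂ :=
  firstPart a b c x (1 - exp w) + exp ((-a - b + c) * w) * secondPart a b c x (1 - exp w)

end

/-! The proof has three parts.

*Convergence.* By Stirling's formula the coefficients of each of the three double series grow like
`exp E(m, n)`, up to polynomial factors, where `E` is continuous and homogeneous of degree one: it
is a sum of terms `± x log |x|` with `x` linear in `m` and `n`. By compactness of the set of
directions, the series converges absolutely on a neighbourhood of the closed polydisc of radii
`r, s` as soon as `E(μ, ν) + μ log r + ν log s < 0` for all directions `(μ, ν)`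
(`mem_convDomain_of_exponent_neg`). That this holds in the three regions is
`hornExponent_neg`, `firstExponent_neg` and `secondExponent_neg`: in a cone of directions where the
exponent is an entropy, Gibbs' inequality gives a bound that is sharp on the boundary curve of the
region, and on the remaining cones a function of one variable is maximized.

*The formula.* For a fixed power of `x`, the sums over `n` are Gauss hypergeometric functions of
`y` and of `1 - y`, and the formula is, for each power of `x`, the connection formula of Gauss
between the solutions of the hypergeometric equation at `y = 0` and at `y = 1`
(`hornH5_row_connection`). That formula is `hyp_connection`: the coefficients are quotients of
Wronskians, which Abel's formula allows to compute from the behaviour of the solutions at the two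
points (`hyp_connection_of_re_pos`). This behaviour follows from an Abelian theorem and Euler's
limit for the Gamma function, provided that `Re C > 0`; the general case is reduced to this one by
differentiation.

*Continuation.* The series are analytic on open sets that contain the given regions, and the
formula holds on the whole overlap of these open sets, which glues the two sides to one analytic
function. Uniqueness is the identity theorem. Each point `(x, y)` of the common region can be
joined to `(0, y)` along the segment `(t x, y)`, because the bounds on `|1 - y|` only get weaker
when `|x|` decreases. In the coordinate `w = log (1 - y)` the part over `x = 0` is a half-plane,
and the cut region corresponds to a strip in it. So the cut region and the covering of the common
region are connected (`isPreconnected_cutRegion`, `isPreconnected_coverRegion`), and the point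
`(0, 1 / 2)` has a neighbourhood in both the common region and the region of `H₅`, where the formula
is known. -/

/-! ### Pochhammer symbols -/

open Filter Topology in
theorem exists_norm_le_of_tendsto {u : ℕ → ℂ} {l : ℂ} (h : Tendsto u atTop (𝓝 l)) :
    ∃ M : ℝ, 0 < M ∧ ∀ n, ‖u n‖ ≤ M := by
  obtain ⟨M, hM⟩ := h.norm.bddAbove_range
  exact ⟨max M 1, by positivity, fun n => (hM ⟨n, rfl⟩).trans (le_max_left _ _)⟩

theorem poch_natCast (z : ℂ) (n : ℕ) : poch z n = (ascPochhammer ℂ n).eval z := rfl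

@[simp] theorem poch_zero (z : ℂ) : poch z 0 = 1 := by
  simpa using poch_natCast z 0

theorem poch_natCast_succ (z : ℂ) (n : ℕ) : poch z ((n : ℤ) + 1) = poch z n * (z + n) := by
  have := ascPochhammer_succ_eval n z
  rw [poch_natCast, ← this]; rfl

theorem poch_natCast_succ_left (z : ℂ) (n : ℕ) :
    poch z ((n : ℤ) + 1) = z * poch (z + 1) n := by
  induction n with
  | zero => simpa using poch_natCast_succ z 0
  | succ n ih =>
    have h := poch_natCast_succ z (n + 1)
    push_cast at h ⊢
    rw [h, ih, poch_natCast_succ]; ring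

theorem poch_one (n : ℕ) : poch 1 n = n.factorial := by
  induction n with
  | zero => simp
  | succ n ih =>
    push_cast
    rw [poch_natCast_succ, ih, Nat.factorial_succ]; push_cast; ring

theorem poch_neg_natCast (z : ℂ) (n : ℕ) : poch z (-(n : ℤ)) = ((-1) ^ n * poch (1 - z) n)⁻¹ := by
  have key : ∀ n : ℕ, poch (z - n) n = (-1) ^ n * poch (1 - z) n := by
    intro n
    induction n with
    | zero => simp
    | succ n ih =>
      push_cast
      rw [poch_natCast_succ_left, poch_natCast_succ, show z - (n + 1) + 1 = z - n by ring, ih]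
      ring
  rw [← key]
  cases n with
  | zero => simp
  | succ n => rw [poch_natCast]; push_cast; rfl

theorem poch_natCast_ne_zero {z : ℂ} (hz : ∀ k : ℕ, z ≠ -(k : ℂ)) (n : ℕ) : poch z n ≠ 0 := by
  induction n with
  | zero => simp
  | succ n ih =>
    push_cast
    rw [poch_natCast_succ]
    exact mul_ne_zero ih fun h => hz n (eq_neg_of_add_eq_zero_left h)

theorem poch_ne_zero {z : ℂ} (hz : ∀ k : ℤ, z ≠ (k : ℂ)) (k : ℤ) : poch z k ≠ 0 := by
  obtain ⟨n, rfl | rfl⟩ := k.eq_nat_or_neg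
  · exact poch_natCast_ne_zero (fun j => by exact_mod_cast hz (-j)) n
  · rw [poch_neg_natCast]
    refine inv_ne_zero (mul_ne_zero (by simp) (poch_natCast_ne_zero (fun j h => ?_) n))
    refine hz (j + 1) ?_
    push_cast
    linear_combination -h

theorem poch_succ {z : ℂ} (hz : ∀ k : ℤ, z ≠ (k : ℂ)) (k : ℤ) :
    poch z (k + 1) = poch z k * (z + k) := by
  obtain ⟨n, rfl | rfl⟩ := k.eq_nat_or_neg
  · exact poch_natCast_succ z n
  · cases n with
    | zero => simpa using poch_natCast_succ z 0
    | succ n =>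
      have h1 : (1 - z) + n ≠ 0 := fun h => hz (n + 1) (by push_cast; linear_combination -h)
      rw [show -((n + 1 : ℕ) : ℤ) + 1 = -(n : ℤ) by push_cast; ring, poch_neg_natCast,
        poch_neg_natCast]
      push_cast
      rw [poch_natCast_succ, show z + -((n : ℂ) + 1) = -((1 - z) + n) by ring, pow_succ]
      field_simp

theorem poch_add_natCast {z : ℂ} (hz : ∀ k : ℤ, z ≠ (k : ℂ)) (k : ℤ) (n : ℕ) :
    poch z (k + n) = poch z k * poch (z + k) n := by
  induction n with
  | zero => simp
  | succ n ih =>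
    push_cast
    rw [← add_assoc, poch_succ hz, ih, poch_natCast_succ]
    push_cast; ring

theorem poch_natCast_add_natCast (z : ℂ) (k n : ℕ) :
    poch z (k + n) = poch z k * poch (z + k) n := by
  induction n with
  | zero => simp
  | succ n ih =>
    have := poch_natCast_succ z (k + n)
    push_cast at this ⊢
    rw [← add_assoc, this, ih, poch_natCast_succ]
    ring

/-- The link between Pochhammer symbols and Euler's sequence for the Gamma function. -/
theorem poch_mul_GammaSeq {z : ℂ} (hz : ∀ k : ℕ, z ≠ -(k : ℂ)) (n : ℕ) :
    poch z ((n : ℤ) + 1) * GammaSeq z n = (n : ℂ) ^ z * n.factorial := by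
  have h : ∀ n : ℕ, poch z n = ∏ j ∈ Finset.range n, (z + j) := by
    intro n
    induction n with
    | zero => simp
    | succ n ih => push_cast; rw [poch_natCast_succ, ih, Finset.prod_range_succ]
  have h0 := poch_natCast_ne_zero hz (n + 1)
  have h1 := h (n + 1)
  rw [GammaSeq, ← h1]
  push_cast at h0 ⊢
  field_simp

theorem GammaSeq_ne_zero {z : ℂ} (hz : ∀ k : ℕ, z ≠ -(k : ℂ)) {n : ℕ} (hn : n ≠ 0) :
    GammaSeq z n ≠ 0 := by
  intro h
  have h1 := poch_mul_GammaSeq hz n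
  rw [h, mul_zero] at h1
  exact mul_ne_zero (by simp [cpow_eq_zero_iff, hn]) (by exact_mod_cast n.factorial_ne_zero) h1.symm

/-! ### Growth of Pochhammer symbols -/

/-- A weak form of Stirling's formula: `n!` is `n ^ n e ^ (-n)` up to a factor between `1` and
`e n`. -/
theorem factorial_bounds (n : ℕ) :
    Real.exp (n * Real.log n - n) ≤ n.factorial ∧
      (n ≠ 0 → (n.factorial : ℝ) ≤ Real.exp 1 * n * Real.exp (n * Real.log n - n)) := by
  induction n with
  | zero => simp
  | succ n ih =>
    rcases Nat.eq_zero_or_pos n with rfl | hn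
    · refine ⟨by simp, fun _ => ?_⟩
      simp only [zero_add, Nat.factorial_one, Nat.cast_one, Real.log_one, mul_zero, zero_sub,
        mul_one]
      rw [← Real.exp_add]; norm_num
    · have hn0 : (0 : ℝ) < n := by exact_mod_cast hn
      have h1 : (0 : ℝ) < n + 1 := by positivity
      have e : Real.exp (((n : ℝ) + 1) * Real.log (n + 1) - (n + 1)) =
          (n + 1) * Real.exp (n * Real.log n - n)
            * Real.exp (n * Real.log ((n + 1) / n) - 1) := by
        rw [← Real.exp_log h1, mul_assoc, ← Real.exp_add, ← Real.exp_add, Real.exp_log h1,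
          Real.log_div h1.ne' hn0.ne']
        ring_nf
      have u1 : n * Real.log ((n + 1) / n) - 1 ≤ 0 := by
        have := Real.log_le_sub_one_of_pos (show 0 < ((n : ℝ) + 1) / n by positivity)
        have h2 : n * Real.log ((n + 1) / n) ≤ n * (((n : ℝ) + 1) / n - 1) := by gcongr
        have h3 : (n : ℝ) * (((n : ℝ) + 1) / n - 1) = 1 := by field_simp; ring
        linarith
      have u2 : Real.log (n / (n + 1)) ≤ n * Real.log ((n + 1) / n) - 1 := by
        have := Real.one_sub_inv_le_log_of_pos (show 0 < ((n : ℝ) + 1) / n by positivity)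
        have h2 : (n + 1) * (1 - (((n : ℝ) + 1) / n)⁻¹) ≤ (n + 1) * Real.log ((n + 1) / n) := by
          gcongr
        have h3 : ((n : ℝ) + 1) * (1 - (((n : ℝ) + 1) / n)⁻¹) = 1 := by field_simp; ring
        have h4 : Real.log ((n : ℝ) / (n + 1)) = - Real.log ((n + 1) / n) := by
          rw [← Real.log_inv, inv_div]
        linarith
      have u3 : (n : ℝ) / (n + 1) ≤ Real.exp (n * Real.log ((n + 1) / n) - 1) := by
        rw [← Real.exp_log (show (0 : ℝ) < n / (n + 1) by positivity)]
        exact Real.exp_le_exp.2 u2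
      have u4 : Real.exp (n * Real.log ((n + 1) / n) - 1) ≤ 1 := Real.exp_le_one_iff.2 u1
      rw [Nat.factorial_succ]
      push_cast
      rw [e]
      set w := Real.exp (n * Real.log n - n) with hw
      have hw0 : 0 < w := Real.exp_pos _
      constructor
      · calc (n + 1) * w * Real.exp (n * Real.log ((n + 1) / n) - 1) ≤ (n + 1) * w * 1 := by gcongr
          _ ≤ (n + 1) * n.factorial := by rw [mul_one]; gcongr; exact ih.1
      · intro _
        have u5 : (n : ℝ) ≤ (n + 1) * Real.exp (n * Real.log ((n + 1) / n) - 1) := by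
          rwa [div_le_iff₀' h1] at u3
        calc ((n : ℝ) + 1) * n.factorial ≤ (n + 1) * (Real.exp 1 * n * w) := by
              gcongr; exact ih.2 hn.ne'
          _ ≤ (n + 1) *
              (Real.exp 1 * ((n + 1) * Real.exp (n * Real.log ((n + 1) / n) - 1)) * w) := by
              gcongr
          _ = _ := by ring

/-- The comparison function `exp (k log |k| - k)` for the size of `(z)_k`. As
`Real.log k = log |k|`, it makes sense for negative `k` too, where it is the inverse of its value
at `-k`. -/
noncomputable def pochSize (k : ℤ) : ℝ := Real.exp (k * Real.log k - k)

theorem pochSize_pos (k : ℤ) : 0 < pochSize k := Real.exp_pos _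

theorem pochSize_neg (k : ℤ) : pochSize (-k) = (pochSize k)⁻¹ := by
  rw [pochSize, pochSize, ← Real.exp_neg]
  congr 1
  push_cast
  rw [Real.log_neg_eq_log]; ring

theorem factorial_le_pochSize (n : ℕ) :
    (n.factorial : ℝ) ≤ Real.exp 1 * (n + 1) * pochSize n := by
  rcases Nat.eq_zero_or_pos n with rfl | hn
  · simp [pochSize]
  · refine ((factorial_bounds n).2 hn.ne').trans ?_
    simp only [pochSize, Int.cast_natCast]
    gcongr
    linarith

theorem pochSize_le_factorial (n : ℕ) : pochSize n ≤ n.factorial := by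
  simpa [pochSize] using (factorial_bounds n).1

theorem rpow_le_pow_of_abs_le {x t : ℝ} {K : ℕ} (hx : 1 ≤ x) (ht : |t| ≤ K) :
    x ^ t ≤ x ^ K := by
  rw [← Real.rpow_natCast]
  exact Real.rpow_le_rpow_of_exponent_le hx ((le_abs_self t).trans ht)

/-- Up to powers of `n`, the Pochhammer symbol `(z)_n` has the size of `n!`. -/
theorem exists_poch_factorial_bound {z : ℂ} (hz : ∀ k : ℕ, z ≠ -(k : ℂ)) :
    ∃ (C : ℝ) (K : ℕ), 0 < C ∧ ∀ n : ℕ, ‖poch z n‖ ≤ C * (n + 1) ^ K * n.factorial ∧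
      (n.factorial : ℝ) ≤ C * (n + 1) ^ K * ‖poch z n‖ := by
  obtain ⟨K, hK⟩ := exists_nat_ge |z.re|
  have hlim := (GammaSeq_tendsto_Gamma z).comp (Filter.tendsto_add_atTop_nat 1)
  obtain ⟨M₁, hM₁, h₁⟩ := exists_norm_le_of_tendsto hlim
  obtain ⟨M₂, hM₂, h₂⟩ := exists_norm_le_of_tendsto (hlim.inv₀ (Gamma_ne_zero hz))
  have hz0 : 0 < ‖z‖ := norm_pos_iff.2 (by simpa using hz 0)
  have hfac : ∀ n : ℕ, ((n + 2).factorial : ℝ) = (n + 2) * (n + 1).factorial := by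
    intro n; rw [Nat.factorial_succ]; push_cast; ring
  refine ⟨1 + ‖z‖ + ‖z‖⁻¹ + M₁ + M₂, K + 1, by positivity, fun n => ?_⟩
  have hC : ∀ t, t ≤ 1 + ‖z‖ + ‖z‖⁻¹ + M₁ + M₂ → ∀ n : ℕ, t ≤
      (1 + ‖z‖ + ‖z‖⁻¹ + M₁ + M₂) * ((n : ℝ) + 1) ^ (K + 1) := fun t ht n =>
    ht.trans (le_mul_of_one_le_right (by positivity) (one_le_pow₀ (by simp)))
  have hzi : 0 < ‖z‖⁻¹ := by positivity
  match n with
  | 0 =>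
    have := hC 1 (by linarith) 0
    constructor <;> simpa using this
  | 1 =>
    have e : poch z ((1 : ℕ) : ℤ) = z := by simpa using poch_natCast_succ z 0
    rw [e]
    constructor
    · simpa using hC ‖z‖ (by linarith) 1
    · have := mul_le_mul_of_nonneg_right (hC ‖z‖⁻¹ (by linarith) 1) hz0.le
      rw [inv_mul_cancel₀ hz0.ne'] at this
      simpa using this
  | n + 2 =>
    have hx : (1 : ℝ) ≤ n + 1 := by simp
    have hx0 : (0 : ℝ) < n + 1 := by positivity
    have hG := poch_mul_GammaSeq hz (n + 1)
    have hG0 := GammaSeq_ne_zero hz (Nat.succ_ne_zero n)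
    have hcp : ‖((n + 1 : ℕ) : ℂ) ^ z‖ = ((n : ℝ) + 1) ^ z.re := by
      rw [norm_natCast_cpow_of_pos (Nat.succ_pos n)]; push_cast; rfl
    have hnorm := congrArg norm hG
    rw [norm_mul, norm_mul, hcp, norm_natCast] at hnorm
    have hcast : (((n + 1 : ℕ) : ℤ) + 1) = ((n + 2 : ℕ) : ℤ) := by push_cast; ring
    rw [hcast] at hnorm
    set P := ‖poch z ((n + 2 : ℕ) : ℤ)‖
    set g := ‖GammaSeq z (n + 1)‖
    have hg0 : 0 < g := norm_pos_iff.2 hG0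
    have hg1 : g ≤ M₁ := h₁ n
    have hg2 : g⁻¹ ≤ M₂ := by simpa using h₂ n
    have up : ((n : ℝ) + 1) ^ z.re ≤ ((n : ℝ) + 1) ^ K := rpow_le_pow_of_abs_le hx hK
    have dn : (((n : ℝ) + 1) ^ z.re)⁻¹ ≤ ((n : ℝ) + 1) ^ K := by
      rw [← Real.rpow_neg hx0.le]
      exact rpow_le_pow_of_abs_le hx (by rwa [abs_neg])
    have hp : (0 : ℝ) < ((n : ℝ) + 1) ^ z.re := Real.rpow_pos_of_pos hx0 _
    have hf0 : (0 : ℝ) < (n + 1).factorial := by exact_mod_cast Nat.factorial_pos _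
    rw [hfac]
    push_cast
    have hpow : ((n : ℝ) + 1) ^ K ≤ (n + 2 + 1) ^ K := by gcongr; linarith
    have hpow' : (0 : ℝ) < (n + 2 + 1 : ℝ) ^ K := by positivity
    constructor
    · calc P = (((n : ℝ) + 1) ^ z.re * (n + 1).factorial) * g⁻¹ := by
            rw [← hnorm]; field_simp
        _ ≤ ((n + 2 + 1) ^ K * (n + 1).factorial) * M₂ := by gcongr; exact up.trans hpow
        _ = M₂ * (n + 2 + 1) ^ K * (1 * (n + 1).factorial) := by ring
        _ ≤ (1 + ‖z‖ + ‖z‖⁻¹ + M₁ + M₂) * (n + 2 + 1) ^ (K + 1)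
            * ((n + 2) * (n + 1).factorial) := by
          gcongr
          · linarith
          · linarith
          · omega
          · linarith
    · calc ((n : ℝ) + 2) * (n + 1).factorial
          = (n + 2) * ((((n : ℝ) + 1) ^ z.re)⁻¹ * (((n : ℝ) + 1) ^ z.re * (n + 1).factorial)) := by
            field_simp
        _ = (n + 2) * ((((n : ℝ) + 1) ^ z.re)⁻¹ * (P * g)) := by rw [hnorm]
        _ ≤ (n + 2 + 1) * ((n + 2 + 1) ^ K * (P * M₁)) := by
          have h3 : (n : ℝ) + 2 ≤ n + 2 + 1 := by linarith
          have h4 := dn.trans hpow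
          exact mul_le_mul h3 (mul_le_mul h4 (mul_le_mul_of_nonneg_left hg1 (norm_nonneg _))
            (by positivity) (by positivity)) (by positivity) (by positivity)
        _ = M₁ * (n + 2 + 1) ^ (K + 1) * P := by ring
        _ ≤ _ := by gcongr; linarith

theorem exists_poch_bound_nat {z : ℂ} (hz : ∀ k : ℕ, z ≠ -(k : ℂ)) :
    ∃ (C : ℝ) (K : ℕ), 0 < C ∧ ∀ n : ℕ, ‖poch z n‖ ≤ C * (n + 1) ^ K * pochSize n ∧
      ‖(poch z n)⁻¹‖ ≤ C * (n + 1) ^ K * (pochSize n)⁻¹ := by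
  obtain ⟨C, K, hC, h⟩ := exists_poch_factorial_bound hz
  have he : (1 : ℝ) ≤ Real.exp 1 := Real.one_le_exp zero_le_one
  refine ⟨C * Real.exp 1, K + 1, by positivity, fun n => ?_⟩
  have hs := pochSize_pos n
  have hP : 0 < ‖poch z n‖ := norm_pos_iff.2 (poch_natCast_ne_zero hz n)
  have hn1 : (1 : ℝ) ≤ n + 1 := by simp
  constructor
  · calc ‖poch z n‖ ≤ C * (n + 1) ^ K * n.factorial := (h n).1
      _ ≤ C * (n + 1) ^ K * (Real.exp 1 * (n + 1) * pochSize n) := by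
        gcongr; exact factorial_le_pochSize n
      _ = _ := by ring
  · rw [norm_inv, inv_le_iff_one_le_mul₀ hP]
    have h1 : pochSize n ≤ C * (n + 1) ^ K * ‖poch z n‖ :=
      (pochSize_le_factorial n).trans (h n).2
    have h2 : 1 ≤ Real.exp 1 * ((n : ℝ) + 1) := one_le_mul_of_one_le_of_one_le he hn1
    calc (1 : ℝ) = 1 * (pochSize n * (pochSize n)⁻¹) := by rw [mul_inv_cancel₀ hs.ne', mul_one]
      _ ≤ (Real.exp 1 * ((n : ℝ) + 1)) * ((C * (n + 1) ^ K * ‖poch z n‖) * (pochSize n)⁻¹) := by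
        gcongr
      _ = _ := by ring

/-- For non-integral `z` the comparison of `(z)_k` with `pochSize k` holds for all integers `k`,
by the reflection `(z)_{-n} = (-1) ^ n / (1 - z)_n`. -/
theorem exists_poch_bound {z : ℂ} (hz : ∀ k : ℤ, z ≠ (k : ℂ)) :
    ∃ (C : ℝ) (K : ℕ), 0 < C ∧ ∀ k : ℤ, ‖poch z k‖ ≤ C * (|(k : ℝ)| + 1) ^ K * pochSize k ∧
      ‖(poch z k)⁻¹‖ ≤ C * (|(k : ℝ)| + 1) ^ K * (pochSize k)⁻¹ := by
  obtain ⟨C₁, K₁, hC₁, h₁⟩ := exists_poch_bound_nat (z := z)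
    fun k => by exact_mod_cast hz (-k)
  obtain ⟨C₂, K₂, hC₂, h₂⟩ := exists_poch_bound_nat (z := 1 - z)
    fun k h => hz (k + 1) (by push_cast; linear_combination -h)
  have aux : ∀ n : ℕ, C₁ * ((n : ℝ) + 1) ^ K₁ ≤ (C₁ + C₂) * ((n : ℝ) + 1) ^ (K₁ + K₂) ∧
      C₂ * ((n : ℝ) + 1) ^ K₂ ≤ (C₁ + C₂) * ((n : ℝ) + 1) ^ (K₁ + K₂) := by
    intro n
    have hn1 : (1 : ℝ) ≤ n + 1 := by simp
    constructor
    · gcongr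
      · linarith
      · omega
    · gcongr
      · linarith
      · omega
  refine ⟨C₁ + C₂, K₁ + K₂, by positivity, fun k => ?_⟩
  obtain ⟨n, rfl | rfl⟩ := k.eq_nat_or_neg
  · have hs := pochSize_pos n
    simp only [Int.cast_natCast, Nat.abs_cast]
    exact ⟨(h₁ n).1.trans (mul_le_mul_of_nonneg_right (aux n).1 hs.le),
      (h₁ n).2.trans (mul_le_mul_of_nonneg_right (aux n).1 (inv_nonneg.2 hs.le))⟩
  · have hs := pochSize_pos n
    rw [pochSize_neg, poch_neg_natCast, inv_inv, inv_inv, mul_inv, norm_mul, norm_mul]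
    simp only [Int.cast_neg, Int.cast_natCast, abs_neg, Nat.abs_cast, norm_pow, norm_neg, norm_one,
      one_pow, norm_inv, one_mul, inv_one]
    have h := h₂ n
    rw [norm_inv] at h
    exact ⟨h.2.trans (mul_le_mul_of_nonneg_right (aux n).2 (inv_nonneg.2 hs.le)),
      h.1.trans (mul_le_mul_of_nonneg_right (aux n).2 hs.le)⟩

/-! ### Double power series -/

/-- The sum `∑ A (m, n) X ^ m Y ^ n` of a double power series at `q = (X, Y)`. -/
noncomputable def doubleSeries (A : ℕ × ℕ → ℂ) (q : ℂ × ℂ) : ℂ :=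
  ∑' p : ℕ × ℕ, A p * (q.1 ^ p.1 * q.2 ^ p.2)

/-- The points that lie in an open polydisc on whose distinguished boundary the double power series
with coefficients `A` converges absolutely. -/
def convDomain (A : ℕ × ℕ → ℂ) : Set (ℂ × ℂ) :=
  {q | ∃ r s : ℝ, ‖q.1‖ < r ∧ ‖q.2‖ < s ∧ Summable fun p : ℕ × ℕ => ‖A p‖ * (r ^ p.1 * s ^ p.2)}

theorem isOpen_convDomain (A : ℕ × ℕ → ℂ) : IsOpen (convDomain A) := by
  have : convDomain A = ⋃ (r : ℝ) (s : ℝ)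
      (_ : Summable fun p : ℕ × ℕ => ‖A p‖ * (r ^ p.1 * s ^ p.2)),
      {q : ℂ × ℂ | ‖q.1‖ < r ∧ ‖q.2‖ < s} := by
    ext q
    simp only [convDomain, mem_ofPred_eq, mem_iUnion, exists_prop]
    constructor
    · rintro ⟨r, s, h1, h2, h3⟩; exact ⟨r, s, h3, h1, h2⟩
    · rintro ⟨r, s, h3, h1, h2⟩; exact ⟨r, s, h1, h2, h3⟩
  rw [this]
  refine isOpen_iUnion fun r => isOpen_iUnion fun s => isOpen_iUnion fun _ => ?_
  exact (isOpen_lt (continuous_fst.norm) continuous_const).inter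
    (isOpen_lt (continuous_snd.norm) continuous_const)

theorem summable_of_mem_convDomain {A : ℕ × ℕ → ℂ} {q : ℂ × ℂ} (hq : q ∈ convDomain A) :
    Summable fun p : ℕ × ℕ => A p * (q.1 ^ p.1 * q.2 ^ p.2) := by
  obtain ⟨r, s, hr, hs, h⟩ := hq
  refine Summable.of_norm_bounded h fun p => ?_
  rw [norm_mul, norm_mul, norm_pow, norm_pow]
  have h1 : 0 ≤ r := (norm_nonneg q.1).trans hr.le
  gcongr

/-- The multilinear form on `ℂ × ℂ` whose diagonal is the monomial `X ^ m Y ^ (k - m)`. -/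
noncomputable def monomialForm (m k : ℕ) : ContinuousMultilinearMap ℂ (fun _ : Fin k => ℂ × ℂ) ℂ :=
  (ContinuousMultilinearMap.mkPiAlgebra ℂ (Fin k) ℂ).compContinuousLinearMap fun i =>
    if (i : ℕ) < m then ContinuousLinearMap.fst ℂ ℂ ℂ else ContinuousLinearMap.snd ℂ ℂ ℂ

theorem monomialForm_apply_diag {m n k : ℕ} (h : m + n = k) (v : ℂ × ℂ) :
    monomialForm m k (fun _ => v) = v.1 ^ m * v.2 ^ n := by
  subst h
  simp [monomialForm, Fin.prod_univ_add]

theorem norm_monomialForm_le (m k : ℕ) : ‖monomialForm m k‖ ≤ 1 := by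
  refine ContinuousMultilinearMap.opNorm_le_bound zero_le_one fun v => ?_
  simp only [monomialForm, ContinuousMultilinearMap.compContinuousLinearMap_apply,
    ContinuousMultilinearMap.mkPiAlgebra_apply, norm_prod, one_mul]
  refine Finset.prod_le_prod (fun _ _ => norm_nonneg _) fun i _ => ?_
  split_ifs
  · exact norm_fst_le _
  · exact norm_snd_le _

theorem hasSum_antidiagonal_of_summable {f : ℕ × ℕ → ℂ} (hf : Summable f) :
    HasSum (fun k => ∑ p ∈ Finset.HasAntidiagonal.antidiagonal k, f p) (∑' p, f p) := by
  have h := (Finset.HasAntidiagonal.sigmaAntidiagonalEquivProd (A := ℕ)).hasSum_iff.2 hf.hasSum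
  refine h.sigma fun k => ?_
  have := hasSum_fintype fun c : Finset.HasAntidiagonal.antidiagonal k => f c
  rw [Finset.sum_coe_sort (Finset.HasAntidiagonal.antidiagonal k) f] at this
  exact this

theorem summable_antidiagonal_of_summable {f : ℕ × ℕ → ℝ} (hf : Summable f) :
    Summable (fun k => ∑ p ∈ Finset.HasAntidiagonal.antidiagonal k, f p) := by
  have h := (Finset.HasAntidiagonal.sigmaAntidiagonalEquivProd (A := ℕ)).summable_iff.2 hf
  refine h.sigma.congr fun k => ?_
  rw [tsum_fintype, ← Finset.sum_coe_sort (Finset.HasAntidiagonal.antidiagonal k) f]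
  rfl

theorem HasSum.of_forall_eq {f g : ℕ → ℂ} {a : ℂ} (hf : HasSum f a) (h : ∀ k, g k = f k) :
    HasSum g a := by
  rwa [funext h]

theorem mem_eball_zero_one {y : ℂ × ℂ} : y ∈ Metric.eball (0 : ℂ × ℂ) 1 ↔ ‖y‖ < 1 := by
  rw [← ENNReal.ofReal_one, Metric.eball_ofReal, mem_ball_zero_iff]

/-- An absolutely convergent double power series, grouped by total degree, is a convergent power
series in the variable `(X, Y)`. -/
theorem hasFPowerSeriesOnBall_doubleSeries {A : ℕ × ℕ → ℂ} (hA : Summable fun p => ‖A p‖) :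
    HasFPowerSeriesOnBall (doubleSeries A)
      (fun k => ∑ p ∈ Finset.HasAntidiagonal.antidiagonal k, A p • monomialForm p.1 k) 0 1 where
  r_le := by
    have : Summable fun k => ‖∑ p ∈ Finset.HasAntidiagonal.antidiagonal k, A p • monomialForm p.1 k‖
        * ((1 : NNReal) : ℝ) ^ k := by
      refine Summable.of_nonneg_of_le (fun k => by positivity) (fun k => ?_)
        (summable_antidiagonal_of_summable hA)
      rw [NNReal.coe_one, one_pow, mul_one]
      refine (norm_sum_le _ _).trans (Finset.sum_le_sum fun p _ => ?_)
      rw [norm_smul]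
      exact mul_le_of_le_one_right (norm_nonneg _) (norm_monomialForm_le _ _)
    exact_mod_cast FormalMultilinearSeries.le_radius_of_summable_norm _ this
  r_pos := one_pos
  hasSum := by
    intro y hy
    have hy1 : ‖y‖ < 1 := mem_eball_zero_one.1 hy
    have h1 : ‖y.1‖ ≤ 1 := (norm_fst_le y).trans hy1.le
    have h2 : ‖y.2‖ ≤ 1 := (norm_snd_le y).trans hy1.le
    have hs : Summable fun p : ℕ × ℕ => A p * (y.1 ^ p.1 * y.2 ^ p.2) := by
      refine Summable.of_norm_bounded hA fun p => ?_
      rw [norm_mul, norm_mul, norm_pow, norm_pow]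
      exact mul_le_of_le_one_right (norm_nonneg _)
        (mul_le_one₀ (pow_le_one₀ (norm_nonneg _) h1) (by positivity)
          (pow_le_one₀ (norm_nonneg _) h2))
    have := hasSum_antidiagonal_of_summable hs
    rw [zero_add]
    refine HasSum.of_forall_eq this fun k => ?_
    rw [sum_apply]
    refine Finset.sum_congr rfl fun p hp => ?_
    rw [smul_apply, smul_eq_mul,
      monomialForm_apply_diag (Finset.HasAntidiagonal.mem_antidiagonal.1 hp)]

theorem analyticAt_doubleSeries {A : ℕ × ℕ → ℂ} {q : ℂ × ℂ} (hq : q ∈ convDomain A) :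
    AnalyticAt ℂ (doubleSeries A) q := by
  obtain ⟨r, s, hr, hs, h⟩ := hq
  have hr0 : 0 < r := (norm_nonneg _).trans_lt hr
  have hs0 : 0 < s := (norm_nonneg _).trans_lt hs
  have hrc : (r : ℂ) ≠ 0 := by exact_mod_cast hr0.ne'
  have hsc : (s : ℂ) ≠ 0 := by exact_mod_cast hs0.ne'
  -- rescaling the polydisc to the unit polydisc
  set A' : ℕ × ℕ → ℂ := fun p => A p * ((r : ℂ) ^ p.1 * (s : ℂ) ^ p.2) with hA'
  have hA's : Summable fun p => ‖A' p‖ := by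
    refine h.congr fun p => ?_
    simp [hA', abs_of_pos hr0, abs_of_pos hs0]
  have hscale : doubleSeries A = fun q => doubleSeries A' (q.1 / r, q.2 / s) := by
    funext q
    refine tsum_congr fun p => ?_
    simp only [hA', div_pow]
    field_simp
  rw [hscale]
  have hball := (hasFPowerSeriesOnBall_doubleSeries hA's).analyticOnNhd
  have hmem : (q.1 / r, q.2 / s) ∈ Metric.eball (0 : ℂ × ℂ) 1 := by
    have : ‖((q.1 / r, q.2 / s) : ℂ × ℂ)‖ < 1 := by
      rw [Prod.norm_def, max_lt_iff]
      simp only [norm_div, norm_real, Real.norm_eq_abs, abs_of_pos hr0, abs_of_pos hs0]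
      exact ⟨(div_lt_one hr0).2 hr, (div_lt_one hs0).2 hs⟩
    exact mem_eball_zero_one.2 this
  exact (hball _ hmem).fun_comp (f := fun q : ℂ × ℂ => (q.1 / (r : ℂ), q.2 / (s : ℂ)))
    ((analyticAt_fst.div analyticAt_const hrc).prod (analyticAt_snd.div analyticAt_const hsc))

/-! ### Coefficients of exponential growth -/

/-- `f (m, n)` is bounded by `exp (e (m, n))` up to a polynomial factor in `m + n`. -/
def PolyExpBound (f : ℕ × ℕ → ℂ) (e : ℕ × ℕ → ℝ) : Prop :=
  ∃ (C : ℝ) (K : ℕ), 0 ≤ C ∧ ∀ p : ℕ × ℕ, ‖f p‖ ≤ C * ((p.1 : ℝ) + p.2 + 1) ^ K * Real.exp (e p)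

theorem PolyExpBound.mul {f g : ℕ × ℕ → ℂ} {e d : ℕ × ℕ → ℝ} (hf : PolyExpBound f e)
    (hg : PolyExpBound g d) : PolyExpBound (fun p => f p * g p) (fun p => e p + d p) := by
  obtain ⟨C, K, hC, h⟩ := hf
  obtain ⟨C', K', hC', h'⟩ := hg
  refine ⟨C * C', K + K', by positivity, fun p => ?_⟩
  rw [norm_mul, Real.exp_add]
  calc ‖f p‖ * ‖g p‖ ≤ (C * ((p.1 : ℝ) + p.2 + 1) ^ K * Real.exp (e p)) *
        (C' * ((p.1 : ℝ) + p.2 + 1) ^ K' * Real.exp (d p)) :=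
        mul_le_mul (h p) (h' p) (norm_nonneg _) (by positivity)
    _ = _ := by ring

theorem PolyExpBound.congr {f g : ℕ × ℕ → ℂ} {e d : ℕ × ℕ → ℝ} (hf : PolyExpBound f e)
    (hfg : ∀ p, g p = f p) (hed : ∀ p, d p = e p) : PolyExpBound g d := by
  rwa [funext hfg, funext hed]

theorem polyExpBound_of_bound {f : ℕ × ℕ → ℂ} {k : ℕ × ℕ → ℤ} {e : ℕ × ℕ → ℝ} {N : ℕ}
    (hk : ∀ p, |(k p : ℝ)| ≤ N * ((p.1 : ℝ) + p.2))
    (h : ∃ (C : ℝ) (K : ℕ), 0 < C ∧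
      ∀ p, ‖f p‖ ≤ C * (|(k p : ℝ)| + 1) ^ K * Real.exp (e p)) : PolyExpBound f e := by
  obtain ⟨C, K, hC, h⟩ := h
  refine ⟨C * (N + 1) ^ K, K, by positivity, fun p => (h p).trans ?_⟩
  have : |(k p : ℝ)| + 1 ≤ (N + 1) * ((p.1 : ℝ) + p.2 + 1) := by
    have h1 : (0 : ℝ) ≤ (p.1 : ℝ) + p.2 := by positivity
    have h2 : (0 : ℝ) ≤ N := by positivity
    nlinarith [hk p]
  calc C * (|(k p : ℝ)| + 1) ^ K * Real.exp (e p)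
      ≤ C * ((N + 1) * ((p.1 : ℝ) + p.2 + 1)) ^ K * Real.exp (e p) := by gcongr
    _ = _ := by rw [mul_pow]; ring

theorem polyExpBound_poch {z : ℂ} (hz : ∀ k : ℤ, z ≠ (k : ℂ)) (k : ℕ × ℕ → ℤ) (N : ℕ)
    (hk : ∀ p, |(k p : ℝ)| ≤ N * ((p.1 : ℝ) + p.2)) :
    PolyExpBound (fun p => poch z (k p)) (fun p => (k p : ℝ) * Real.log (k p) - k p) := by
  obtain ⟨C, K, hC, h⟩ := exists_poch_bound hz
  exact polyExpBound_of_bound hk ⟨C, K, hC, fun p => (h (k p)).1⟩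

theorem polyExpBound_poch_inv {z : ℂ} (hz : ∀ k : ℤ, z ≠ (k : ℂ)) (k : ℕ × ℕ → ℤ) (N : ℕ)
    (hk : ∀ p, |(k p : ℝ)| ≤ N * ((p.1 : ℝ) + p.2)) :
    PolyExpBound (fun p => (poch z (k p))⁻¹) (fun p => -((k p : ℝ) * Real.log (k p) - k p)) := by
  obtain ⟨C, K, hC, h⟩ := exists_poch_bound hz
  refine polyExpBound_of_bound hk ⟨C, K, hC, fun p => ?_⟩
  have := (h (k p)).2
  rwa [pochSize, ← Real.exp_neg] at this

theorem polyExpBound_poch_nat {z : ℂ} (hz : ∀ k : ℕ, z ≠ -(k : ℂ)) (k : ℕ × ℕ → ℕ) (N : ℕ)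
    (hk : ∀ p, (k p : ℝ) ≤ N * ((p.1 : ℝ) + p.2)) :
    PolyExpBound (fun p => poch z (k p)) (fun p => (k p : ℝ) * Real.log (k p) - k p) := by
  obtain ⟨C, K, hC, h⟩ := exists_poch_bound_nat hz
  refine polyExpBound_of_bound (k := fun p => k p) (N := N) (by simpa using hk)
    ⟨C, K, hC, fun p => ?_⟩
  simpa [pochSize] using (h (k p)).1

theorem polyExpBound_poch_nat_inv {z : ℂ} (hz : ∀ k : ℕ, z ≠ -(k : ℂ)) (k : ℕ × ℕ → ℕ) (N : ℕ)
    (hk : ∀ p, (k p : ℝ) ≤ N * ((p.1 : ℝ) + p.2)) :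
    PolyExpBound (fun p => (poch z (k p))⁻¹) (fun p => -((k p : ℝ) * Real.log (k p) - k p)) := by
  obtain ⟨C, K, hC, h⟩ := exists_poch_bound_nat hz
  refine polyExpBound_of_bound (k := fun p => k p) (N := N) (by simpa using hk)
    ⟨C, K, hC, fun p => ?_⟩
  have := (h (k p)).2
  rw [pochSize, ← Real.exp_neg] at this
  simpa using this

theorem summable_succ_pow_mul_exp (K : ℕ) {δ : ℝ} (hδ : 0 < δ) :
    Summable fun n : ℕ => ((n : ℝ) + 1) ^ K * Real.exp (-(δ * n)) := by
  have h1 : ‖Real.exp (-δ)‖ < 1 := by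
    rw [Real.norm_eq_abs, Real.abs_exp, Real.exp_lt_one_iff]; linarith
  have h2 := (summable_nat_add_iff (f := fun n : ℕ => (n : ℝ) ^ K * Real.exp (-δ) ^ n) 1).2
    (summable_pow_mul_geometric_of_norm_lt_one K h1)
  refine (h2.mul_right (Real.exp δ)).congr fun n => ?_
  have h3 : Real.exp (-δ) ^ (n + 1) * Real.exp δ = Real.exp (-(δ * n)) := by
    rw [← Real.exp_nat_mul, ← Real.exp_add]
    congr 1
    push_cast
    ring
  rw [mul_assoc, h3, Nat.cast_add_one]

theorem summable_polynomial_mul_exp (K : ℕ) {δ : ℝ} (hδ : 0 < δ) :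
    Summable fun p : ℕ × ℕ => ((p.1 : ℝ) + p.2 + 1) ^ K * Real.exp (-(δ * (p.1 + p.2))) := by
  have h := summable_succ_pow_mul_exp K hδ
  refine Summable.of_nonneg_of_le (fun p => by positivity) (fun p => ?_)
    (h.mul_of_nonneg h (fun n => by positivity) (fun n => by positivity))
  have h1 : ((p.1 : ℝ) + p.2 + 1) ≤ (p.1 + 1) * (p.2 + 1) := by
    have : (0 : ℝ) ≤ (p.1 : ℝ) * p.2 := by positivity
    nlinarith
  calc ((p.1 : ℝ) + p.2 + 1) ^ K * Real.exp (-(δ * (p.1 + p.2)))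
      ≤ (((p.1 : ℝ) + 1) * (p.2 + 1)) ^ K * Real.exp (-(δ * (p.1 + p.2))) := by gcongr
    _ = _ := by
      rw [mul_pow, show -(δ * ((p.1 : ℝ) + p.2)) = -(δ * p.1) + -(δ * p.2) by ring, Real.exp_add]
      ring

/-- If the coefficients of a double power series grow like `exp (E (m, n))` with `E` continuous and
homogeneous of degree one, the series converges absolutely at `(r, s)`, and in a neighbourhood of
the closed polydisc of these radii, as soon as `E (μ, ν) + μ log r + ν log s` is negative in every
direction `(μ, ν)`: by compactness it is then at most `-δ (μ + ν)`. -/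
theorem mem_convDomain_of_exponent_neg {A : ℕ × ℕ → ℂ} {E : ℝ → ℝ → ℝ}
    (hA : PolyExpBound A fun p => E p.1 p.2) (hcont : Continuous fun v : ℝ × ℝ => E v.1 v.2)
    (hhom : ∀ t μ ν : ℝ, 0 < t → E (t * μ) (t * ν) = t * E μ ν) {r s : ℝ} (hr : 0 < r) (hs : 0 < s)
    (hneg : ∀ μ ν : ℝ, 0 ≤ μ → 0 ≤ ν → 0 < μ + ν → E μ ν + μ * Real.log r + ν * Real.log s < 0)
    {q : ℂ × ℂ} (hq₁ : ‖q.1‖ ≤ r) (hq₂ : ‖q.2‖ ≤ s) : q ∈ convDomain A := by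
  obtain ⟨C, K, hC, hA⟩ := hA
  set F : ℝ × ℝ → ℝ := fun v => E v.1 v.2 + v.1 * Real.log r + v.2 * Real.log s with hF
  have hFc : Continuous F := by fun_prop
  set S : Set (ℝ × ℝ) := (fun t : ℝ => (t, 1 - t)) '' Icc 0 1 with hS
  have hSc : IsCompact S := isCompact_Icc.image (by fun_prop)
  have hSn : S.Nonempty := (nonempty_Icc.2 zero_le_one).image _
  obtain ⟨v, ⟨t, ht, rfl⟩, hmax⟩ := hSc.exists_isMaxOn hSn hFc.continuousOn
  obtain ⟨δ, hδ, hFv⟩ : ∃ δ > 0, F (t, 1 - t) = -δ :=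
    ⟨-F (t, 1 - t), by
      have := hneg t (1 - t) ht.1 (by linarith [ht.2]) (by linarith)
      simp only [hF]; linarith, by simp⟩
  have hE0 : E 0 0 = 0 := by
    have := hhom 2 0 0 two_pos
    rw [mul_zero] at this; linarith
  have hle : ∀ μ ν : ℝ, 0 ≤ μ → 0 ≤ ν → F (μ, ν) ≤ -δ * (μ + ν) := by
    intro μ ν hμ hν
    rcases (add_nonneg hμ hν).eq_or_lt with h0 | h0
    · have h1 : μ = 0 := by linarith
      have h2 : ν = 0 := by linarith
      simp [hF, h1, h2, hE0]
    · have hmem : (μ / (μ + ν), ν / (μ + ν)) ∈ S :=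
        ⟨μ / (μ + ν), ⟨by positivity, by rw [div_le_one h0]; linarith⟩, by
          simp only [Prod.mk.injEq, true_and]; field_simp; ring⟩
      have h1 := hmax hmem
      simp only [mem_ofPred_eq] at h1
      rw [hFv] at h1
      have h2 : F (μ, ν) = (μ + ν) * F (μ / (μ + ν), ν / (μ + ν)) := by
        simp only [hF]
        rw [mul_add, mul_add, ← hhom _ _ _ h0]
        field_simp
      rw [h2]; nlinarith
  refine ⟨r * Real.exp (δ / 2), s * Real.exp (δ / 2), ?_, ?_, ?_⟩
  · exact hq₁.trans_lt (lt_mul_of_one_lt_right hr (Real.one_lt_exp_iff.2 (by linarith)))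
  · exact hq₂.trans_lt (lt_mul_of_one_lt_right hs (Real.one_lt_exp_iff.2 (by linarith)))
  · refine Summable.of_nonneg_of_le (fun p => by positivity) (fun p => ?_)
      ((summable_polynomial_mul_exp K (half_pos hδ)).mul_left C)
    have hpow : (r * Real.exp (δ / 2)) ^ p.1 * (s * Real.exp (δ / 2)) ^ p.2 =
        Real.exp (p.1 * (Real.log r + δ / 2) + p.2 * (Real.log s + δ / 2)) := by
      rw [Real.exp_add, Real.exp_nat_mul, Real.exp_nat_mul, Real.exp_add, Real.exp_add,
        Real.exp_log hr, Real.exp_log hs]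
    rw [hpow]
    calc ‖A p‖ * _ ≤ (C * ((p.1 : ℝ) + p.2 + 1) ^ K * Real.exp (E p.1 p.2)) * _ :=
          mul_le_mul_of_nonneg_right (hA p) (Real.exp_pos _).le
      _ = C * (((p.1 : ℝ) + p.2 + 1) ^ K * Real.exp (E p.1 p.2 +
            (p.1 * (Real.log r + δ / 2) + p.2 * (Real.log s + δ / 2)))) := by
          rw [Real.exp_add (E _ _)]; ring
      _ ≤ _ := by
          gcongr
          have := hle p.1 p.2 (by positivity) (by positivity)
          simp only [hF] at this
          linarith

/-! ### Entropy estimates -/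

/-- The function `x log |x|`. -/
noncomputable def mulLog (x : ℝ) : ℝ := x * Real.log x

theorem continuous_mulLog : Continuous mulLog := Real.continuous_mul_log

theorem mulLog_neg (x : ℝ) : mulLog (-x) = -mulLog x := by
  simp [mulLog, Real.log_neg_eq_log]

@[simp] theorem mulLog_zero : mulLog 0 = 0 := by simp [mulLog]

@[simp] theorem mulLog_one : mulLog 1 = 0 := by simp [mulLog]

theorem mulLog_mul {t : ℝ} (ht : 0 < t) (x : ℝ) :
    mulLog (t * x) = t * mulLog x + t * x * Real.log t := by
  rcases eq_or_ne x 0 with rfl | hx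
  · simp
  · rw [mulLog, mulLog, Real.log_mul ht.ne' hx]; ring

theorem hasDerivAt_mulLog {x : ℝ} (hx : x ≠ 0) : HasDerivAt mulLog (Real.log x + 1) x :=
  Real.hasDerivAt_mul_log hx

/-- Gibbs' inequality, for a single term. Summed over parts `x` of `X` with weights `p` of sum
one, it bounds a multinomial coefficient by the reciprocal of its weight. -/
theorem mul_log_sub_mulLog_le {x X p : ℝ} (hx : 0 ≤ x) (hX : 0 < X) (hp : 0 < p) :
    x * Real.log X - mulLog x ≤ p * X - x - x * Real.log p := by
  rcases hx.eq_or_lt with rfl | hx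
  · simp; positivity
  · have h := Real.log_le_sub_one_of_pos (show 0 < p * X / x by positivity)
    rw [Real.log_div (by positivity) hx.ne', Real.log_mul hp.ne' hX.ne'] at h
    have h2 : x * (Real.log p + Real.log X - Real.log x) ≤ x * (p * X / x - 1) := by gcongr
    have h3 : x * (p * X / x - 1) = p * X - x := by field_simp
    rw [mulLog]; linarith

/-- A function that increases on `[a, t₀]`, decreases on `[t₀, t₁]` and increases on `[t₁, b]`
is bounded by its values at `t₀` and `b`. -/
theorem le_max_of_deriv_sign {g g' : ℝ → ℝ} {a b t₀ t₁ : ℝ} (hc : Continuous g)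
    (hd : ∀ x ∈ Ioo a b, HasDerivAt g (g' x) x) (h₀ : a ≤ t₀) (h₀₁ : t₀ ≤ t₁) (h₁ : t₁ ≤ b)
    (hs₀ : ∀ x ∈ Ioo a t₀, 0 ≤ g' x) (hs₁ : ∀ x ∈ Ioo t₀ t₁, g' x ≤ 0)
    (hs₂ : ∀ x ∈ Ioo t₁ b, 0 ≤ g' x) {x : ℝ} (hx : x ∈ Icc a b) : g x ≤ max (g t₀) (g b) := by
  have hd' : ∀ u v, a ≤ u → v ≤ b → ∀ x ∈ Ioo u v, HasDerivAt g (g' x) x :=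
    fun u v hu hv x hx => hd x ⟨hu.trans_lt hx.1, hx.2.trans_le hv⟩
  have mono : ∀ u v, a ≤ u → v ≤ b → (∀ x ∈ Ioo u v, 0 ≤ g' x) → MonotoneOn g (Icc u v) := by
    intro u v hu hv h
    refine monotoneOn_of_hasDerivWithinAt_nonneg (convex_Icc u v) hc.continuousOn
      (f' := g') (fun x hx => ?_) fun x hx => ?_
    · rw [interior_Icc] at hx
      exact (hd' u v hu hv x hx).hasDerivWithinAt
    · rw [interior_Icc] at hx
      exact h x hx
  have anti : AntitoneOn g (Icc t₀ t₁) := by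
    refine antitoneOn_of_hasDerivWithinAt_nonpos (convex_Icc t₀ t₁) hc.continuousOn
      (f' := g') (fun x hx => ?_) fun x hx => ?_
    · rw [interior_Icc] at hx
      exact (hd' _ _ h₀ h₁ x hx).hasDerivWithinAt
    · rw [interior_Icc] at hx
      exact hs₁ x hx
  rcases le_total x t₀ with h | h
  · exact le_max_of_le_left (mono a t₀ le_rfl (h₀₁.trans h₁) hs₀ ⟨hx.1, h⟩ ⟨h₀, le_rfl⟩ h)
  rcases le_total x t₁ with h' | h'
  · exact le_max_of_le_left (anti ⟨le_rfl, h₀₁⟩ ⟨h, h'⟩ h)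
  · exact le_max_of_le_right
      (mono t₁ b (h₀.trans h₀₁) le_rfl hs₂ ⟨h', hx.2⟩ ⟨h₁, le_rfl⟩ hx.2)

theorem rpow_three_halves_of_sq {x w : ℝ} (hw : 0 ≤ w) (h : x = w ^ 2) :
    x ^ (3 / 2 : ℝ) = w ^ 3 := by
  rw [h, ← Real.rpow_natCast w 2, ← Real.rpow_mul hw, ← Real.rpow_natCast w 3]
  norm_num

/-! ### The exponents of `H₅` -/

/-- The exponential growth rate of the coefficients of `H₅` in the direction `(μ, ν)`. -/
noncomputable def hornExponent (μ ν : ℝ) : ℝ :=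
  mulLog (2 * μ + ν) + mulLog (ν - μ) - mulLog ν - mulLog μ - mulLog ν

theorem hornExponent_mul {t : ℝ} (ht : 0 < t) (μ ν : ℝ) :
    hornExponent (t * μ) (t * ν) = t * hornExponent μ ν := by
  rw [hornExponent, hornExponent, show 2 * (t * μ) + t * ν = t * (2 * μ + ν) by ring,
    show t * ν - t * μ = t * (ν - μ) by ring, mulLog_mul ht, mulLog_mul ht, mulLog_mul ht,
    mulLog_mul ht]
  ring

/-- The directions `ν ≤ μ`: by Gibbs' inequality with the weights `p, p, q, t` for the parts
`ν, ν, μ, μ - ν` of `2 μ + ν`. Here `r = q t` and `s = p ^ 2 / t` parametrize the curve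
`s = γ(r)`. -/
theorem hornExponent_neg_of_le {r s : ℝ} {t p q : ℝ} (ht : 0 < t) (hp : 0 < p) (hq : 0 < q)
    (hpqt : 2 * p + q + t = 1) (hr : r = q * t) (hs0 : 0 < s) (hs : s < p ^ 2 / t)
    (hr4 : r < 1 / 4) {μ ν : ℝ} (hν : 0 ≤ ν) (hνμ : ν ≤ μ) (hμ : 0 < μ) :
    hornExponent μ ν + μ * Real.log r + ν * Real.log s < 0 := by
  have hr0 : 0 < r := by rw [hr]; positivity
  rcases hν.eq_or_lt with rfl | hν
  · have h1 : mulLog (2 * μ) = 2 * mulLog μ + 2 * μ * Real.log 2 := mulLog_mul two_pos μ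
    have h2 : 2 * Real.log 2 + Real.log r < 0 := by
      have : Real.log (4 * r) < 0 := Real.log_neg (by positivity) (by linarith)
      rw [Real.log_mul (by norm_num) hr0.ne', show (4 : ℝ) = 2 ^ 2 by norm_num,
        Real.log_pow] at this
      simpa using this
    simp only [hornExponent, add_zero, zero_sub, mulLog_neg, h1, mulLog_zero]
    nlinarith
  · have hX : 0 < 2 * μ + ν := by positivity
    have e1 := mul_log_sub_mulLog_le hν.le hX hp
    have e2 := mul_log_sub_mulLog_le hμ.le hX hq
    have e3 := mul_log_sub_mulLog_le (sub_nonneg.2 hνμ) hX ht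
    have e4 : mulLog (ν - μ) = -mulLog (μ - ν) := by rw [← mulLog_neg, neg_sub]
    have e5 : p * (2 * μ + ν) + p * (2 * μ + ν) + q * (2 * μ + ν) + t * (2 * μ + ν) =
        2 * μ + ν := by
      linear_combination (2 * μ + ν) * hpqt
    have e6 : Real.log r = Real.log q + Real.log t := by rw [hr, Real.log_mul hq.ne' ht.ne']
    have e7 : Real.log s < 2 * Real.log p - Real.log t := by
      have := Real.log_lt_log hs0 hs
      rw [Real.log_div (by positivity) ht.ne', Real.log_pow] at this
      exact_mod_cast this
    have e8 : ν * Real.log s < ν * (2 * Real.log p - Real.log t) := by gcongr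
    rw [hornExponent, e4, e6]
    have e9 : mulLog (2 * μ + ν) = (2 * μ + ν) * Real.log (2 * μ + ν) := rfl
    rw [e9]
    linarith

theorem hornExponent_one_deriv {τ : ℝ} (h0 : 0 < τ) (h1 : τ < 1) (r s : ℝ) :
    HasDerivAt (fun τ => hornExponent τ 1 + τ * Real.log r + 1 * Real.log s)
      (2 * Real.log (2 * τ + 1) + Real.log r - (Real.log (1 - τ) + Real.log τ)) τ := by
  have d1 : HasDerivAt (fun τ => mulLog (2 * τ + 1)) ((Real.log (2 * τ + 1) + 1) * 2) τ :=
    (hasDerivAt_mulLog (by positivity)).comp τ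
      (by simpa using ((hasDerivAt_id τ).const_mul 2).add_const 1)
  have d2 : HasDerivAt (fun τ => mulLog (1 - τ)) ((Real.log (1 - τ) + 1) * (-1)) τ :=
    (hasDerivAt_mulLog (by linarith)).comp τ (by simpa using (hasDerivAt_id τ).const_sub 1)
  have d3 := hasDerivAt_mulLog h0.ne'
  have d4 : HasDerivAt (fun τ : ℝ => τ * Real.log r) (Real.log r) τ := by
    simpa using (hasDerivAt_id τ).mul_const (Real.log r)
  have := ((((((d1.add d2).sub_const (mulLog 1)).sub d3).sub_const (mulLog 1)).add d4).add_const
    (1 * Real.log s))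
  refine this.congr_deriv ?_
  ring

theorem continuous_hornExponent : Continuous fun v : ℝ × ℝ => hornExponent v.1 v.2 := by
  have := continuous_mulLog
  unfold hornExponent
  fun_prop

/-- The directions `μ = τ ≤ ν = 1`: on this segment the exponent is largest at `τ = 1`, where it is
`log (27 r s)`, or at the smaller root `t₀` of `(1 + 2 τ) ^ 2 r = τ (1 - τ)`, where its sign is
decided by the first part of the bound, written in terms of `w = √(1 - 12 r)`. -/
theorem hornExponent_one_neg {r s : ℝ} (hr0 : 0 < r) (hs0 : 0 < s) (hrs : 27 * r * s < 1)
    (hsw : ∀ w : ℝ, 0 < w → w < 1 → 1 - 12 * r = w ^ 2 → s < 2 * (2 + w) ^ 2 / (9 * (1 + w)))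
    {τ : ℝ} (hτ : τ ∈ Icc (0 : ℝ) 1) :
    hornExponent τ 1 + τ * Real.log r + 1 * Real.log s < 0 := by
  set g : ℝ → ℝ := fun τ => hornExponent τ 1 + τ * Real.log r + 1 * Real.log s with hg
  have hgc : Continuous g := by
    have := continuous_hornExponent.comp
      (Continuous.prodMk continuous_id (continuous_const (y := (1 : ℝ))))
    simp only [Function.comp_def, id] at this
    fun_prop
  have hd : ∀ x ∈ Ioo (0 : ℝ) 1, HasDerivAt g _ x := fun x hx =>
    hornExponent_one_deriv hx.1 hx.2 r s
  have hsign : ∀ x ∈ Ioo (0 : ℝ) 1,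
      2 * Real.log (2 * x + 1) + Real.log r - (Real.log (1 - x) + Real.log x) =
        Real.log ((2 * x + 1) ^ 2 * r) - Real.log ((1 - x) * x) := by
    intro x hx
    have : 0 < 1 - x := by linarith [hx.2]
    have := hx.1
    rw [Real.log_mul (by positivity) hr0.ne', Real.log_mul (by positivity) (by positivity),
      Real.log_pow]
    norm_num
  have hpos : ∀ x ∈ Ioo (0 : ℝ) 1, (1 - x) * x ≤ (2 * x + 1) ^ 2 * r →
      0 ≤ 2 * Real.log (2 * x + 1) + Real.log r - (Real.log (1 - x) + Real.log x) := by
    intro x hx h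
    rw [hsign x hx, sub_nonneg]
    exact Real.log_le_log (mul_pos (by linarith [hx.2]) hx.1) h
  have hneg : ∀ x ∈ Ioo (0 : ℝ) 1, (2 * x + 1) ^ 2 * r ≤ (1 - x) * x →
      2 * Real.log (2 * x + 1) + Real.log r - (Real.log (1 - x) + Real.log x) ≤ 0 := by
    intro x hx h
    have := hx.1
    rw [hsign x hx, sub_nonpos]
    exact Real.log_le_log (by positivity) h
  have hg1 : g 1 < 0 := by
    have h1 : g 1 = Real.log (27 * r * s) := by
      rw [Real.log_mul (by positivity) hs0.ne', Real.log_mul (by norm_num) hr0.ne',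
        show (27 : ℝ) = 3 ^ 3 by norm_num, Real.log_pow]
      simp only [hg, hornExponent, mulLog]
      norm_num
    rw [h1]
    exact Real.log_neg (by positivity) hrs
  -- for `r ≥ 1 / 12` the derivative is nowhere negative
  rcases le_or_gt (1 / 12) r with hr | hr
  · have := le_max_of_deriv_sign hgc hd zero_le_one le_rfl le_rfl
      (fun x hx => hpos x hx (by nlinarith [sq_nonneg (4 * x - 1)])) (by simp) (by simp) hτ
    exact this.trans_lt (by simpa using hg1)
  · obtain ⟨w, hw0, hw⟩ : ∃ w : ℝ, 0 < w ∧ 1 - 12 * r = w ^ 2 :=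
      ⟨√(1 - 12 * r), Real.sqrt_pos.2 (by linarith), (Real.sq_sqrt (by linarith)).symm⟩
    have hw1 : w < 1 := by nlinarith
    have hsw := hsw w hw0 hw1 hw
    have hrw : r = (1 - w ^ 2) / 12 := by linarith
    set t₀ := (1 - w) / (2 * (2 + w)) with ht₀
    set t₁ := (1 + w) / (2 * (2 - w)) with ht₁
    have h2w : 0 < 2 - w := by linarith
    have hfac : ∀ x : ℝ, (2 * x + 1) ^ 2 * r - (1 - x) * x =
        (4 - w ^ 2) / 3 * ((x - t₀) * (x - t₁)) := by
      intro x
      rw [hrw, ht₀, ht₁]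
      field_simp
      ring
    have h4 : 0 < (4 - w ^ 2) / 3 := by nlinarith
    have ht0 : 0 < t₀ := div_pos (by linarith) (by linarith)
    have ht01 : t₀ ≤ t₁ := by
      rw [ht₀, ht₁, div_le_div_iff₀ (by linarith) (by linarith)]; nlinarith
    have ht1 : t₁ ≤ 1 := by rw [ht₁, div_le_one (by linarith)]; linarith
    have ht0' : t₀ < 1 := by rw [ht₀, div_lt_one (by linarith)]; linarith
    have key := le_max_of_deriv_sign hgc hd ht0.le ht01 ht1
      (fun x hx => hpos x ⟨hx.1, hx.2.trans ht0'⟩ (by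
        have := mul_nonneg_of_nonpos_of_nonpos (by linarith [hx.2] : x - t₀ ≤ 0)
          (by linarith [hx.2] : x - t₁ ≤ 0)
        nlinarith [hfac x]))
      (fun x hx => hneg x ⟨ht0.trans hx.1, hx.2.trans_le ht1⟩ (by
        have := mul_nonneg (by linarith [hx.1] : 0 ≤ x - t₀) (by linarith [hx.2] : 0 ≤ t₁ - x)
        nlinarith [hfac x]))
      (fun x hx => hpos x ⟨(ht0.trans_le ht01).trans hx.1, hx.2⟩ (by
        have := mul_nonneg (by linarith [hx.1] : 0 ≤ x - t₀) (by linarith [hx.1] : 0 ≤ x - t₁)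
        nlinarith [hfac x])) hτ
    refine key.trans_lt (max_lt ?_ hg1)
    have h1 : 0 < 1 - t₀ := by linarith
    have h2 : (2 * t₀ + 1) ^ 2 * r = (1 - t₀) * t₀ := by
      have := hfac t₀; rw [sub_self, zero_mul, mul_zero] at this; linarith
    have h3 : 2 * Real.log (2 * t₀ + 1) + Real.log r = Real.log (1 - t₀) + Real.log t₀ := by
      have := hsign t₀ ⟨ht0, ht0'⟩
      rw [h2, sub_self] at this; linarith
    have h4 : g t₀ = Real.log (s * ((2 * t₀ + 1) * (1 - t₀))) := by
      rw [Real.log_mul hs0.ne' (by positivity), Real.log_mul (by positivity) h1.ne']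
      simp only [hg, hornExponent, mulLog, Real.log_one]
      linear_combination t₀ * h3
    rw [h4]
    refine Real.log_neg (by positivity) ?_
    have h5 : (2 * t₀ + 1) * (1 - t₀) = 9 * (1 + w) / (2 * (2 + w) ^ 2) := by
      rw [ht₀]; field_simp; ring
    rw [h5, ← mul_div_assoc, div_lt_one (by positivity)]
    rwa [lt_div_iff₀ (by positivity)] at hsw

theorem hornExponent_neg {r s : ℝ} (hr0 : 0 < r) (hr : r < 1 / 4) (hs0 : 0 < s)
    (hs : s < hornH5Bound r) {μ ν : ℝ} (hμ : 0 ≤ μ) (hν : 0 ≤ ν) (hμν : 0 < μ + ν) :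
    hornExponent μ ν + μ * Real.log r + ν * Real.log s < 0 := by
  -- the parametrization of the last part of the bound
  obtain ⟨t, ht0, htr⟩ : ∃ t : ℝ, 0 < t ∧ 12 * r + 1 = (1 + 2 * t) ^ 2 := by
    refine ⟨(√(12 * r + 1) - 1) / 2, ?_, ?_⟩
    · have : 1 < √(12 * r + 1) := by rw [Real.lt_sqrt zero_le_one]; linarith
      linarith
    · rw [show 1 + 2 * ((√(12 * r + 1) - 1) / 2) = √(12 * r + 1) by ring,
        Real.sq_sqrt (by linarith)]
  have ht2 : t < 1 / 2 := by nlinarith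
  have hrt : r = (1 + t) / 3 * t := by nlinarith
  have hγ : ((12 * r + 1) ^ (3 / 2 : ℝ) - 36 * r + 1) / (54 * r) = ((1 - 2 * t) / 3) ^ 2 / t := by
    rw [rpow_three_halves_of_sq (by linarith) htr, hrt]
    field_simp
    ring
  have hs1 : s < ((1 - 2 * t) / 3) ^ 2 / t := by
    rw [← hγ]
    refine hs.trans_le ?_
    rw [hornH5Bound]
    split_ifs
    · exact min_le_right _ _
    · exact le_rfl
  have hrs : 27 * r * s < 1 := by
    rw [lt_div_iff₀ ht0] at hs1
    calc 27 * r * s = 9 * (1 + t) * (s * t) := by rw [hrt]; ring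
      _ < 9 * (1 + t) * ((1 - 2 * t) / 3) ^ 2 := by gcongr
      _ ≤ 1 := by nlinarith [mul_pos ht0 ht0]
  rcases le_or_gt ν μ with h | h
  · exact hornExponent_neg_of_le ht0 (by linarith : 0 < (1 - 2 * t) / 3)
      (by linarith : 0 < (1 + t) / 3) (by ring) hrt hs0 hs1 hr hν h (by linarith)
  · have hν0 : 0 < ν := hμ.trans_lt h
    have hw : ∀ w : ℝ, 0 < w → w < 1 → 1 - 12 * r = w ^ 2 →
        s < 2 * (2 + w) ^ 2 / (9 * (1 + w)) := by
      intro w hw0 hw1 hw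
      have hcond : √r < 1 / (2 * √3) := by
        rw [Real.sqrt_lt' (by positivity), div_pow, mul_pow, Real.sq_sqrt (by norm_num)]
        nlinarith
      rw [hornH5Bound, if_pos hcond] at hs
      have h1 := hs.trans_le ((min_le_left _ _).trans (min_le_left _ _))
      rw [rpow_three_halves_of_sq hw0.le hw, show r = (1 - w ^ 2) / 12 by linarith] at h1
      refine h1.trans_eq ?_
      have : 1 - w ≠ 0 := by linarith
      have h3 : 1 - w ^ 2 = (1 - w) * (1 + w) := by ring
      rw [h3]
      field_simp
      ring
    have h1 := hornExponent_one_neg hr0 hs0 hrs hw (τ := μ / ν)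
      ⟨by positivity, by rw [div_le_one hν0]; exact h.le⟩
    have h2 : hornExponent μ ν = ν * hornExponent (μ / ν) 1 := by
      rw [← hornExponent_mul hν0]; congr 1 <;> field_simp
    have h3 : hornExponent μ ν + μ * Real.log r + ν * Real.log s =
        ν * (hornExponent (μ / ν) 1 + μ / ν * Real.log r + 1 * Real.log s) := by
      rw [h2]; field_simp
    rw [h3]
    exact mul_neg_of_pos_of_neg hν0 h1

/-! ### The exponents of the first series around `(0, 1)` -/

/-- The exponential growth rate of the coefficients of the first series around `(0, 1)` in the
direction `(μ, ν)`. -/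
noncomputable def firstExponent (μ ν : ℝ) : ℝ :=
  mulLog (2 * μ) + mulLog (2 * μ + ν) + mulLog (ν - μ) - mulLog μ - mulLog (μ + ν) - mulLog μ
    - mulLog ν

theorem firstExponent_mul {t : ℝ} (ht : 0 < t) (μ ν : ℝ) :
    firstExponent (t * μ) (t * ν) = t * firstExponent μ ν := by
  rw [firstExponent, firstExponent, show 2 * (t * μ) + t * ν = t * (2 * μ + ν) by ring,
    show t * ν - t * μ = t * (ν - μ) by ring, show 2 * (t * μ) = t * (2 * μ) by ring,
    show t * μ + t * ν = t * (μ + ν) by ring, mulLog_mul ht, mulLog_mul ht, mulLog_mul ht,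
    mulLog_mul ht, mulLog_mul ht, mulLog_mul ht]
  ring

theorem continuous_firstExponent : Continuous fun v : ℝ × ℝ => firstExponent v.1 v.2 := by
  have := continuous_mulLog
  unfold firstExponent
  fun_prop

/-- The directions `ν ≤ μ`: by Gibbs' inequality with the weights `p, q, t` for the parts
`μ + ν, ν, μ - ν` of `2 μ + ν`. Here `4 r = p t` and `s = p q / t` parametrize the boundary
curve. -/
theorem firstExponent_neg_of_le {r s : ℝ} {t p q : ℝ} (ht : 0 < t) (hp : 0 < p) (hq : 0 < q)
    (hpqt : p + q + t = 1) (hr : 4 * r = p * t) (hr0 : 0 < r) (hs0 : 0 < s) (hs : s < p * q / t)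
    (hr4 : r < 1 / 16) {μ ν : ℝ} (hν : 0 ≤ ν) (hνμ : ν ≤ μ) (hμ : 0 < μ) :
    firstExponent μ ν + μ * Real.log r + ν * Real.log s < 0 := by
  have h1 : mulLog (2 * μ) = 2 * mulLog μ + 2 * μ * Real.log 2 := mulLog_mul two_pos μ
  rcases hν.eq_or_lt with rfl | hν
  · have h2 : 4 * Real.log 2 + Real.log r < 0 := by
      have : Real.log (16 * r) < 0 := Real.log_neg (by positivity) (by linarith)
      rw [Real.log_mul (by norm_num) hr0.ne', show (16 : ℝ) = 2 ^ 4 by norm_num,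
        Real.log_pow] at this
      simpa using this
    simp only [firstExponent, add_zero, zero_sub, mulLog_neg, h1, mulLog_zero]
    nlinarith
  · have hX : 0 < 2 * μ + ν := by positivity
    have e1 := mul_log_sub_mulLog_le (add_pos hμ hν).le hX hp
    have e2 := mul_log_sub_mulLog_le hν.le hX hq
    have e3 := mul_log_sub_mulLog_le (sub_nonneg.2 hνμ) hX ht
    have e4 : mulLog (ν - μ) = -mulLog (μ - ν) := by rw [← mulLog_neg, neg_sub]
    have e5 : p * (2 * μ + ν) + q * (2 * μ + ν) + t * (2 * μ + ν) = 2 * μ + ν := by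
      linear_combination (2 * μ + ν) * hpqt
    have e6 : 2 * Real.log 2 + Real.log r = Real.log p + Real.log t := by
      have := congrArg Real.log hr
      rw [Real.log_mul (by norm_num) hr0.ne', Real.log_mul hp.ne' ht.ne',
        show (4 : ℝ) = 2 ^ 2 by norm_num, Real.log_pow] at this
      exact_mod_cast this
    have e7 : Real.log s < Real.log p + Real.log q - Real.log t := by
      have := Real.log_lt_log hs0 hs
      rwa [Real.log_div (by positivity) ht.ne', Real.log_mul hp.ne' hq.ne'] at this
    have e8 : ν * Real.log s < ν * (Real.log p + Real.log q - Real.log t) := by gcongr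
    have e9 : mulLog (2 * μ + ν) = (2 * μ + ν) * Real.log (2 * μ + ν) := rfl
    rw [firstExponent, e4, h1, e9]
    linear_combination e1 + e2 + e3 + e8 + μ * e6 + e5

theorem firstExponent_one_deriv {τ : ℝ} (h0 : 0 < τ) (h1 : τ < 1) (r s : ℝ) :
    HasDerivAt (fun τ => firstExponent τ 1 + τ * Real.log r + 1 * Real.log s)
      (2 * Real.log 2 + 2 * Real.log (2 * τ + 1) + Real.log r
        - (Real.log (1 - τ) + Real.log (1 + τ))) τ := by
  have d0 : HasDerivAt (fun τ => mulLog (2 * τ)) ((Real.log (2 * τ) + 1) * 2) τ :=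
    (hasDerivAt_mulLog (by positivity)).comp τ
      (by simpa using ((hasDerivAt_id τ).const_mul 2))
  have d1 : HasDerivAt (fun τ => mulLog (2 * τ + 1)) ((Real.log (2 * τ + 1) + 1) * 2) τ :=
    (hasDerivAt_mulLog (by positivity)).comp τ
      (by simpa using ((hasDerivAt_id τ).const_mul 2).add_const 1)
  have d2 : HasDerivAt (fun τ => mulLog (1 - τ)) ((Real.log (1 - τ) + 1) * (-1)) τ :=
    (hasDerivAt_mulLog (by linarith)).comp τ (by simpa using (hasDerivAt_id τ).const_sub 1)
  have d3 := hasDerivAt_mulLog h0.ne'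
  have d5 : HasDerivAt (fun τ => mulLog (τ + 1)) ((Real.log (τ + 1) + 1) * 1) τ :=
    (hasDerivAt_mulLog (by positivity)).comp τ (by simpa using (hasDerivAt_id τ).add_const 1)
  have d4 : HasDerivAt (fun τ : ℝ => τ * Real.log r) (Real.log r) τ := by
    simpa using (hasDerivAt_id τ).mul_const (Real.log r)
  have := ((((((((d0.add d1).add d2).sub d3).sub d5).sub d3).sub_const (mulLog 1)).add d4).add_const
    (1 * Real.log s))
  refine this.congr_deriv ?_
  rw [Real.log_mul two_ne_zero h0.ne', add_comm 1 τ]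
  ring

/-- The directions `μ = τ ≤ ν = 1`: on this segment the exponent first decreases and then
increases, from `log s` to `log (27 r s)`. -/
theorem firstExponent_one_neg {r s : ℝ} (hr0 : 0 < r) (hr : r < 1 / 16) (hs0 : 0 < s) (hs1 : s < 1)
    (hrs : 27 * r * s < 1) {τ : ℝ} (hτ : τ ∈ Icc (0 : ℝ) 1) :
    firstExponent τ 1 + τ * Real.log r + 1 * Real.log s < 0 := by
  set g : ℝ → ℝ := fun τ => firstExponent τ 1 + τ * Real.log r + 1 * Real.log s with hg
  have hgc : Continuous g := by
    have := continuous_firstExponent.comp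
      (Continuous.prodMk continuous_id (continuous_const (y := (1 : ℝ))))
    simp only [Function.comp_def, id] at this
    fun_prop
  have hd : ∀ x ∈ Ioo (0 : ℝ) 1, HasDerivAt g _ x := fun x hx =>
    firstExponent_one_deriv hx.1 hx.2 r s
  have hsign : ∀ x ∈ Ioo (0 : ℝ) 1,
      2 * Real.log 2 + 2 * Real.log (2 * x + 1) + Real.log r
          - (Real.log (1 - x) + Real.log (1 + x)) =
        Real.log (2 ^ 2 * (2 * x + 1) ^ 2 * r) - Real.log ((1 - x) * (1 + x)) := by
    intro x hx
    have : 0 < 1 - x := by linarith [hx.2]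
    have := hx.1
    rw [Real.log_mul (by positivity) hr0.ne', Real.log_mul (by positivity) (by positivity),
      Real.log_mul (by positivity) (by positivity), Real.log_pow, Real.log_pow]
    norm_num
  have hg1 : g 1 < 0 := by
    have h1 : g 1 = Real.log (27 * r * s) := by
      rw [Real.log_mul (by positivity) hs0.ne', Real.log_mul (by norm_num) hr0.ne',
        show (27 : ℝ) = 3 ^ 3 by norm_num, Real.log_pow]
      simp only [hg, firstExponent, mulLog]
      norm_num
    rw [h1]
    exact Real.log_neg (by positivity) hrs
  have hg0 : g 0 < 0 := by
    have h1 : g 0 = Real.log s := by simp [hg, firstExponent]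
    rw [h1]
    exact Real.log_neg hs0 hs1
  obtain ⟨v, hv1, hv⟩ : ∃ v : ℝ, 1 < v ∧ 1 + 12 * r = v ^ 2 :=
    ⟨√(1 + 12 * r), by rw [Real.lt_sqrt zero_le_one]; linarith,
      (Real.sq_sqrt (by linarith)).symm⟩
  have hv2 : v < 2 := by nlinarith
  have hrv : r = (v ^ 2 - 1) / 12 := by linarith
  set t₁ := (2 - v) / (2 * v - 1) with ht₁
  have h2v : 0 < 2 * v - 1 := by linarith
  have hfac : ∀ x : ℝ, 2 ^ 2 * (2 * x + 1) ^ 2 * r - (1 - x) * (1 + x) =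
      (4 * v ^ 2 - 1) / 3 * ((x - t₁) * (x + (2 + v) / (2 * v + 1))) := by
    intro x
    have : 2 * v + 1 ≠ 0 := by linarith
    rw [hrv, ht₁]
    field_simp
    ring
  have h4 : 0 < (4 * v ^ 2 - 1) / 3 := by nlinarith
  have h5 : 0 < (2 + v) / (2 * v + 1) := by positivity
  have ht0 : 0 ≤ t₁ := div_nonneg (by linarith) (by linarith)
  have ht1 : t₁ ≤ 1 := by rw [ht₁, div_le_one (by linarith)]; linarith
  have key := le_max_of_deriv_sign (t₀ := 0) hgc hd le_rfl ht0 ht1 (by simp)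
    (fun x hx => by
      have hx' : x ∈ Ioo (0 : ℝ) 1 := ⟨hx.1, hx.2.trans_le ht1⟩
      have := hx.1
      rw [hsign x hx', sub_nonpos]
      refine Real.log_le_log (by positivity) ?_
      have := mul_nonneg h4.le (mul_nonneg (by linarith [hx.2] : 0 ≤ t₁ - x)
        (by linarith : 0 ≤ x + (2 + v) / (2 * v + 1)))
      linarith [hfac x])
    (fun x hx => by
      have hx' : x ∈ Ioo (0 : ℝ) 1 := ⟨ht0.trans_lt hx.1, hx.2⟩
      have := hx'.1
      rw [hsign x hx', sub_nonneg]
      refine Real.log_le_log (mul_pos (by linarith [hx.2]) (by linarith)) ?_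
      have := mul_nonneg h4.le (mul_nonneg (by linarith [hx.1] : 0 ≤ x - t₁)
        (by linarith : 0 ≤ x + (2 + v) / (2 * v + 1)))
      linarith [hfac x]) hτ
  exact key.trans_lt (max_lt hg0 hg1)

theorem firstExponent_neg {r s : ℝ} (hr0 : 0 < r) (hr : r < 1 / 16) (hs0 : 0 < s) (hs1 : s < 1)
    (hs : s < ((1 - 12 * r) ^ (3 / 2 : ℝ) - 18 * r + 1) / (54 * r)) {μ ν : ℝ} (hμ : 0 ≤ μ)
    (hν : 0 ≤ ν) (hμν : 0 < μ + ν) :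
    firstExponent μ ν + μ * Real.log r + ν * Real.log s < 0 := by
  obtain ⟨w, hw0, hw⟩ : ∃ w : ℝ, 0 < w ∧ 1 - 12 * r = w ^ 2 :=
    ⟨√(1 - 12 * r), Real.sqrt_pos.2 (by linarith), (Real.sq_sqrt (by linarith)).symm⟩
  have hw1 : w < 1 := by nlinarith
  have hw2 : 1 / 2 < w := by nlinarith
  have hrw : r = (1 - w ^ 2) / 12 := by linarith
  have h1w : 0 < 1 - w := by linarith
  have hs' : s < (1 + w) / 3 * ((2 * w - 1) / 3) / (1 - w) := by
    refine hs.trans_eq ?_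
    rw [rpow_three_halves_of_sq hw0.le hw, hrw, show 1 - w ^ 2 = (1 - w) * (1 + w) by ring]
    field_simp
    ring
  have hrs : 27 * r * s < 1 := by
    rw [lt_div_iff₀ h1w] at hs'
    calc 27 * r * s = 9 / 4 * (1 + w) * (s * (1 - w)) := by rw [hrw]; ring
      _ < 9 / 4 * (1 + w) * ((1 + w) / 3 * ((2 * w - 1) / 3)) := by gcongr
      _ ≤ 1 := by nlinarith [mul_pos hw0 hw0]
  rcases le_or_gt ν μ with h | h
  · exact firstExponent_neg_of_le h1w (by linarith : 0 < (1 + w) / 3)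
      (by linarith : 0 < (2 * w - 1) / 3) (by ring) (by rw [hrw]; ring) hr0 hs0 hs' hr hν h
      (by linarith)
  · have hν0 : 0 < ν := hμ.trans_lt h
    have h1 := firstExponent_one_neg hr0 hr hs0 hs1 hrs (τ := μ / ν)
      ⟨by positivity, by rw [div_le_one hν0]; exact h.le⟩
    have h2 : firstExponent μ ν = ν * firstExponent (μ / ν) 1 := by
      rw [← firstExponent_mul hν0]; congr 1 <;> field_simp
    have h3 : firstExponent μ ν + μ * Real.log r + ν * Real.log s =
        ν * (firstExponent (μ / ν) 1 + μ / ν * Real.log r + 1 * Real.log s) := by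
      rw [h2]; field_simp
    rw [h3]
    exact mul_neg_of_pos_of_neg hν0 h1

/-! ### The exponents of the second series around `(0, 1)` -/

/-- The exponential growth rate of the coefficients of the second series around `(0, 1)` in the
direction `(μ, ν)`. -/
noncomputable def secondExponent (μ ν : ℝ) : ℝ :=
  mulLog (2 * μ) + mulLog (ν - 2 * μ) + mulLog (μ + ν) - mulLog μ - mulLog ν - mulLog μ
    - mulLog (ν - μ)

theorem secondExponent_mul {t : ℝ} (ht : 0 < t) (μ ν : ℝ) :
    secondExponent (t * μ) (t * ν) = t * secondExponent μ ν := by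
  rw [secondExponent, secondExponent, show t * ν - 2 * (t * μ) = t * (ν - 2 * μ) by ring,
    show t * ν - t * μ = t * (ν - μ) by ring, show 2 * (t * μ) = t * (2 * μ) by ring,
    show t * μ + t * ν = t * (μ + ν) by ring, mulLog_mul ht, mulLog_mul ht, mulLog_mul ht,
    mulLog_mul ht, mulLog_mul ht, mulLog_mul ht]
  ring

theorem continuous_secondExponent : Continuous fun v : ℝ × ℝ => secondExponent v.1 v.2 := by
  have := continuous_mulLog
  unfold secondExponent
  fun_prop

/-- The part `ε` of the bound of the second region, as a function of `ρ = r / s`. -/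
noncomputable def epsPlus (ρ : ℝ) : ℝ := 1 / 27 * ((4 * ρ + 3) ^ (3 / 2 : ℝ) / √ρ - 8 * ρ - 9)

/-- The part of the bound of the second region that is present for `ρ > 3 / 4`, as a function of
`ρ = r / s`. -/
noncomputable def epsMinus (ρ : ℝ) : ℝ :=
  1 / 27 * (-((4 * ρ - 3) ^ (3 / 2 : ℝ) / √ρ) - 8 * ρ + 9)

theorem rpow_three_halves_div_sqrt {x ρ : ℝ} (hx : 0 ≤ x) :
    x ^ (3 / 2 : ℝ) / √ρ = x * √(x / ρ) := by
  rw [Real.sqrt_div hx, rpow_three_halves_of_sq (Real.sqrt_nonneg x) (Real.sq_sqrt hx).symm,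
    pow_succ, Real.sq_sqrt hx]
  ring

theorem rpow_three_halves_mul_div {x r s : ℝ} (hx : 0 ≤ x) (hs : 0 < s) :
    (x * s) ^ (3 / 2 : ℝ) / (√r * s) = x ^ (3 / 2 : ℝ) / √(r / s) := by
  rw [← div_div, rpow_three_halves_div_sqrt (by positivity), rpow_three_halves_div_sqrt hx,
    show x * s / r = x / (r / s) by rw [div_div_eq_mul_div]]
  field_simp

/-- The bound of the second region depends on `r / s` only. -/
theorem secondBound_eq {r s : ℝ} (hr : 0 < r) (hs : 0 < s) :
    secondBound r s = if 4 * (r / s) > 3 then min (epsMinus (r / s)) (epsPlus (r / s))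
      else epsPlus (r / s) := by
  have hρ : 0 < r / s := by positivity
  have e1 : 1 / 27 * ((4 * r + 3 * s) ^ (3 / 2 : ℝ) / (√r * s) - 8 * r / s - 9) =
      epsPlus (r / s) := by
    rw [epsPlus, ← rpow_three_halves_mul_div (by positivity) hs,
      show (4 * (r / s) + 3) * s = 4 * r + 3 * s by field_simp]
    ring
  rw [secondBound, e1]
  split_ifs with h
  · congr 1
    rw [epsMinus, ← rpow_three_halves_mul_div (by linarith) hs,
      show (4 * (r / s) - 3) * s = 4 * r - 3 * s by field_simp]
    ring
  · rfl

theorem one_lt_epsPlus : 1 < epsPlus (1 / 400) := by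
  have h4 : √(1 / 400) = 1 / 20 := by
    rw [show (1 / 400 : ℝ) = (1 / 20) ^ 2 by norm_num, Real.sqrt_sq (by norm_num)]
  have h5 : (4 * (1 / 400) + 3 : ℝ) ≤ (4 * (1 / 400) + 3) ^ (3 / 2 : ℝ) := by
    have := Real.rpow_le_rpow_of_exponent_le (show (1 : ℝ) ≤ 4 * (1 / 400) + 3 by norm_num)
      (show (1 : ℝ) ≤ 3 / 2 by norm_num)
    rwa [Real.rpow_one] at this
  rw [epsPlus, h4, div_eq_mul_inv]
  linarith

theorem epsMinus_antitone {ρ₀ ρ : ℝ} (h₀ : 3 ≤ 4 * ρ₀) (h : ρ₀ ≤ ρ) : epsMinus ρ ≤ epsMinus ρ₀ := by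
  have h0 : 0 < ρ₀ := by linarith
  have h1 : 0 < ρ := by linarith
  have key : (4 * ρ₀ - 3) * √((4 * ρ₀ - 3) / ρ₀) ≤ (4 * ρ - 3) * √((4 * ρ - 3) / ρ) := by
    refine mul_le_mul (by linarith) (Real.sqrt_le_sqrt ?_) (Real.sqrt_nonneg _) (by linarith)
    rw [div_le_div_iff₀ h0 h1]
    nlinarith
  rw [epsMinus, epsMinus, rpow_three_halves_div_sqrt (by linarith),
    rpow_three_halves_div_sqrt (by linarith)]
  linarith

/-- The parametrization of the curve `s = ε(ρ)`. -/
theorem exists_epsPlus_param {ρ : ℝ} (hρ : 0 < ρ) : ∃ σ : ℝ, 0 < σ ∧ 3 * σ ^ 2 < 1 ∧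
    √ρ = (1 - 3 * σ ^ 2) / (4 * σ) ∧ epsPlus ρ = σ ^ 2 * (1 + σ ^ 2) / (1 - 3 * σ ^ 2) := by
  obtain ⟨κ, hκ, hκρ⟩ : ∃ κ : ℝ, 0 < κ ∧ ρ = κ ^ 2 :=
    ⟨√ρ, Real.sqrt_pos.2 hρ, (Real.sq_sqrt hρ.le).symm⟩
  have hsq : √ρ = κ := by rw [hκρ, Real.sqrt_sq hκ.le]
  obtain ⟨η, hη, hηρ⟩ : ∃ η : ℝ, 0 < η ∧ 4 * ρ + 3 = η ^ 2 :=
    ⟨√(4 * ρ + 3), Real.sqrt_pos.2 (by linarith), (Real.sq_sqrt (by linarith)).symm⟩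
  have hlt : 2 * κ < η := by nlinarith
  set σ := (η - 2 * κ) / 3 with hσ
  have hσ0 : 0 < σ := by rw [hσ]; linarith
  have hprod : σ * (η + 2 * κ) = 1 := by rw [hσ]; nlinarith
  have hκσ : κ = (1 - 3 * σ ^ 2) / (4 * σ) := by
    rw [eq_div_iff (by positivity)]
    have : 3 * σ = η - 2 * κ := by rw [hσ]; ring
    linear_combination hprod - σ * this
  have hησ : η = (1 + 3 * σ ^ 2) / (2 * σ) := by
    rw [eq_div_iff (by positivity)]
    have : 3 * σ = η - 2 * κ := by rw [hσ]; ring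
    linear_combination hprod - σ * this
  have hσ3 : 3 * σ ^ 2 < 1 := by
    have := hκσ ▸ hκ
    rw [div_pos_iff_of_pos_right (by positivity)] at this
    linarith
  refine ⟨σ, hσ0, hσ3, hsq.trans hκσ, ?_⟩
  have h13 : 1 - 3 * σ ^ 2 ≠ 0 := by linarith
  rw [epsPlus, rpow_three_halves_of_sq hη.le hηρ, hsq, hκρ, hκσ, hησ]
  field_simp
  ring

/-- The directions `μ ≤ ν ≤ 2 μ`: by Gibbs' inequality for the parts `ν, 2 μ - ν` of `2 μ` and
`μ, μ, ν - μ` of `μ + ν`. -/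
theorem secondExponent_neg_of_le_of_le {ρ s : ℝ} (hρ : 0 < ρ) (hs0 : 0 < s) (hs : s < epsPlus ρ)
    {μ ν : ℝ} (hμ : 0 < μ) (hνμ : μ ≤ ν) (hνμ' : ν ≤ 2 * μ) :
    secondExponent μ ν + μ * Real.log ρ + ν * Real.log s < 0 := by
  obtain ⟨σ, hσ, hσ3, hσρ, hσε⟩ := exists_epsPlus_param hρ
  have hν : 0 < ν := hμ.trans_le hνμ
  have h13 : 0 < 1 - 3 * σ ^ 2 := by linarith
  -- the weights `v / (1 + v), 1 / (1 + v)` and `q, q, σ ^ 2`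
  set v := (1 + σ ^ 2) / (1 - 3 * σ ^ 2) with hv
  set q := (1 - σ ^ 2) / 2 with hq
  have hv0 : 0 < v := by positivity
  have hq0 : 0 < q := by rw [hq]; nlinarith
  have e1 := mul_log_sub_mulLog_le hν.le (show 0 < 2 * μ by positivity)
    (show 0 < v / (1 + v) by positivity)
  have e2 := mul_log_sub_mulLog_le (sub_nonneg.2 hνμ') (show 0 < 2 * μ by positivity)
    (show 0 < 1 / (1 + v) by positivity)
  have e3 := mul_log_sub_mulLog_le hμ.le (show 0 < μ + ν by positivity) hq0
  have e4 := mul_log_sub_mulLog_le (sub_nonneg.2 hνμ) (show 0 < μ + ν by positivity)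
    (show 0 < σ ^ 2 by positivity)
  rw [Real.log_div (by positivity) (by positivity)] at e1
  rw [Real.log_div (by positivity) (by positivity), Real.log_one] at e2
  rw [Real.log_pow] at e4
  have e5 : v / (1 + v) * (2 * μ) + 1 / (1 + v) * (2 * μ) = 2 * μ := by field_simp; ring
  have e6 : q * (μ + ν) + q * (μ + ν) + σ ^ 2 * (μ + ν) = μ + ν := by rw [hq]; ring
  have e7 : Real.log ρ = 2 * (Real.log q - Real.log σ - Real.log (1 + v)) := by
    have h1 : √ρ = q / σ / (1 + v) := by
      rw [hσρ, hq, hv]; field_simp; ring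
    rw [← Real.log_div (by positivity) (by positivity),
      ← Real.log_div (by positivity) (by positivity), ← h1, Real.log_sqrt hρ.le]
    ring
  have e8 : Real.log s < Real.log v + 2 * Real.log σ := by
    have h1 : s < v * σ ^ 2 := by rw [hσε] at hs; rw [hv]; refine hs.trans_eq ?_; ring
    have := Real.log_lt_log hs0 h1
    rw [Real.log_mul (by positivity) (by positivity), Real.log_pow] at this
    exact_mod_cast this
  have e9 : ν * Real.log s < ν * (Real.log v + 2 * Real.log σ) := by gcongr
  have e10 : mulLog (ν - 2 * μ) = -mulLog (2 * μ - ν) := by rw [← mulLog_neg, neg_sub]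
  have e11 : mulLog (2 * μ) = 2 * μ * Real.log (2 * μ) := rfl
  have e12 : mulLog (μ + ν) = (μ + ν) * Real.log (μ + ν) := rfl
  rw [secondExponent, e10, e11, e12, e7]
  push_cast at e4
  linear_combination e1 + e2 + 2 * e3 + e4 + e9 + e5 + e6

theorem secondExponent_one_right_deriv {τ : ℝ} (h0 : 0 < τ) (h1 : τ < 1 / 2) (r s : ℝ) :
    HasDerivAt (fun τ => secondExponent τ 1 + τ * Real.log r + 1 * Real.log s)
      (2 * Real.log 2 + Real.log (1 + τ) + Real.log (1 - τ) + Real.log r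
        - 2 * Real.log (1 - 2 * τ)) τ := by
  have d0 : HasDerivAt (fun τ => mulLog (2 * τ)) ((Real.log (2 * τ) + 1) * 2) τ :=
    (hasDerivAt_mulLog (by positivity)).comp τ
      (by simpa using ((hasDerivAt_id τ).const_mul 2))
  have d1 : HasDerivAt (fun τ => mulLog (1 - 2 * τ)) ((Real.log (1 - 2 * τ) + 1) * (-2)) τ :=
    (hasDerivAt_mulLog (by linarith)).comp τ
      (by simpa using ((hasDerivAt_id τ).const_mul 2).const_sub 1)
  have d2 : HasDerivAt (fun τ => mulLog (1 - τ)) ((Real.log (1 - τ) + 1) * (-1)) τ :=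
    (hasDerivAt_mulLog (by linarith)).comp τ (by simpa using (hasDerivAt_id τ).const_sub 1)
  have d3 := hasDerivAt_mulLog h0.ne'
  have d5 : HasDerivAt (fun τ => mulLog (τ + 1)) ((Real.log (τ + 1) + 1) * 1) τ :=
    (hasDerivAt_mulLog (by positivity)).comp τ (by simpa using (hasDerivAt_id τ).add_const 1)
  have d4 : HasDerivAt (fun τ : ℝ => τ * Real.log r) (Real.log r) τ := by
    simpa using (hasDerivAt_id τ).mul_const (Real.log r)
  have := ((((((((d0.add d1).add d5).sub d3).sub_const (mulLog 1)).sub d3).sub d2).add d4).add_const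
    (1 * Real.log s))
  refine this.congr_deriv ?_
  rw [Real.log_mul two_ne_zero h0.ne', add_comm 1 τ]
  ring

/-- The directions `2 μ ≤ ν`, with `μ = τ` and `ν = 1`: the exponent is largest at an end of the
segment. -/
theorem secondExponent_one_right_neg {ρ s : ℝ} (hρ : 0 < ρ) (hs0 : 0 < s) (hs1 : s < 1)
    (hs : s < epsPlus ρ) {τ : ℝ} (hτ : τ ∈ Icc (0 : ℝ) (1 / 2)) :
    secondExponent τ 1 + τ * Real.log ρ + 1 * Real.log s < 0 := by
  set g : ℝ → ℝ := fun τ => secondExponent τ 1 + τ * Real.log ρ + 1 * Real.log s with hg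
  have hgc : Continuous g := by
    have := continuous_secondExponent.comp
      (Continuous.prodMk continuous_id (continuous_const (y := (1 : ℝ))))
    simp only [Function.comp_def, id] at this
    fun_prop
  have hd : ∀ x ∈ Ioo (0 : ℝ) (1 / 2), HasDerivAt g _ x := fun x hx =>
    secondExponent_one_right_deriv hx.1 hx.2 ρ s
  have hsign : ∀ x ∈ Ioo (0 : ℝ) (1 / 2),
      2 * Real.log 2 + Real.log (1 + x) + Real.log (1 - x) + Real.log ρ
          - 2 * Real.log (1 - 2 * x) =
        Real.log (2 ^ 2 * (1 + x) * (1 - x) * ρ) - Real.log ((1 - 2 * x) ^ 2) := by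
    intro x hx
    have : 0 < 1 - x := by linarith [hx.2]
    have := hx.1
    rw [Real.log_mul (by positivity) hρ.ne', Real.log_mul (by positivity) (by positivity),
      Real.log_mul (by positivity) (by positivity), Real.log_pow, Real.log_pow]
    norm_num
  have hpos : ∀ x ∈ Ioo (0 : ℝ) (1 / 2), (1 - 2 * x) ^ 2 ≤ 2 ^ 2 * (1 + x) * (1 - x) * ρ →
      0 ≤ 2 * Real.log 2 + Real.log (1 + x) + Real.log (1 - x) + Real.log ρ
          - 2 * Real.log (1 - 2 * x) := by
    intro x hx h
    rw [hsign x hx, sub_nonneg]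
    exact Real.log_le_log (pow_pos (by linarith [hx.2]) 2) h
  have hghalf : g (1 / 2) < 0 :=
    secondExponent_neg_of_le_of_le hρ hs0 hs (by norm_num) (by norm_num) (by norm_num)
  have hg0 : g 0 < 0 := by
    have h1 : g 0 = Real.log s := by simp [hg, secondExponent]
    rw [h1]
    exact Real.log_neg hs0 hs1
  -- for `ρ ≥ 1 / 4` the derivative is nowhere negative
  rcases le_or_gt 1 (4 * ρ) with hρ4 | hρ4
  · have := le_max_of_deriv_sign hgc hd (by norm_num) le_rfl le_rfl
      (fun x hx => hpos x hx (by
        have h1 : 0 < (1 + x) * (1 - x) := mul_pos (by linarith [hx.1]) (by linarith [hx.2])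
        nlinarith [hx.1, hx.2])) (by simp) (by simp) hτ
    exact this.trans_lt (by simpa using hghalf)
  · obtain ⟨u, hu0, hu⟩ : ∃ u : ℝ, 0 < u ∧ 16 * ρ ^ 2 + 12 * ρ = u ^ 2 :=
      ⟨√(16 * ρ ^ 2 + 12 * ρ), Real.sqrt_pos.2 (by positivity),
        (Real.sq_sqrt (by positivity)).symm⟩
    have hu1 : 2 * ρ ≤ u := by nlinarith
    have hu2 : u ≤ 2 := by nlinarith
    set t₁ := (2 - u) / (4 + 4 * ρ) with ht₁
    set t₂ := (2 + u) / (4 + 4 * ρ) with ht₂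
    have hfac : ∀ x : ℝ, 2 ^ 2 * (1 + x) * (1 - x) * ρ - (1 - 2 * x) ^ 2 =
        (4 + 4 * ρ) * ((x - t₁) * (t₂ - x)) := by
      intro x
      have h1 : (4 + 4 * ρ) * ((x - t₁) * (t₂ - x)) * (4 + 4 * ρ) =
          ((4 + 4 * ρ) * x - (2 - u)) * ((2 + u) - (4 + 4 * ρ) * x) := by
        rw [ht₁, ht₂]; field_simp
      refine mul_right_cancel₀ (show (4 + 4 * ρ) ≠ 0 by positivity) ?_
      rw [h1]
      linear_combination hu
    have ht0 : 0 ≤ t₁ := div_nonneg (by linarith) (by linarith)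
    have ht1 : t₁ ≤ 1 / 2 := by rw [ht₁, div_le_iff₀ (by positivity)]; linarith
    have ht2 : 1 / 2 ≤ t₂ := by rw [ht₂, le_div_iff₀ (by positivity)]; linarith
    have key := le_max_of_deriv_sign (t₀ := 0) hgc hd le_rfl ht0 ht1 (by simp)
      (fun x hx => by
        have hx' : x ∈ Ioo (0 : ℝ) (1 / 2) := ⟨hx.1, hx.2.trans_le ht1⟩
        have h0 := hx.1
        have h1 : 0 < 1 - x := by linarith [hx'.2]
        rw [hsign x hx', sub_nonpos]
        refine Real.log_le_log (by positivity) ?_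
        have := mul_nonneg (show 0 ≤ 4 + 4 * ρ by positivity)
          (mul_nonneg (by linarith [hx.2] : 0 ≤ t₁ - x) (by linarith [hx'.2] : 0 ≤ t₂ - x))
        linarith [hfac x])
      (fun x hx => hpos x ⟨ht0.trans_lt hx.1, hx.2⟩ (by
        have := mul_nonneg (show 0 ≤ 4 + 4 * ρ by positivity)
          (mul_nonneg (by linarith [hx.1] : 0 ≤ x - t₁) (by linarith [hx.2] : 0 ≤ t₂ - x))
        linarith [hfac x])) hτ
    exact key.trans_lt (max_lt hg0 hghalf)

theorem secondExponent_one_left_deriv {l : ℝ} (h0 : 0 < l) (h1 : l < 1) (r s : ℝ) :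
    HasDerivAt (fun l => secondExponent 1 l + 1 * Real.log r + l * Real.log s)
      (Real.log s + Real.log (1 + l) + Real.log (2 - l) - (Real.log l + Real.log (1 - l))) l := by
  have d1 : HasDerivAt (fun l => mulLog (l - 2 * 1)) ((Real.log (l - 2 * 1) + 1) * 1) l :=
    (hasDerivAt_mulLog (by linarith)).comp l
      (by simpa using (hasDerivAt_id l).sub_const 2)
  have d2 : HasDerivAt (fun l => mulLog (l - 1)) ((Real.log (l - 1) + 1) * 1) l :=
    (hasDerivAt_mulLog (by linarith)).comp l (by simpa using (hasDerivAt_id l).sub_const 1)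
  have d3 := hasDerivAt_mulLog h0.ne'
  have d5 : HasDerivAt (fun l => mulLog (1 + l)) ((Real.log (1 + l) + 1) * 1) l :=
    (hasDerivAt_mulLog (by positivity)).comp l (by simpa using (hasDerivAt_id l).const_add 1)
  have d4 : HasDerivAt (fun l : ℝ => l * Real.log s) (Real.log s) l := by
    simpa using (hasDerivAt_id l).mul_const (Real.log s)
  have := (((((((d1.const_add (mulLog (2 * 1))).add d5).sub_const (mulLog 1)).sub d3).sub_const
    (mulLog 1)).sub d2).add_const (1 * Real.log r)).add d4
  refine this.congr_deriv ?_
  rw [← Real.log_neg_eq_log (l - 2 * 1), ← Real.log_neg_eq_log (l - 1),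
    show -(l - 2 * 1) = 2 - l by ring, neg_sub]
  ring

/-- The directions `ν ≤ μ`, with `μ = 1` and `ν = l`: the exponent is largest at `l = 1`, or at the
smaller root `t₀` of `s (1 + l) (2 - l) = l (1 - l)`. There it can only fail to be negative
if `ρ > 3 / 4` and `s ≥ epsMinus ρ`. -/
theorem secondExponent_one_left_neg {ρ s : ℝ} (hρ : 0 < ρ) (hρ1 : ρ < 1) (hs0 : 0 < s)
    (hs1 : s < 1) (hs : s < epsPlus ρ) (hs' : 3 < 4 * ρ → s < epsMinus ρ) {l : ℝ}
    (hl : l ∈ Icc (0 : ℝ) 1) :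
    secondExponent 1 l + 1 * Real.log ρ + l * Real.log s < 0 := by
  set g : ℝ → ℝ := fun l => secondExponent 1 l + 1 * Real.log ρ + l * Real.log s with hg
  have hgc : Continuous g := by
    have := continuous_secondExponent.comp
      (Continuous.prodMk (continuous_const (y := (1 : ℝ))) continuous_id)
    simp only [Function.comp_def, id] at this
    fun_prop
  have hd : ∀ x ∈ Ioo (0 : ℝ) 1, HasDerivAt g _ x := fun x hx =>
    secondExponent_one_left_deriv hx.1 hx.2 ρ s
  have hsign : ∀ x ∈ Ioo (0 : ℝ) 1,
      Real.log s + Real.log (1 + x) + Real.log (2 - x) - (Real.log x + Real.log (1 - x)) =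
        Real.log (s * (1 + x) * (2 - x)) - Real.log (x * (1 - x)) := by
    intro x hx
    have : 0 < 1 - x := by linarith [hx.2]
    have : 0 < 2 - x := by linarith [hx.2]
    have := hx.1
    rw [Real.log_mul (by positivity) (by positivity), Real.log_mul (by positivity) (by positivity),
      Real.log_mul (by positivity) (by positivity)]
  have hpos : ∀ x ∈ Ioo (0 : ℝ) 1, x * (1 - x) ≤ s * (1 + x) * (2 - x) →
      0 ≤ Real.log s + Real.log (1 + x) + Real.log (2 - x) - (Real.log x + Real.log (1 - x)) := by
    intro x hx h
    rw [hsign x hx, sub_nonneg]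
    exact Real.log_le_log (mul_pos hx.1 (by linarith [hx.2])) h
  have hneg : ∀ x ∈ Ioo (0 : ℝ) 1, s * (1 + x) * (2 - x) ≤ x * (1 - x) →
      Real.log s + Real.log (1 + x) + Real.log (2 - x) - (Real.log x + Real.log (1 - x)) ≤ 0 := by
    intro x hx h
    have := hx.1
    have : 0 < 2 - x := by linarith [hx.2]
    rw [hsign x hx, sub_nonpos]
    exact Real.log_le_log (by positivity) h
  have hg1 : g 1 < 0 :=
    secondExponent_neg_of_le_of_le hρ hs0 hs one_pos le_rfl (by norm_num)
  -- for `s ≥ 1 / 9` the derivative is nowhere negative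
  rcases le_or_gt (1 / 9) s with hs9 | hs9
  · have := le_max_of_deriv_sign hgc hd zero_le_one le_rfl le_rfl
      (fun x hx => hpos x hx (by nlinarith [sq_nonneg (2 * x - 1)])) (by simp) (by simp) hl
    exact this.trans_lt (by simpa using hg1)
  · obtain ⟨w, hw0, hw⟩ : ∃ w : ℝ, 0 < w ∧ 1 - 8 * s / (1 - s) = w ^ 2 := by
      have : 0 < 1 - 8 * s / (1 - s) := by
        rw [sub_pos, div_lt_one (by linarith)]; linarith
      exact ⟨√(1 - 8 * s / (1 - s)), Real.sqrt_pos.2 this, (Real.sq_sqrt this.le).symm⟩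
    have h1s : 0 < 1 - s := by linarith
    have hw1 : w < 1 := by
      have : 0 < 8 * s / (1 - s) := by positivity
      nlinarith
    have hsw : s * (9 - w ^ 2) = 1 - w ^ 2 := by
      rw [← hw]; field_simp; ring
    set t₀ := (1 - w) / 2 with ht₀
    set t₁ := (1 + w) / 2 with ht₁
    have hfac : ∀ x : ℝ, s * (1 + x) * (2 - x) - x * (1 - x) = (1 - s) * ((x - t₀) * (x - t₁)) := by
      intro x
      rw [ht₀, ht₁]
      linear_combination hsw / 4
    have ht0 : 0 < t₀ := by rw [ht₀]; linarith
    have ht01 : t₀ ≤ t₁ := by rw [ht₀, ht₁]; linarith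
    have ht1 : t₁ ≤ 1 := by rw [ht₁]; linarith
    have ht0' : t₀ < 1 := by rw [ht₀]; linarith
    have key := le_max_of_deriv_sign hgc hd ht0.le ht01 ht1
      (fun x hx => hpos x ⟨hx.1, hx.2.trans ht0'⟩ (by
        have := mul_nonneg h1s.le (mul_nonneg_of_nonpos_of_nonpos (by linarith [hx.2] : x - t₀ ≤ 0)
          (by linarith [hx.2] : x - t₁ ≤ 0))
        linarith [hfac x]))
      (fun x hx => hneg x ⟨ht0.trans hx.1, hx.2.trans_le ht1⟩ (by
        have := mul_nonneg h1s.le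
          (mul_nonneg (by linarith [hx.1] : 0 ≤ x - t₀) (by linarith [hx.2] : 0 ≤ t₁ - x))
        linarith [hfac x]))
      (fun x hx => hpos x ⟨(ht0.trans_le ht01).trans hx.1, hx.2⟩ (by
        have := mul_nonneg h1s.le
          (mul_nonneg (by linarith [hx.1] : 0 ≤ x - t₀) (by linarith [hx.1] : 0 ≤ x - t₁))
        linarith [hfac x])) hl
    refine key.trans_lt (max_lt ?_ hg1)
    have h1 : 0 < 1 - t₀ := by linarith
    have h2 : 0 < 2 - t₀ := by linarith
    have h3 : Real.log s + Real.log (1 + t₀) + Real.log (2 - t₀) =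
        Real.log t₀ + Real.log (1 - t₀) := by
      have := hsign t₀ ⟨ht0, ht0'⟩
      rw [show s * (1 + t₀) * (2 - t₀) = t₀ * (1 - t₀) by
        have := hfac t₀; rw [sub_self, zero_mul, mul_zero] at this; linarith, sub_self] at this
      linarith
    have h4 : g t₀ = Real.log (2 ^ 2 * ρ * (1 + t₀) * (1 - t₀)) - Real.log ((2 - t₀) ^ 2) := by
      rw [Real.log_mul (by positivity) (by positivity),
        Real.log_mul (by positivity) (by positivity),
        Real.log_mul (by positivity) (by positivity), Real.log_pow, Real.log_pow]
      have h5 : mulLog (t₀ - 2 * 1) = -mulLog (2 - t₀) := by rw [← mulLog_neg]; congr 1; ring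
      have h6 : mulLog (t₀ - 1) = -mulLog (1 - t₀) := by rw [← mulLog_neg, neg_sub]
      simp only [hg, secondExponent, h5, h6]
      simp only [mulLog, Real.log_one, mul_one]
      push_cast
      linear_combination t₀ * h3
    rw [h4, sub_neg]
    refine Real.log_lt_log (by positivity) ?_
    by_contra! hcon
    -- then `ρ ≥ ρ₀` for the value `ρ₀` with `s = epsMinus ρ₀`
    have h3w : 0 < 3 - w := by linarith
    set ρ₀ := (3 + w) ^ 2 / (4 * ((3 - w) * (1 + w))) with hρ₀
    have hle : ρ₀ ≤ ρ := by
      rw [hρ₀, div_le_iff₀ (by positivity)]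
      rw [ht₀] at hcon
      nlinarith
    have h43 : 4 * ρ₀ - 3 = 4 * w ^ 2 / ((3 - w) * (1 + w)) := by
      rw [hρ₀]; field_simp; ring
    have h43' : 0 < 4 * ρ₀ - 3 := by rw [h43]; positivity
    have hval : epsMinus ρ₀ = s := by
      have hsq : √((4 * ρ₀ - 3) / ρ₀) = 4 * w / (3 + w) := by
        rw [show (4 * ρ₀ - 3) / ρ₀ = (4 * w / (3 + w)) ^ 2 by
          rw [h43, hρ₀]; field_simp, Real.sqrt_sq (by positivity)]
      rw [epsMinus, rpow_three_halves_div_sqrt h43'.le, hsq, h43, hρ₀]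
      have h9 : 9 - w ^ 2 ≠ 0 := by nlinarith
      rw [eq_div_of_mul_eq h9 hsw, show 9 - w ^ 2 = (3 - w) * (3 + w) by ring]
      field_simp
      ring
    have := (hs' (by linarith)).trans_le (epsMinus_antitone (by linarith) hle)
    rw [hval] at this
    exact lt_irrefl _ this

theorem secondExponent_neg {ρ s : ℝ} (hρ : 0 < ρ) (hρ1 : ρ < 1) (hs0 : 0 < s)
    (hs1 : s < 1) (hs : s < epsPlus ρ) (hs' : 3 < 4 * ρ → s < epsMinus ρ) {μ ν : ℝ} (hμ : 0 ≤ μ)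
    (hν : 0 ≤ ν) (hμν : 0 < μ + ν) :
    secondExponent μ ν + μ * Real.log ρ + ν * Real.log s < 0 := by
  rcases le_or_gt ν μ with h | h
  · have hμ0 : 0 < μ := by linarith
    have h1 := secondExponent_one_left_neg hρ hρ1 hs0 hs1 hs hs' (l := ν / μ)
      ⟨by positivity, by rw [div_le_one hμ0]; exact h⟩
    have h2 : secondExponent μ ν = μ * secondExponent 1 (ν / μ) := by
      rw [← secondExponent_mul hμ0]; congr 1 <;> field_simp
    have h3 : secondExponent μ ν + μ * Real.log ρ + ν * Real.log s =
        μ * (secondExponent 1 (ν / μ) + 1 * Real.log ρ + ν / μ * Real.log s) := by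
      rw [h2]; field_simp
    rw [h3]
    exact mul_neg_of_pos_of_neg hμ0 h1
  rcases le_or_gt ν (2 * μ) with h' | h'
  · exact secondExponent_neg_of_le_of_le hρ hs0 hs (by linarith) h.le h'
  · have hν0 : 0 < ν := hμ.trans_lt h
    have h1 := secondExponent_one_right_neg hρ hs0 hs1 hs (τ := μ / ν)
      ⟨by positivity, by rw [div_le_iff₀ hν0]; linarith⟩
    have h2 : secondExponent μ ν = ν * secondExponent (μ / ν) 1 := by
      rw [← secondExponent_mul hν0]; congr 1 <;> field_simp
    have h3 : secondExponent μ ν + μ * Real.log ρ + ν * Real.log s =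
        ν * (secondExponent (μ / ν) 1 + μ / ν * Real.log ρ + 1 * Real.log s) := by
      rw [h2]; field_simp
    rw [h3]
    exact mul_neg_of_pos_of_neg hν0 h1

/-! ### Convergence of the three double series -/

/-- The coefficients of `H₅`. -/
noncomputable def hornCoeff (a b c : ℂ) (p : ℕ × ℕ) : ℂ :=
  poch a (2 * p.1 + p.2) * poch b ((p.2 : ℤ) - p.1) / poch c p.2
    / (p.1.factorial * p.2.factorial)

/-- The coefficients of the first series, as a power series in `-x` and `1 - y`. -/
noncomputable def firstCoeff (a b c : ℂ) (p : ℕ × ℕ) : ℂ :=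
  poch (a - c + 1) (2 * p.1) * poch a (2 * p.1 + p.2) * poch b ((p.2 : ℤ) - p.1)
    / (poch (c - b) p.1 * poch (a + b - c + 1) (p.1 + p.2)) / (p.1.factorial * p.2.factorial)

/-- The coefficients of the second series, as a power series in `-x / (1 - y)` and `1 - y`. -/
noncomputable def secondCoeff (a b c : ℂ) (p : ℕ × ℕ) : ℂ :=
  poch (a - c + 1) (2 * p.1) * poch (c - a) ((p.2 : ℤ) - 2 * p.1) * poch (c - b) (p.1 + p.2)
    / (p.1.factorial * p.2.factorial * poch (c - b) p.1
        * poch (-a - b + c + 1) ((p.2 : ℤ) - p.1))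

theorem hornH5Term_eq (a b c x y : ℂ) (p : ℕ × ℕ) :
    hornH5Term a b c x y p = hornCoeff a b c p * (x ^ p.1 * y ^ p.2) := by
  rw [hornH5Term, hornCoeff]; ring

theorem firstTerm_eq (a b c x y : ℂ) (p : ℕ × ℕ) :
    firstTerm a b c x y p = firstCoeff a b c p * ((-x) ^ p.1 * (1 - y) ^ p.2) := by
  rw [firstTerm, firstCoeff]; ring

theorem secondTerm_eq (a b c x y : ℂ) (p : ℕ × ℕ) :
    secondTerm a b c x y p = secondCoeff a b c p * ((-(x / (1 - y))) ^ p.1 * (1 - y) ^ p.2) := rfl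

theorem polyExpBound_factorial_inv (k : ℕ × ℕ → ℕ) (N : ℕ)
    (hk : ∀ p, (k p : ℝ) ≤ N * ((p.1 : ℝ) + p.2)) :
    PolyExpBound (fun p => ((k p).factorial : ℂ)⁻¹)
      (fun p => -((k p : ℝ) * Real.log (k p) - k p)) := by
  refine (polyExpBound_poch_nat_inv (z := 1) (fun n h => ?_) k N hk).congr
    (fun p => by rw [poch_one]) fun _ => rfl
  have h1 : ((n + 1 : ℕ) : ℂ) = 0 := by push_cast; linear_combination h
  exact Nat.succ_ne_zero n (by exact_mod_cast h1)

theorem polyExpBound_hornCoeff {a b c : ℂ} (ha : ∀ k : ℕ, a ≠ -(k : ℂ))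
    (hb : ∀ k : ℤ, b ≠ (k : ℂ)) (hc : ∀ k : ℕ, c ≠ -(k : ℂ)) :
    PolyExpBound (hornCoeff a b c) fun p => hornExponent p.1 p.2 := by
  have h1 := polyExpBound_poch_nat ha (fun p => 2 * p.1 + p.2) 2
    (fun p => by push_cast; linarith [Nat.cast_nonneg (α := ℝ) p.2])
  have h2 := polyExpBound_poch hb (fun p => (p.2 : ℤ) - p.1) 1 (fun p => by
    have := Nat.cast_nonneg (α := ℝ) p.2
    have := Nat.cast_nonneg (α := ℝ) p.1
    push_cast; rw [abs_le]; constructor <;> linarith)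
  have h3 := polyExpBound_poch_nat_inv hc (fun p => p.2) 1
    (fun p => by push_cast; linarith [Nat.cast_nonneg (α := ℝ) p.1])
  have h4 := polyExpBound_factorial_inv (fun p => p.1) 1
    (fun p => by push_cast; linarith [Nat.cast_nonneg (α := ℝ) p.2])
  have h5 := polyExpBound_factorial_inv (fun p => p.2) 1
    (fun p => by push_cast; linarith [Nat.cast_nonneg (α := ℝ) p.1])
  refine ((((h1.mul h2).mul h3).mul h4).mul h5).congr (fun p => ?_) fun p => ?_
  · rw [hornCoeff]; push_cast; rw [div_eq_mul_inv, div_eq_mul_inv, mul_inv]; ring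
  · simp only [hornExponent, mulLog]; push_cast; ring

theorem ne_neg_natCast_of_ne_intCast {z : ℂ} (hz : ∀ k : ℤ, z ≠ (k : ℂ)) (k : ℕ) :
    z ≠ -(k : ℂ) := by exact_mod_cast hz (-k)

theorem polyExpBound_firstCoeff {a b c : ℂ} (ha : ∀ k : ℕ, a ≠ -(k : ℂ))
    (hb : ∀ k : ℤ, b ≠ (k : ℂ)) (hca : ∀ k : ℤ, c - a ≠ (k : ℂ))
    (hcb : ∀ k : ℕ, c - b ≠ -(k : ℂ)) (hcab : ∀ k : ℤ, c - a - b ≠ (k : ℂ)) :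
    PolyExpBound (firstCoeff a b c) fun p => firstExponent p.1 p.2 := by
  have hac : ∀ k : ℤ, a - c + 1 ≠ (k : ℂ) := fun k h =>
    hca (1 - k) (by push_cast; linear_combination -h)
  have habc : ∀ k : ℤ, a + b - c + 1 ≠ (k : ℂ) := fun k h =>
    hcab (1 - k) (by push_cast; linear_combination -h)
  have h0 := polyExpBound_poch_nat (ne_neg_natCast_of_ne_intCast hac) (fun p => 2 * p.1) 2
    (fun p => by push_cast; linarith [Nat.cast_nonneg (α := ℝ) p.2])
  have h1 := polyExpBound_poch_nat ha (fun p => 2 * p.1 + p.2) 2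
    (fun p => by push_cast; linarith [Nat.cast_nonneg (α := ℝ) p.2])
  have h2 := polyExpBound_poch hb (fun p => (p.2 : ℤ) - p.1) 1 (fun p => by
    have := Nat.cast_nonneg (α := ℝ) p.2
    have := Nat.cast_nonneg (α := ℝ) p.1
    push_cast; rw [abs_le]; constructor <;> linarith)
  have h3 := polyExpBound_poch_nat_inv hcb (fun p => p.1) 1
    (fun p => by push_cast; linarith [Nat.cast_nonneg (α := ℝ) p.2])
  have h6 := polyExpBound_poch_nat_inv (ne_neg_natCast_of_ne_intCast habc)
    (fun p => p.1 + p.2) 1 (fun p => by push_cast; linarith)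
  have h4 := polyExpBound_factorial_inv (fun p => p.1) 1
    (fun p => by push_cast; linarith [Nat.cast_nonneg (α := ℝ) p.2])
  have h5 := polyExpBound_factorial_inv (fun p => p.2) 1
    (fun p => by push_cast; linarith [Nat.cast_nonneg (α := ℝ) p.1])
  refine ((((((h0.mul h1).mul h2).mul h3).mul h6).mul h4).mul h5).congr (fun p => ?_) fun p => ?_
  · rw [firstCoeff]; push_cast; rw [div_eq_mul_inv, div_eq_mul_inv, mul_inv, mul_inv]; ring
  · simp only [firstExponent, mulLog]; push_cast; ring

theorem polyExpBound_secondCoeff {a b c : ℂ} (hca : ∀ k : ℤ, c - a ≠ (k : ℂ))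
    (hcb : ∀ k : ℕ, c - b ≠ -(k : ℂ)) (hcab : ∀ k : ℤ, c - a - b ≠ (k : ℂ)) :
    PolyExpBound (secondCoeff a b c) fun p => secondExponent p.1 p.2 := by
  have hac : ∀ k : ℤ, a - c + 1 ≠ (k : ℂ) := fun k h =>
    hca (1 - k) (by push_cast; linear_combination -h)
  have habc : ∀ k : ℤ, -a - b + c + 1 ≠ (k : ℂ) := fun k h =>
    hcab (k - 1) (by push_cast; linear_combination h)
  have h0 := polyExpBound_poch_nat (ne_neg_natCast_of_ne_intCast hac) (fun p => 2 * p.1) 2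
    (fun p => by push_cast; linarith [Nat.cast_nonneg (α := ℝ) p.2])
  have h1 := polyExpBound_poch hca (fun p => (p.2 : ℤ) - 2 * p.1) 2 (fun p => by
    have := Nat.cast_nonneg (α := ℝ) p.2
    have := Nat.cast_nonneg (α := ℝ) p.1
    push_cast; rw [abs_le]; constructor <;> linarith)
  have h2 := polyExpBound_poch_nat hcb (fun p => p.1 + p.2) 1 (fun p => by push_cast; linarith)
  have h3 := polyExpBound_poch_nat_inv hcb (fun p => p.1) 1
    (fun p => by push_cast; linarith [Nat.cast_nonneg (α := ℝ) p.2])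
  have h6 := polyExpBound_poch_inv habc (fun p => (p.2 : ℤ) - p.1) 1 (fun p => by
    have := Nat.cast_nonneg (α := ℝ) p.2
    have := Nat.cast_nonneg (α := ℝ) p.1
    push_cast; rw [abs_le]; constructor <;> linarith)
  have h4 := polyExpBound_factorial_inv (fun p => p.1) 1
    (fun p => by push_cast; linarith [Nat.cast_nonneg (α := ℝ) p.2])
  have h5 := polyExpBound_factorial_inv (fun p => p.2) 1
    (fun p => by push_cast; linarith [Nat.cast_nonneg (α := ℝ) p.1])
  refine ((((((h0.mul h1).mul h2).mul h4).mul h5).mul h3).mul h6).congr (fun p => ?_) fun p => ?_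
  · rw [secondCoeff]; push_cast; rw [div_eq_mul_inv, mul_inv, mul_inv, mul_inv]; ring
  · simp only [secondExponent, mulLog]; push_cast; ring

/-- A quantitative form of the fact that the bound of the region of `H₅` tends to one for
`r → 0`. -/
theorem lt_hornH5Bound {r s : ℝ} (hr0 : 0 < r) (hr1 : r ≤ 1 / 100) (hr2 : r ≤ (1 - s) / 2) :
    s < hornH5Bound r := by
  obtain ⟨w, hw0, hw⟩ : ∃ w : ℝ, 0 < w ∧ 1 - 12 * r = w ^ 2 :=
    ⟨√(1 - 12 * r), Real.sqrt_pos.2 (by linarith), (Real.sq_sqrt (by linarith)).symm⟩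
  have hw1 : w ≤ 1 - 6 * r := by nlinarith
  have hw3 : w ^ 3 ≤ 1 - 18 * r + 72 * r ^ 2 := by
    calc w ^ 3 = (1 - 12 * r) * w := by rw [hw]; ring
      _ ≤ (1 - 12 * r) * (1 - 6 * r) := by gcongr; linarith
      _ = _ := by ring
  have h54 : 0 < 54 * r := by positivity
  have hcond : √r < 1 / (2 * √3) := by
    rw [Real.sqrt_lt' (by positivity), div_pow, mul_pow, Real.sq_sqrt (by norm_num)]
    nlinarith
  have hb : s * (54 * r) < -w ^ 3 + 36 * r + 1 := by nlinarith
  rw [hornH5Bound, if_pos hcond, rpow_three_halves_of_sq hw0.le hw]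
  refine lt_min (lt_min ?_ ?_) ?_
  · rwa [lt_div_iff₀ h54]
  · rw [lt_div_iff₀ h54]
    have : 0 < w ^ 3 := by positivity
    linarith
  · have h1 : 12 * r + 1 ≤ (12 * r + 1) ^ (3 / 2 : ℝ) := by
      have := Real.rpow_le_rpow_of_exponent_le (show 1 ≤ 12 * r + 1 by linarith)
        (show (1 : ℝ) ≤ 3 / 2 by norm_num)
      rwa [Real.rpow_one] at this
    rw [lt_div_iff₀ h54]
    nlinarith

theorem mem_convDomain_hornCoeff {a b c : ℂ} (ha : ∀ k : ℕ, a ≠ -(k : ℂ))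
    (hb : ∀ k : ℤ, b ≠ (k : ℂ)) (hc : ∀ k : ℕ, c ≠ -(k : ℂ)) {q : ℂ × ℂ}
    (hq : q ∈ hornH5Region) : q ∈ convDomain (hornCoeff a b c) := by
  obtain ⟨h1, h2, h3⟩ := hq
  obtain ⟨r, s, hr0, hr, hs0, hs, hq1, hq2⟩ : ∃ r s : ℝ, 0 < r ∧ r < 1 / 4 ∧ 0 < s ∧
      s < hornH5Bound r ∧ ‖q.1‖ ≤ r ∧ ‖q.2‖ ≤ s := by
    have hy := norm_nonneg q.2
    by_cases hx : q.1 = 0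
    · obtain ⟨r, hr0, hr⟩ : ∃ r : ℝ, 0 < r ∧ r < min (1 / 100) ((1 - (‖q.2‖ + 1) / 2) / 2) :=
        exists_between (lt_min (by norm_num) (by linarith))
      obtain ⟨hr1, hr2⟩ := lt_min_iff.1 hr
      exact ⟨r, (‖q.2‖ + 1) / 2, hr0, by linarith, by linarith, lt_hornH5Bound hr0 hr1.le hr2.le,
        by simpa [hx] using hr0.le, by linarith⟩
    · have := h3 hx
      exact ⟨‖q.1‖, (‖q.2‖ + hornH5Bound ‖q.1‖) / 2, norm_pos_iff.2 hx, h1, by linarith,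
        by linarith, le_rfl, by linarith⟩
  exact mem_convDomain_of_exponent_neg (polyExpBound_hornCoeff ha hb hc) continuous_hornExponent
    (fun t μ ν ht => hornExponent_mul ht μ ν) hr0 hs0
    (fun μ ν hμ hν h => hornExponent_neg hr0 hr hs0 hs hμ hν h) hq1 hq2

theorem mem_convDomain_firstCoeff {a b c : ℂ} (ha : ∀ k : ℕ, a ≠ -(k : ℂ))
    (hb : ∀ k : ℤ, b ≠ (k : ℂ)) (hca : ∀ k : ℤ, c - a ≠ (k : ℂ))
    (hcb : ∀ k : ℕ, c - b ≠ -(k : ℂ)) (hcab : ∀ k : ℤ, c - a - b ≠ (k : ℂ)) {q : ℂ × ℂ}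
    (hq : q ∈ firstRegion) : (-q.1, 1 - q.2) ∈ convDomain (firstCoeff a b c) := by
  obtain ⟨h1, h2, h3⟩ := hq
  obtain ⟨r, s, hr0, hr, hs0, hs1, hs, hq1, hq2⟩ : ∃ r s : ℝ, 0 < r ∧ r < 1 / 16 ∧ 0 < s ∧
      s < 1 ∧ s < ((1 - 12 * r) ^ (3 / 2 : ℝ) - 18 * r + 1) / (54 * r) ∧ ‖q.1‖ ≤ r ∧
      ‖1 - q.2‖ ≤ s := by
    have hy := norm_nonneg (1 - q.2)
    by_cases hx : q.1 = 0
    · -- for `x = 0` any small radius will do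
      refine ⟨1 / 100, (‖1 - q.2‖ + 1) / 2, by norm_num, by norm_num, by linarith, by linarith, ?_,
        by rw [hx]; norm_num, by linarith⟩
      have : 0 ≤ (1 - 12 * (1 / 100 : ℝ)) ^ (3 / 2 : ℝ) := Real.rpow_nonneg (by norm_num) _
      rw [lt_div_iff₀ (by norm_num)]
      linarith
    · set B := ((1 - 12 * ‖q.1‖) ^ (3 / 2 : ℝ) - 18 * ‖q.1‖ + 1) / (54 * ‖q.1‖)
      have h4 : ‖1 - q.2‖ < min 1 B := lt_min h2 (h3 hx)
      have h5 := min_le_left 1 B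
      have h6 := min_le_right 1 B
      exact ⟨‖q.1‖, (‖1 - q.2‖ + min 1 B) / 2, norm_pos_iff.2 hx, h1, by linarith,
        by linarith, by linarith, le_rfl, by linarith⟩
  exact mem_convDomain_of_exponent_neg (polyExpBound_firstCoeff ha hb hca hcb hcab)
    continuous_firstExponent (fun t μ ν ht => firstExponent_mul ht μ ν) hr0 hs0
    (fun μ ν hμ hν h => firstExponent_neg hr0 hr hs0 hs1 hs hμ hν h) (by simpa using hq1) hq2

theorem mem_convDomain_secondCoeff {a b c : ℂ} (hca : ∀ k : ℤ, c - a ≠ (k : ℂ))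
    (hcb : ∀ k : ℕ, c - b ≠ -(k : ℂ)) (hcab : ∀ k : ℤ, c - a - b ≠ (k : ℂ)) {q : ℂ × ℂ}
    (hq : q ∈ secondRegion) :
    (-(q.1 / (1 - q.2)), 1 - q.2) ∈ convDomain (secondCoeff a b c) := by
  obtain ⟨h0, h1, h2, h3⟩ := hq
  have hs0 : 0 < ‖1 - q.2‖ := norm_pos_iff.2 (sub_ne_zero.2 h0.symm)
  rw [norm_div, norm_sub_rev q.2 1] at h1
  set s := ‖1 - q.2‖ with hs
  obtain ⟨ρ, hρ0, hρ1, hε, hε', hq1⟩ : ∃ ρ : ℝ, 0 < ρ ∧ ρ < 1 ∧ s < epsPlus ρ ∧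
      (3 < 4 * ρ → s < epsMinus ρ) ∧ ‖q.1‖ / s ≤ ρ := by
    by_cases hx : q.1 = 0
    · -- for `x = 0` any small radius will do
      refine ⟨1 / 400, by norm_num, by norm_num, ?_, fun h => by norm_num at h, by simp [hx]⟩
      exact h2.trans one_lt_epsPlus
    · have hx0 := norm_pos_iff.2 hx
      have h4 := h3 hx
      rw [secondBound_eq hx0 hs0] at h4
      refine ⟨‖q.1‖ / s, by positivity, h1, ?_, fun h => ?_, le_rfl⟩
      · split_ifs at h4
        · exact h4.trans_le (min_le_right _ _)
        · exact h4
      · rw [if_pos h] at h4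
        exact h4.trans_le (min_le_left _ _)
  exact mem_convDomain_of_exponent_neg (polyExpBound_secondCoeff hca hcb hcab)
    continuous_secondExponent (fun t μ ν ht => secondExponent_mul ht μ ν) hρ0 hs0
    (fun μ ν hμ hν h => secondExponent_neg hρ0 hρ1 hs0 h2 hε hε' hμ hν h)
    (by simpa using hq1) le_rfl

/-! ### The hypergeometric function -/

/-- The `n`-th coefficient of the Gauss hypergeometric series. -/
noncomputable def hypCoeff (A B C : ℂ) (n : ℕ) : ℂ := poch A n * poch B n / (poch C n * n.factorial)

/-- The Gauss hypergeometric function `₂F₁(A, B; C; z)`, as the sum of its series. -/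
noncomputable def hyp (A B C z : ℂ) : ℂ := ∑' n : ℕ, hypCoeff A B C n * z ^ n

/-- The parameter `z` is not a non-positive integer. -/
def NotNonposInt (z : ℂ) : Prop := ∀ k : ℕ, z ≠ -(k : ℂ)

theorem NotNonposInt.add_one {z : ℂ} (hz : NotNonposInt z) : NotNonposInt (z + 1) := fun k h =>
  hz (k + 1) (by push_cast; linear_combination h)

theorem NotNonposInt.ne_zero {z : ℂ} (hz : NotNonposInt z) : z ≠ 0 := by simpa using hz 0

theorem NotNonposInt.add_natCast_ne_zero {z : ℂ} (hz : NotNonposInt z) (n : ℕ) : z + n ≠ 0 :=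
  fun h => hz n (eq_neg_of_add_eq_zero_left h)

/-- Polynomial growth of a sequence of coefficients. -/
def PolyBound (a : ℕ → ℂ) : Prop :=
  ∃ (M : ℝ) (K : ℕ), 0 ≤ M ∧ ∀ n, ‖a n‖ ≤ M * ((n : ℝ) + 1) ^ K

theorem PolyBound.deriv {a : ℕ → ℂ} (ha : PolyBound a) :
    PolyBound fun n => ((n : ℂ) + 1) * a (n + 1) := by
  obtain ⟨M, K, hM, h⟩ := ha
  refine ⟨M * 2 ^ K, K + 1, by positivity, fun n => ?_⟩
  have h1 : ‖(n : ℂ) + 1‖ = (n : ℝ) + 1 := by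
    rw [← Nat.cast_add_one, Complex.norm_natCast]; push_cast; rfl
  rw [norm_mul, h1]
  calc ((n : ℝ) + 1) * ‖a (n + 1)‖ ≤ (n + 1) * (M * ((n + 1 : ℕ) + 1) ^ K) := by gcongr; exact h _
    _ ≤ (n + 1) * (M * (2 * ((n : ℝ) + 1)) ^ K) := by
      gcongr; push_cast; linarith [Nat.cast_nonneg (α := ℝ) n]
    _ = _ := by rw [mul_pow]; ring

theorem PolyBound.summable_norm {a : ℕ → ℂ} (ha : PolyBound a) {r : ℝ} (hr0 : 0 ≤ r) (hr : r < 1) :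
    Summable fun n => ‖a n‖ * r ^ n := by
  obtain ⟨M, K, hM, h⟩ := ha
  rcases hr0.eq_or_lt with rfl | hr0
  · exact summable_of_ne_finset_zero (s := {0}) fun n hn => by
      rw [zero_pow (by simpa using hn), mul_zero]
  have h1 : 0 < -Real.log r := by linarith [Real.log_neg hr0 hr]
  refine Summable.of_nonneg_of_le (fun n => by positivity) (fun n => ?_)
    ((summable_succ_pow_mul_exp K h1).mul_left M)
  have h2 : r ^ n = Real.exp (-(-Real.log r * n)) := by
    rw [neg_mul, neg_neg, mul_comm, Real.exp_nat_mul, Real.exp_log hr0]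
  rw [← h2, ← mul_assoc]
  gcongr
  exact h n

theorem PolyBound.hasSum {a : ℕ → ℂ} (ha : PolyBound a) {z : ℂ} (hz : ‖z‖ < 1) :
    HasSum (fun n => a n * z ^ n) (∑' n, a n * z ^ n) := by
  refine Summable.hasSum (Summable.of_norm_bounded (ha.summable_norm (norm_nonneg z) hz)
    fun n => ?_)
  rw [norm_mul, norm_pow]

theorem PolyBound.hasDerivAt {a : ℕ → ℂ} (ha : PolyBound a) {z : ℂ} (hz : ‖z‖ < 1) :
    HasDerivAt (fun z => ∑' n, a n * z ^ n) (∑' n : ℕ, ((n : ℂ) + 1) * a (n + 1) * z ^ n) z := by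
  obtain ⟨r, hzr, hr⟩ := exists_between hz
  have hr0 : 0 ≤ r := (norm_nonneg z).trans hzr.le
  have hu : Summable fun n : ℕ => ‖a n‖ * (n * r ^ (n - 1)) := by
    refine (summable_nat_add_iff (f := fun n : ℕ => ‖a n‖ * (n * r ^ (n - 1))) 1).1 ?_
    refine (ha.deriv.summable_norm hr0 hr).congr fun n => ?_
    rw [norm_mul, ← Nat.cast_add_one, Complex.norm_natCast, Nat.add_sub_cancel]
    ring
  have key := hasDerivAt_tsum_of_isPreconnected (g := fun n z => a n * z ^ n)
    (g' := fun n z => a n * (n * z ^ (n - 1))) hu (Metric.isOpen_ball (x := (0 : ℂ)) (ε := r))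
    (convex_ball 0 r).isPreconnected (fun n y _ => (hasDerivAt_pow n y).const_mul (a n))
    (fun n y hy => by
      rw [norm_mul, norm_mul, norm_pow, Complex.norm_natCast]
      have : ‖y‖ ≤ r := (mem_ball_zero_iff.1 hy).le
      gcongr)
    (mem_ball_zero_iff.2 hzr) (ha.hasSum hz).summable (mem_ball_zero_iff.2 hzr)
  refine key.congr_deriv ?_
  rw [Summable.tsum_eq_zero_add]
  · simp only [CharP.cast_eq_zero, zero_mul, mul_zero, zero_add, Nat.add_sub_cancel]
    refine tsum_congr fun n => ?_
    push_cast; ring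
  · refine Summable.of_norm_bounded hu fun n => ?_
    rw [norm_mul, norm_mul, norm_pow, Complex.norm_natCast]
    gcongr

theorem hasSum_of_shift {g : ℕ → ℂ} {s : ℂ} (h : HasSum (fun n => g (n + 1)) s) (h0 : g 0 = 0) :
    HasSum g s := by
  have := (hasSum_nat_add_iff (f := g) 1).1 h
  simpa [h0] using this

/-- A power series whose coefficients satisfy the hypergeometric recursion satisfies the
hypergeometric differential equation. -/
theorem hypergeometric_ode_of_recursion {a : ℕ → ℂ} (ha : PolyBound a) {A B C : ℂ}
    (hrec : ∀ n : ℕ, ((n : ℂ) + 1) * (n + C) * a (n + 1) = (n + A) * (n + B) * a n) {z : ℂ}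
    (hz : ‖z‖ < 1) :
    z * (1 - z) * (∑' n : ℕ, ((n : ℂ) + 1) * (((n + 1 : ℕ) : ℂ) + 1) * a (n + 1 + 1) * z ^ n)
      + (C - (A + B + 1) * z) * (∑' n : ℕ, ((n : ℂ) + 1) * a (n + 1) * z ^ n)
      - A * B * (∑' n, a n * z ^ n) = 0 := by
  have h0 := ha.hasSum hz
  have h1 := ha.deriv.hasSum hz
  have h2 := ha.deriv.deriv.hasSum hz
  simp only [← mul_assoc] at h2
  set f := ∑' n, a n * z ^ n
  set f1 := ∑' n : ℕ, ((n : ℂ) + 1) * a (n + 1) * z ^ n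
  set f2 := ∑' n : ℕ, ((n : ℂ) + 1) * (((n + 1 : ℕ) : ℂ) + 1) * a (n + 1 + 1) * z ^ n
  have e1 : HasSum (fun n : ℕ => (n : ℂ) * a n * z ^ n) (z * f1) := by
    refine hasSum_of_shift ?_ (by simp)
    refine (h1.mul_left z).of_forall_eq fun n => ?_
    push_cast; ring
  have e2 : HasSum (fun n : ℕ => (n : ℂ) * (n + 1) * a (n + 1) * z ^ n) (z * f2) := by
    refine hasSum_of_shift ?_ (by simp)
    refine (h2.mul_left z).of_forall_eq fun n => ?_
    push_cast; ring
  have e3 : HasSum (fun n : ℕ => (n : ℂ) * (n - 1) * a n * z ^ n) (z * (z * f2)) := by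
    refine hasSum_of_shift ?_ (by simp)
    refine (e2.mul_left z).of_forall_eq fun n => ?_
    push_cast; ring
  have tot := (((e2.sub e3).add (h1.mul_left C)).sub (e1.mul_left (A + B + 1))).sub
    (h0.mul_left (A * B))
  have hzero := tot.of_forall_eq (g := fun _ => 0) fun n => by
    linear_combination (-z ^ n) * hrec n
  have := hzero.unique hasSum_zero
  linear_combination this

theorem polyBound_hypCoeff {A B C : ℂ} (hA : NotNonposInt A) (hB : NotNonposInt B)
    (hC : NotNonposInt C) : PolyBound (hypCoeff A B C) := by
  obtain ⟨M₁, K₁, hM₁, h₁⟩ := exists_poch_factorial_bound hA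
  obtain ⟨M₂, K₂, hM₂, h₂⟩ := exists_poch_factorial_bound hB
  obtain ⟨M₃, K₃, hM₃, h₃⟩ := exists_poch_factorial_bound hC
  refine ⟨M₁ * M₂ * M₃, K₁ + K₂ + K₃, by positivity, fun n => ?_⟩
  have hf : (0 : ℝ) < n.factorial := by exact_mod_cast n.factorial_pos
  have hP : 0 < ‖poch C n‖ := norm_pos_iff.2 (poch_natCast_ne_zero hC n)
  rw [hypCoeff, norm_div, norm_mul, norm_mul, Complex.norm_natCast, div_le_iff₀ (by positivity)]
  calc ‖poch A n‖ * ‖poch B n‖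
      ≤ (M₁ * (n + 1) ^ K₁ * n.factorial) * (M₂ * (n + 1) ^ K₂ * n.factorial) :=
        mul_le_mul (h₁ n).1 (h₂ n).1 (norm_nonneg _) (by positivity)
    _ ≤ (M₁ * (n + 1) ^ K₁ * n.factorial) *
        (M₂ * (n + 1) ^ K₂ * (M₃ * (n + 1) ^ K₃ * ‖poch C n‖)) := by
        gcongr; exact (h₃ n).2
    _ = _ := by ring

theorem hypCoeff_rec {C : ℂ} (A B : ℂ) (hC : NotNonposInt C) (n : ℕ) :
    ((n : ℂ) + 1) * (n + C) * hypCoeff A B C (n + 1) = (n + A) * (n + B) * hypCoeff A B C n := by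
  have h1 := poch_natCast_ne_zero hC n
  have h2 := hC.add_natCast_ne_zero n
  have h3 : (n.factorial : ℂ) ≠ 0 := by exact_mod_cast n.factorial_ne_zero
  have h4 : (n : ℂ) + 1 ≠ 0 := by exact_mod_cast n.succ_ne_zero
  rw [hypCoeff, hypCoeff]
  push_cast [Nat.factorial_succ]
  rw [poch_natCast_succ, poch_natCast_succ, poch_natCast_succ]
  field_simp
  ring

theorem hypCoeff_succ {C : ℂ} (A B : ℂ) (hC : NotNonposInt C) (n : ℕ) :
    ((n : ℂ) + 1) * hypCoeff A B C (n + 1) =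
      A * B / C * hypCoeff (A + 1) (B + 1) (C + 1) n := by
  have h1 := poch_natCast_ne_zero hC.add_one n
  have h2 := hC.ne_zero
  have h3 : (n.factorial : ℂ) ≠ 0 := by exact_mod_cast n.factorial_ne_zero
  have h4 : (n : ℂ) + 1 ≠ 0 := by exact_mod_cast n.succ_ne_zero
  rw [hypCoeff, hypCoeff]
  push_cast [Nat.factorial_succ]
  rw [poch_natCast_succ_left, poch_natCast_succ_left, poch_natCast_succ_left]
  field_simp

theorem tsum_succ_mul_hypCoeff {C : ℂ} (A B z : ℂ) (hC : NotNonposInt C) :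
    ∑' n : ℕ, ((n : ℂ) + 1) * hypCoeff A B C (n + 1) * z ^ n =
      A * B / C * hyp (A + 1) (B + 1) (C + 1) z := by
  refine Eq.trans (tsum_congr fun n => ?_) tsum_mul_left
  rw [hypCoeff_succ A B hC, mul_assoc]

theorem hasDerivAt_hyp {A B C z : ℂ} (hA : NotNonposInt A) (hB : NotNonposInt B)
    (hC : NotNonposInt C) (hz : ‖z‖ < 1) :
    HasDerivAt (hyp A B C) (A * B / C * hyp (A + 1) (B + 1) (C + 1) z) z :=
  ((polyBound_hypCoeff hA hB hC).hasDerivAt hz).congr_deriv (tsum_succ_mul_hypCoeff A B z hC)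

/-- The second derivative of the hypergeometric function. -/
noncomputable def hypDeriv₂ (A B C z : ℂ) : ℂ :=
  A * B / C * ((A + 1) * (B + 1) / (C + 1) * hyp (A + 1 + 1) (B + 1 + 1) (C + 1 + 1) z)

theorem hyp_ode {A B C z : ℂ} (hA : NotNonposInt A) (hB : NotNonposInt B)
    (hC : NotNonposInt C) (hz : ‖z‖ < 1) :
    z * (1 - z) * hypDeriv₂ A B C z
      + (C - (A + B + 1) * z) * (A * B / C * hyp (A + 1) (B + 1) (C + 1) z)
      - A * B * hyp A B C z = 0 := by
  have h := hypergeometric_ode_of_recursion (polyBound_hypCoeff hA hB hC)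
    (hypCoeff_rec A B hC) hz
  have h2 : ∑' n : ℕ, ((n : ℂ) + 1) * (((n + 1 : ℕ) : ℂ) + 1) * hypCoeff A B C (n + 1 + 1) * z ^ n
      = hypDeriv₂ A B C z := by
    rw [hypDeriv₂, ← tsum_succ_mul_hypCoeff _ _ z hC.add_one]
    refine Eq.trans (tsum_congr fun n => ?_) tsum_mul_left
    rw [mul_assoc ((n : ℂ) + 1), hypCoeff_succ A B hC (n + 1)]
    ring
  rwa [h2, tsum_succ_mul_hypCoeff A B z hC] at h

theorem hyp_zero (A B C : ℂ) : hyp A B C 0 = 1 := by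
  rw [hyp, tsum_eq_single 0 fun n hn => by rw [zero_pow hn, mul_zero]]
  simp [hypCoeff]

theorem continuousAt_hyp {A B C z : ℂ} (hA : NotNonposInt A) (hB : NotNonposInt B)
    (hC : NotNonposInt C) (hz : ‖z‖ < 1) : ContinuousAt (hyp A B C) z :=
  (hasDerivAt_hyp hA hB hC hz).continuousAt

/-- The contiguous relation behind the derivative of `z ^ κ * ₂F₁(A, B; κ + 1; z)`. -/
theorem hyp_contiguous {A B κ z : ℂ} (hA : NotNonposInt A) (hB : NotNonposInt B)
    (hκ : NotNonposInt κ) (hz : ‖z‖ < 1) :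
    κ * hyp A B (κ + 1) z + z * (A * B / (κ + 1) * hyp (A + 1) (B + 1) (κ + 1 + 1) z) =
      κ * hyp A B κ z := by
  have hP := polyBound_hypCoeff hA hB hκ.add_one
  have h0 := hP.hasSum hz
  have h1 : HasSum (fun n : ℕ => (n : ℂ) * hypCoeff A B (κ + 1) n * z ^ n)
      (z * (A * B / (κ + 1) * hyp (A + 1) (B + 1) (κ + 1 + 1) z)) := by
    refine hasSum_of_shift ?_ (by simp)
    have h2 := ((polyBound_hypCoeff hA.add_one hB.add_one hκ.add_one.add_one).hasSum hz).mul_left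
      (z * (A * B / (κ + 1)))
    rw [hyp, ← mul_assoc]
    refine h2.of_forall_eq fun n => ?_
    have h3 := hypCoeff_succ A B hκ.add_one n
    push_cast
    rw [h3]; ring
  have h2 := (polyBound_hypCoeff hA hB hκ).hasSum hz
  refine ((h0.mul_left κ).add h1).unique ((h2.mul_left κ).of_forall_eq fun n => ?_)
  have h3 := poch_natCast_succ κ n
  rw [poch_natCast_succ_left] at h3
  have h4 := poch_natCast_ne_zero hκ n
  have h5 := poch_natCast_ne_zero hκ.add_one n
  have h6 : (n.factorial : ℂ) ≠ 0 := by exact_mod_cast n.factorial_ne_zero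
  rw [hypCoeff, hypCoeff]
  field_simp
  linear_combination (-(poch A n * poch B n * z ^ n)) * h3

open Filter Topology

/-! ### Boundary behaviour of the hypergeometric function -/

theorem choose_eq_poch_div_factorial (z : ℂ) (n : ℕ) :
    Ring.choose (z + n - 1) n = poch z n / n.factorial := by
  have h := Ring.factorial_nsmul_multichoose_eq_ascPochhammer z n
  rw [Polynomial.ascPochhammer_smeval_eq_eval, nsmul_eq_mul] at h
  rw [Ring.choose, show z + n - 1 - n + 1 = z by ring, poch_natCast,
    eq_div_iff (by exact_mod_cast n.factorial_ne_zero), mul_comm, ← h]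

/-- The binomial series of `(1 - z) ^ (-w)`. -/
theorem hasSum_binomial (w : ℂ) {z : ℂ} (hz : ‖z‖ < 1) :
    HasSum (fun n : ℕ => poch w n / n.factorial * z ^ n) (1 / (1 - z) ^ w) := by
  have h := (one_div_one_sub_cpow_hasFPowerSeriesOnBall_zero w).hasSum (y := z) (by
    rw [← ENNReal.ofReal_one, Metric.eball_ofReal, mem_ball_zero_iff]; exact hz)
  rw [zero_add] at h
  refine h.of_forall_eq fun n => ?_
  rw [FormalMultilinearSeries.ofScalars_apply_eq, choose_eq_poch_div_factorial, smul_eq_mul]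

/-- The coefficients of the real binomial series of `(1 - z) ^ (-μ)`. -/
noncomputable def binomCoeff (μ : ℝ) (n : ℕ) : ℝ := (ascPochhammer ℝ n).eval μ / n.factorial

theorem binomCoeff_pos {μ : ℝ} (hμ : 0 < μ) (n : ℕ) : 0 < binomCoeff μ n :=
  div_pos (ascPochhammer_pos n μ hμ) (by exact_mod_cast n.factorial_pos)

theorem ofReal_binomCoeff (μ : ℝ) (n : ℕ) : (binomCoeff μ n : ℂ) = poch μ n / n.factorial := by
  have h : ∀ n : ℕ, (((ascPochhammer ℝ n).eval μ : ℝ) : ℂ) = poch μ n := by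
    intro n
    induction n with
    | zero => simp
    | succ n ih =>
      push_cast
      rw [ascPochhammer_succ_eval, poch_natCast_succ, ← ih]
      push_cast; rfl
  rw [binomCoeff]; push_cast; rw [h]

theorem hasSum_binomCoeff {μ x : ℝ} (hx0 : 0 < x) (hx1 : x < 2) :
    HasSum (fun n => binomCoeff μ n * (1 - x) ^ n) (x ^ (-μ)) := by
  have hn : ‖((1 - x : ℝ) : ℂ)‖ < 1 := by
    rw [norm_real, Real.norm_eq_abs, abs_lt]; constructor <;> linarith
  have h := hasSum_binomial μ hn
  rw [← Complex.hasSum_ofReal]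
  convert h using 1
  · funext n; push_cast [ofReal_binomCoeff]; ring
  · rw [ofReal_cpow hx0.le]; push_cast; rw [cpow_neg, one_div]; ring_nf

/-- An Abelian theorem: coefficients that are negligible against those of `(1 - z) ^ (-μ)` give a
sum that is negligible against `x ^ (-μ)` for `z = 1 - x`, `x → 0`. -/
theorem tendsto_rpow_mul_tsum_of_tendsto_zero {μ : ℝ} (hμ : 0 < μ) {d : ℕ → ℂ}
    (hd : Tendsto (fun n => ‖d n‖ / binomCoeff μ n) atTop (𝓝 0)) :
    Tendsto (fun x : ℝ => x ^ μ * ‖∑' n, d n * (1 - (x : ℂ)) ^ n‖) (𝓝[>] 0) (𝓝 0) := by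
  rw [Metric.tendsto_nhds]
  intro ε hε
  obtain ⟨N, hN⟩ := eventually_atTop.1 (hd.eventually (gt_mem_nhds (half_pos hε)))
  set S := ∑ n ∈ Finset.range N, ‖d n‖ with hS
  have hS0 : 0 ≤ S := Finset.sum_nonneg fun _ _ => norm_nonneg _
  have hlim : Tendsto (fun x : ℝ => x ^ μ * S) (𝓝[>] 0) (𝓝 0) := by
    have h1 : ContinuousAt (fun x : ℝ => x ^ μ * S) 0 :=
      (Real.continuousAt_rpow_const 0 μ (Or.inr hμ.le)).mul_const S
    have h2 := h1.tendsto
    rw [Real.zero_rpow hμ.ne', zero_mul] at h2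
    exact h2.mono_left nhdsWithin_le_nhds
  filter_upwards [hlim.eventually (gt_mem_nhds (half_pos hε)),
    Ioo_mem_nhdsGT (show (0 : ℝ) < 1 by norm_num)] with x hx1 hx
  have hx0 : 0 < x := hx.1
  have hx2 : 0 ≤ 1 - x := by linarith [hx.2]
  have hsum := hasSum_binomCoeff (μ := μ) hx0 (by linarith [hx.2])
  have hb : ∀ n, ‖d n * (1 - (x : ℂ)) ^ n‖ ≤
      (if n ∈ Finset.range N then ‖d n‖ else 0) + ε / 2 * (binomCoeff μ n * (1 - x) ^ n) := by
    intro n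
    have hnorm : ‖1 - (x : ℂ)‖ = 1 - x := by
      rw [← ofReal_one, ← ofReal_sub, norm_real, Real.norm_eq_abs, abs_of_nonneg hx2]
    have hpos : 0 ≤ binomCoeff μ n * (1 - x) ^ n :=
      mul_nonneg (binomCoeff_pos hμ n).le (pow_nonneg hx2 n)
    rw [norm_mul, norm_pow, hnorm]
    split_ifs with h
    · have : (1 - x) ^ n ≤ 1 := pow_le_one₀ hx2 (by linarith)
      have := mul_le_of_le_one_right (norm_nonneg (d n)) this
      have : 0 ≤ ε / 2 * (binomCoeff μ n * (1 - x) ^ n) := by positivity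
      linarith
    · have h1 := hN n (by simpa using h)
      rw [div_lt_iff₀ (binomCoeff_pos hμ n)] at h1
      calc ‖d n‖ * (1 - x) ^ n ≤ (ε / 2 * binomCoeff μ n) * (1 - x) ^ n := by gcongr
        _ = _ := by ring
  have hfin : HasSum (fun n => if n ∈ Finset.range N then ‖d n‖ else 0) S := by
    have : HasSum (fun n => if n ∈ Finset.range N then ‖d n‖ else 0)
        (∑ n ∈ Finset.range N, if n ∈ Finset.range N then ‖d n‖ else 0) :=
      hasSum_sum_of_ne_finset_zero fun n hn => if_neg hn
    rwa [Finset.sum_congr rfl fun n hn => if_pos hn] at this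
  have hle := tsum_of_norm_bounded (hfin.add (hsum.mul_left (ε / 2))) hb
  have hxμ : 0 < x ^ μ := Real.rpow_pos_of_pos hx0 μ
  rw [dist_zero_right, Real.norm_eq_abs, abs_of_nonneg (by positivity)]
  calc x ^ μ * _ ≤ x ^ μ * (S + ε / 2 * x ^ (-μ)) := by gcongr
    _ = x ^ μ * S + ε / 2 := by
      rw [mul_add, Real.rpow_neg hx0.le]; field_simp
    _ < ε := by linarith

/-- The Abelian theorem in the form of a comparison with a complex power `x ^ (-w)`. -/
theorem tendsto_cpow_mul_tsum {w L : ℂ} (hw : 0 < w.re) {a : ℕ → ℂ} (ha : PolyBound a)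
    (hlim : Tendsto (fun n : ℕ => a n / (poch w n / n.factorial)) atTop (𝓝 L)) :
    Tendsto (fun x : ℝ => (x : ℂ) ^ w * ∑' n, a n * (1 - (x : ℂ)) ^ n) (𝓝[>] 0) (𝓝 L) := by
  have hwN : NotNonposInt w := fun k h => by
    rw [h] at hw; simp only [neg_re, natCast_re] at hw
    linarith [Nat.cast_nonneg (α := ℝ) k]
  have hwN' : NotNonposInt (w.re : ℂ) := fun k h => by
    have := congrArg re h
    simp only [neg_re, natCast_re, ofReal_re] at this
    linarith [Nat.cast_nonneg (α := ℝ) k]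
  have hb0 : ∀ n : ℕ, poch w n / n.factorial ≠ 0 := fun n =>
    div_ne_zero (poch_natCast_ne_zero hwN n) (by exact_mod_cast n.factorial_ne_zero)
  -- the coefficients of the two binomial series have comparable size
  have hratio : ∃ M : ℝ, ∀ n : ℕ, ‖poch w n / n.factorial‖ / binomCoeff w.re n ≤ M := by
    have h1 : Tendsto (fun n : ℕ => ‖GammaSeq w.re n / GammaSeq w n‖) atTop
        (𝓝 ‖Gamma w.re / Gamma w‖) :=
      ((GammaSeq_tendsto_Gamma _).div (GammaSeq_tendsto_Gamma _) (Gamma_ne_zero hwN)).norm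
    have h2 : Tendsto (fun n : ℕ => ‖poch w n / n.factorial‖ / binomCoeff w.re n) atTop
        (𝓝 ‖Gamma w.re / Gamma w‖) := by
      rw [← tendsto_add_atTop_iff_nat 1]
      refine h1.congr' ?_
      filter_upwards [eventually_gt_atTop 0] with n hn
      have e1 := poch_mul_GammaSeq hwN n
      have e2 := poch_mul_GammaSeq hwN' n
      have g1 := GammaSeq_ne_zero hwN hn.ne'
      have g2 := GammaSeq_ne_zero hwN' hn.ne'
      have hp := poch_natCast_ne_zero hwN' (n + 1)
      push_cast at hp
      have e3 : ‖(n : ℂ) ^ w‖ = ‖(n : ℂ) ^ (w.re : ℂ)‖ := by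
        rw [norm_natCast_cpow_of_pos hn, norm_natCast_cpow_of_pos hn, ofReal_re]
      have e4 : ‖poch w ((n : ℤ) + 1)‖ * ‖GammaSeq w n‖ =
          ‖poch w.re ((n : ℤ) + 1)‖ * ‖GammaSeq w.re n‖ := by
        rw [← norm_mul, ← norm_mul, e1, e2, norm_mul, norm_mul, e3]
      have e5 : binomCoeff w.re (n + 1) = ‖poch w.re ((n : ℤ) + 1)‖ / (n + 1).factorial := by
        rw [← abs_of_pos (binomCoeff_pos hw (n + 1)), ← Real.norm_eq_abs, ← norm_real,
          ofReal_binomCoeff, norm_div, Complex.norm_natCast]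
        push_cast; rfl
      have n1 := norm_pos_iff.2 g1
      have n2 := norm_pos_iff.2 g2
      have n3 := norm_pos_iff.2 hp
      have hf : (0 : ℝ) < (n + 1).factorial := by exact_mod_cast Nat.factorial_pos _
      rw [e5, norm_div, norm_div, Complex.norm_natCast]
      push_cast
      field_simp
      linear_combination -e4
    obtain ⟨M, hM⟩ := h2.bddAbove_range
    exact ⟨M, fun n => hM ⟨n, rfl⟩⟩
  obtain ⟨M, hM⟩ := hratio
  set d : ℕ → ℂ := fun n => a n - L * (poch w n / n.factorial) with hd
  have hd0 : Tendsto (fun n => ‖d n‖ / binomCoeff w.re n) atTop (𝓝 0) := by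
    have h1 : Tendsto (fun n : ℕ => ‖a n / (poch w n / n.factorial) - L‖ * M) atTop (𝓝 0) := by
      have := ((hlim.sub_const L).norm).mul_const M
      simpa using this
    refine squeeze_zero (fun n => div_nonneg (norm_nonneg _) (binomCoeff_pos hw n).le)
      (fun n => ?_) h1
    have e : d n = (a n / (poch w n / n.factorial) - L) * (poch w n / n.factorial) := by
      rw [hd, sub_mul, div_mul_cancel₀ _ (hb0 n)]
    rw [e, norm_mul, mul_div_assoc]
    exact mul_le_mul_of_nonneg_left (hM n) (norm_nonneg _)
  have key := tendsto_rpow_mul_tsum_of_tendsto_zero hw hd0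
  rw [tendsto_iff_norm_sub_tendsto_zero]
  refine key.congr' ?_
  filter_upwards [Ioo_mem_nhdsGT (show (0 : ℝ) < 1 by norm_num)] with x hx
  have hxn : ‖1 - (x : ℂ)‖ < 1 := by
    rw [← ofReal_one, ← ofReal_sub, norm_real, Real.norm_eq_abs, abs_lt]
    constructor <;> linarith [hx.1, hx.2]
  have hx0 : (x : ℂ) ≠ 0 := by exact_mod_cast hx.1.ne'
  have h1 := ha.hasSum hxn
  have h2 := (hasSum_binomial w hxn).mul_left L
  have h3 : ∑' n, d n * (1 - (x : ℂ)) ^ n =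
      ∑' n, a n * (1 - (x : ℂ)) ^ n - L * (1 / (x : ℂ) ^ w) := by
    have h4 := (h1.sub h2).of_forall_eq (g := fun n => d n * (1 - (x : ℂ)) ^ n)
      fun n => by rw [hd]; ring
    rw [h4.tsum_eq]; ring_nf
  have hxw : (x : ℂ) ^ w ≠ 0 := by simp [cpow_eq_zero_iff, hx0]
  rw [h3, ← norm_cpow_eq_rpow_re_of_pos hx.1, ← norm_mul]
  congr 1
  field_simp

theorem hypCoeff_div_succ {A B C w : ℂ} (hA : NotNonposInt A) (hB : NotNonposInt B)
    (hC : NotNonposInt C) (hw : NotNonposInt w) {n : ℕ} (hn : 0 < n) :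
    hypCoeff A B C (n + 1) / (poch w ((n + 1 : ℕ) : ℤ) / (n + 1).factorial) =
      (n : ℂ) ^ (A + B - C - w)
        * (GammaSeq C n * GammaSeq w n / (GammaSeq A n * GammaSeq B n)) := by
  have hn0 : (n : ℂ) ≠ 0 := by exact_mod_cast hn.ne'
  have eA := poch_mul_GammaSeq hA n
  have eB := poch_mul_GammaSeq hB n
  have eC := poch_mul_GammaSeq hC n
  have ew := poch_mul_GammaSeq hw n
  have gA := GammaSeq_ne_zero hA hn.ne'
  have gB := GammaSeq_ne_zero hB hn.ne'
  have gC := GammaSeq_ne_zero hC hn.ne'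
  have gw := GammaSeq_ne_zero hw hn.ne'
  have hf : (n.factorial : ℂ) ≠ 0 := by exact_mod_cast n.factorial_ne_zero
  have hf' : ((n + 1).factorial : ℂ) ≠ 0 := by exact_mod_cast (n + 1).factorial_ne_zero
  have hpow : ∀ z : ℂ, (n : ℂ) ^ z ≠ 0 := fun z => by simp [cpow_eq_zero_iff, hn0]
  rw [hypCoeff]
  push_cast
  rw [eq_div_of_mul_eq gA eA, eq_div_of_mul_eq gB eB, eq_div_of_mul_eq gC eC,
    eq_div_of_mul_eq gw ew, cpow_sub _ _ hn0, cpow_sub _ _ hn0, cpow_add _ _ hn0]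
  have h1 := hpow C
  have h2 := hpow w
  field_simp

/-- For `Re (A + B - C) > 0`, the hypergeometric function grows like a constant times
`x ^ (C - A - B)` at `1 - x` for `x → 0`. -/
theorem tendsto_cpow_mul_hyp {A B C w : ℂ} (hA : NotNonposInt A) (hB : NotNonposInt B)
    (hC : NotNonposInt C) (hwre : 0 < w.re) (hw : A + B - C = w) :
    Tendsto (fun x : ℝ => (x : ℂ) ^ w * hyp A B C (1 - (x : ℂ))) (𝓝[>] 0)
      (𝓝 (Gamma C * Gamma w / (Gamma A * Gamma B))) := by
  have hwN : NotNonposInt w := fun k h => by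
    rw [h] at hwre; simp only [neg_re, natCast_re] at hwre
    linarith [Nat.cast_nonneg (α := ℝ) k]
  refine tendsto_cpow_mul_tsum hwre (polyBound_hypCoeff hA hB hC) ?_
  rw [← tendsto_add_atTop_iff_nat 1]
  have h : Tendsto (fun n => GammaSeq C n * GammaSeq w n / (GammaSeq A n * GammaSeq B n)) atTop
      (𝓝 (Gamma C * Gamma w / (Gamma A * Gamma B))) :=
    ((GammaSeq_tendsto_Gamma C).mul (GammaSeq_tendsto_Gamma w)).div
      ((GammaSeq_tendsto_Gamma A).mul (GammaSeq_tendsto_Gamma B))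
      (mul_ne_zero (Gamma_ne_zero hA) (Gamma_ne_zero hB))
  refine h.congr' ?_
  filter_upwards [eventually_gt_atTop 0] with n hn
  rw [hypCoeff_div_succ hA hB hC hwN hn, hw, sub_self, cpow_zero, one_mul]

theorem tendsto_cpow_mul_hyp_zero {A B C w : ℂ} (hA : NotNonposInt A) (hB : NotNonposInt B)
    (hC : NotNonposInt C) (hwre : 0 < w.re) (hw : A + B - C + 1 = w) :
    Tendsto (fun x : ℝ => (x : ℂ) ^ w * hyp A B C (1 - (x : ℂ))) (𝓝[>] 0) (𝓝 0) := by
  have hwN : NotNonposInt w := fun k h => by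
    rw [h] at hwre; simp only [neg_re, natCast_re] at hwre
    linarith [Nat.cast_nonneg (α := ℝ) k]
  refine tendsto_cpow_mul_tsum hwre (polyBound_hypCoeff hA hB hC) ?_
  rw [← tendsto_add_atTop_iff_nat 1]
  have h : Tendsto (fun n => GammaSeq C n * GammaSeq w n / (GammaSeq A n * GammaSeq B n)) atTop
      (𝓝 (Gamma C * Gamma w / (Gamma A * Gamma B))) :=
    ((GammaSeq_tendsto_Gamma C).mul (GammaSeq_tendsto_Gamma w)).div
      ((GammaSeq_tendsto_Gamma A).mul (GammaSeq_tendsto_Gamma B))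
      (mul_ne_zero (Gamma_ne_zero hA) (Gamma_ne_zero hB))
  have h' := (tendsto_inv_atTop_nhds_zero_nat (𝕜 := ℂ)).mul h
  rw [zero_mul] at h'
  refine h'.congr' ?_
  filter_upwards [eventually_gt_atTop 0] with n hn
  rw [hypCoeff_div_succ hA hB hC hwN hn, show A + B - C - w = -1 by rw [← hw]; ring, cpow_neg_one]

/-! ### The connection formula of Gauss -/

/-- The lens where both `₂F₁(·; y)` and `₂F₁(·; 1 - y)` are given by their series. -/
def lens : Set ℂ := {y | ‖y‖ < 1 ∧ ‖1 - y‖ < 1}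

theorem isOpen_lens : IsOpen lens :=
  (isOpen_lt continuous_norm continuous_const).inter
    (isOpen_lt (continuous_const.sub continuous_id).norm continuous_const)

theorem convex_lens : Convex ℝ lens := by
  have : lens = Metric.ball (0 : ℂ) 1 ∩ Metric.ball (1 : ℂ) 1 := by
    ext y
    simp [lens, dist_eq_norm, norm_sub_rev]
  rw [this]
  exact (convex_ball _ _).inter (convex_ball _ _)

theorem re_pos_of_norm_one_sub_lt {y : ℂ} (h : ‖1 - y‖ < 1) : 0 < y.re := by
  have := (re_le_norm (1 - y)).trans_lt h
  simp only [sub_re, one_re] at this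
  linarith

theorem mem_slitPlane_of_mem_lens {y : ℂ} (hy : y ∈ lens) :
    y ∈ slitPlane ∧ 1 - y ∈ slitPlane := by
  refine ⟨Or.inl (re_pos_of_norm_one_sub_lt hy.2), Or.inl (re_pos_of_norm_one_sub_lt ?_)⟩
  rw [sub_sub_cancel]; exact hy.1

theorem ofReal_mem_lens {x : ℝ} (hx : x ∈ Ioo (0 : ℝ) 1) : (x : ℂ) ∈ lens := by
  constructor
  · rw [norm_real, Real.norm_eq_abs, abs_lt]; constructor <;> linarith [hx.1, hx.2]
  · rw [← ofReal_one, ← ofReal_sub, norm_real, Real.norm_eq_abs, abs_lt]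
    constructor <;> linarith [hx.1, hx.2]

theorem one_sub_mem_lens {y : ℂ} (hy : y ∈ lens) : 1 - y ∈ lens :=
  ⟨hy.2, by rw [sub_sub_cancel]; exact hy.1⟩

/-- `f`, with derivatives `f₁` and `f₂`, solves the hypergeometric differential equation on the
lens. -/
structure IsHypSolution (A B C : ℂ) (f f₁ f₂ : ℂ → ℂ) : Prop where
  deriv₁ : ∀ y ∈ lens, HasDerivAt f (f₁ y) y
  deriv₂ : ∀ y ∈ lens, HasDerivAt f₁ (f₂ y) y
  ode : ∀ y ∈ lens, y * (1 - y) * f₂ y + (C - (A + B + 1) * y) * f₁ y - A * B * f y = 0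

/-- The Wronskian of two functions, divided by the Wronskian `y ^ (-C) (1 - y) ^ (C - A - B - 1)`
that Abel's formula predicts for the hypergeometric differential equation. -/
noncomputable def normWronskian (A B C : ℂ) (f f₁ g g₁ : ℂ → ℂ) (y : ℂ) : ℂ :=
  y ^ C * (1 - y) ^ (A + B - C + 1) * (f y * g₁ y - f₁ y * g y)

/-- The normalized Wronskian of two solutions is constant: this is Abel's formula. -/
theorem IsHypSolution.normWronskian_eq {A B C : ℂ} {f f₁ f₂ g g₁ g₂ : ℂ → ℂ}
    (hf : IsHypSolution A B C f f₁ f₂) (hg : IsHypSolution A B C g g₁ g₂) {y z : ℂ}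
    (hy : y ∈ lens) (hz : z ∈ lens) :
    normWronskian A B C f f₁ g g₁ y = normWronskian A B C f f₁ g g₁ z := by
  have hd : ∀ y ∈ lens, HasDerivAt (normWronskian A B C f f₁ g g₁) 0 y := by
    intro y hy
    obtain ⟨hs1, hs2⟩ := mem_slitPlane_of_mem_lens hy
    have hy0 : y ≠ 0 := slitPlane_ne_zero hs1
    have hy1 : 1 - y ≠ 0 := slitPlane_ne_zero hs2
    have d1 : HasDerivAt (fun y : ℂ => y ^ C) (C * y ^ (C - 1)) y := by
      simpa using (hasDerivAt_id y).cpow_const (c := C) hs1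
    have d2 : HasDerivAt (fun y : ℂ => (1 - y) ^ (A + B - C + 1))
        ((A + B - C + 1) * (1 - y) ^ (A + B - C) * (-1)) y := by
      have := ((hasDerivAt_id y).const_sub 1).cpow_const (c := A + B - C + 1) hs2
      simpa using this
    have d3 := ((hf.deriv₁ y hy).mul (hg.deriv₂ y hy)).sub ((hf.deriv₂ y hy).mul (hg.deriv₁ y hy))
    refine ((d1.mul d2).mul d3).congr_deriv ?_
    have ef := hf.ode y hy
    have eg := hg.ode y hy
    simp only [Pi.mul_apply, Pi.sub_apply]
    rw [cpow_sub _ _ hy0, cpow_one, cpow_add _ _ hy1, cpow_one]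
    field_simp
    linear_combination y ^ C * (1 - y) ^ (A + B - C) * ((f y) * eg - (g y) * ef)
  exact isOpen_lens.is_const_of_deriv_eq_zero convex_lens.isPreconnected
    (fun y hy => (hd y hy).differentiableAt.differentiableWithinAt)
    (fun y hy => (hd y hy).deriv) hy hz

theorem isHypSolution_hyp {A B C : ℂ} (hA : NotNonposInt A) (hB : NotNonposInt B)
    (hC : NotNonposInt C) :
    IsHypSolution A B C (hyp A B C) (fun y => A * B / C * hyp (A + 1) (B + 1) (C + 1) y)
      (hypDeriv₂ A B C) where
  deriv₁ _ hy := hasDerivAt_hyp hA hB hC hy.1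
  deriv₂ _ hy := (hasDerivAt_hyp hA.add_one hB.add_one hC.add_one hy.1).const_mul _
  ode _ hy := hyp_ode hA hB hC hy.1

/-- The regular solution at `y = 1`. -/
theorem isHypSolution_hyp_one_sub {A B C D : ℂ} (hA : NotNonposInt A) (hB : NotNonposInt B)
    (hD : NotNonposInt D) (hDC : D = A + B - C + 1) :
    IsHypSolution A B C (fun y => hyp A B D (1 - y))
      (fun y => -(A * B / D * hyp (A + 1) (B + 1) (D + 1) (1 - y)))
      (fun y => hypDeriv₂ A B D (1 - y)) where
  deriv₁ y hy := by
    have := (hasDerivAt_hyp hA hB hD hy.2).comp y ((hasDerivAt_id y).const_sub 1)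
    simpa [Function.comp_def] using this
  deriv₂ y hy := by
    have := (((hasDerivAt_hyp hA.add_one hB.add_one hD.add_one hy.2).const_mul
      (A * B / D)).comp y ((hasDerivAt_id y).const_sub 1)).neg
    simpa [Function.comp_def, hypDeriv₂, Pi.neg_def] using this
  ode y hy := by
    have := hyp_ode hA hB hD hy.2
    rw [hDC] at this ⊢
    linear_combination this

theorem cpow_sub_one_mul {z : ℂ} (hz : z ≠ 0) (w : ℂ) : z ^ (w - 1) * z = z ^ w := by
  rw [cpow_sub _ _ hz, cpow_one, div_mul_cancel₀ _ hz]

/-- The solution at `y = 1` with exponent `κ = C - A - B`. -/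
theorem isHypSolution_cpow_mul_hyp {A B C κ : ℂ} (hA : NotNonposInt (C - A))
    (hB : NotNonposInt (C - B)) (hκ : NotNonposInt (κ + 1)) (hκC : κ = C - A - B) :
    IsHypSolution A B C (fun y => (1 - y) ^ κ * hyp (C - A) (C - B) (κ + 1) (1 - y))
      (fun y => -(κ * (1 - y) ^ (κ - 1) * hyp (C - A) (C - B) (κ + 1) (1 - y) +
        (1 - y) ^ κ *
          ((C - A) * (C - B) / (κ + 1) * hyp (C - A + 1) (C - B + 1) (κ + 1 + 1) (1 - y))))
      (fun y => κ * (κ - 1) * (1 - y) ^ (κ - 1 - 1) * hyp (C - A) (C - B) (κ + 1) (1 - y) +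
        2 * κ * (1 - y) ^ (κ - 1) *
          ((C - A) * (C - B) / (κ + 1) * hyp (C - A + 1) (C - B + 1) (κ + 1 + 1) (1 - y)) +
        (1 - y) ^ κ * hypDeriv₂ (C - A) (C - B) (κ + 1) (1 - y)) where
  deriv₁ y hy := by
    have hs := (mem_slitPlane_of_mem_lens hy).2
    have d1 : HasDerivAt (fun y : ℂ => (1 - y) ^ κ) (κ * (1 - y) ^ (κ - 1) * (-1)) y := by
      simpa using ((hasDerivAt_id y).const_sub 1).cpow_const (c := κ) hs
    have d2 : HasDerivAt (fun y => hyp (C - A) (C - B) (κ + 1) (1 - y)) _ y :=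
      (hasDerivAt_hyp hA hB hκ hy.2).comp y ((hasDerivAt_id y).const_sub 1)
    refine (d1.mul d2).congr_deriv ?_
    ring
  deriv₂ y hy := by
    have hs := (mem_slitPlane_of_mem_lens hy).2
    have d0 : HasDerivAt (fun y : ℂ => (1 - y) ^ κ) (κ * (1 - y) ^ (κ - 1) * (-1)) y := by
      simpa using ((hasDerivAt_id y).const_sub 1).cpow_const (c := κ) hs
    have d1 : HasDerivAt (fun y : ℂ => (1 - y) ^ (κ - 1))
        ((κ - 1) * (1 - y) ^ (κ - 1 - 1) * (-1)) y := by
      simpa using ((hasDerivAt_id y).const_sub 1).cpow_const (c := κ - 1) hs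
    have d2 : HasDerivAt (fun y => hyp (C - A) (C - B) (κ + 1) (1 - y)) _ y :=
      (hasDerivAt_hyp hA hB hκ hy.2).comp y ((hasDerivAt_id y).const_sub 1)
    have d3 : HasDerivAt (fun y => (C - A) * (C - B) / (κ + 1) *
        hyp (C - A + 1) (C - B + 1) (κ + 1 + 1) (1 - y)) _ y :=
      ((hasDerivAt_hyp hA.add_one hB.add_one hκ.add_one hy.2).comp y
        ((hasDerivAt_id y).const_sub 1)).const_mul _
    refine ((((d1.const_mul κ).mul d2).add (d0.mul d3)).neg).congr_deriv ?_
    rw [hypDeriv₂]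
    ring
  ode y hy := by
    have hs := (mem_slitPlane_of_mem_lens hy).2
    have hy1 : 1 - y ≠ 0 := slitPlane_ne_zero hs
    have h := hyp_ode hA hB hκ hy.2
    have p1 : (1 - y) ^ κ = (1 - y) ^ (κ - 1) * (1 - y) := (cpow_sub_one_mul hy1 κ).symm
    have p2 : (1 - y) ^ (κ - 1 - 1) * (1 - y) = (1 - y) ^ (κ - 1) :=
      cpow_sub_one_mul hy1 (κ - 1)
    rw [p1]
    generalize (C - A) * (C - B) / (κ + 1) * hyp (C - A + 1) (C - B + 1) (κ + 1 + 1) (1 - y) = F₁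
      at h ⊢
    generalize hyp (C - A) (C - B) (κ + 1) (1 - y) = F at h ⊢
    generalize hypDeriv₂ (C - A) (C - B) (κ + 1) (1 - y) = F₂ at h ⊢
    generalize (1 - y) ^ (κ - 1) = T at p2 ⊢
    generalize (1 - y) ^ (κ - 1 - 1) = T' at p2 ⊢
    subst hκC
    linear_combination T * (1 - y) * h + y * (C - A - B) * (C - A - B - 1) * F * p2

/-- The derivative of the solution with exponent `κ`, in closed form. -/
theorem cpow_mul_hyp_deriv_eq {A B κ z : ℂ} (hA : NotNonposInt A) (hB : NotNonposInt B)
    (hκ : NotNonposInt κ) (hz : ‖z‖ < 1) (hz0 : z ≠ 0) :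
    κ * z ^ (κ - 1) * hyp A B (κ + 1) z +
      z ^ κ * (A * B / (κ + 1) * hyp (A + 1) (B + 1) (κ + 1 + 1) z) =
      κ * z ^ (κ - 1) * hyp A B κ z := by
  have h := hyp_contiguous hA hB hκ hz
  have p1 : z ^ κ = z ^ (κ - 1) * z := (cpow_sub_one_mul hz0 κ).symm
  rw [p1]
  linear_combination z ^ (κ - 1) * h

theorem IsHypSolution.normWronskian_eq_of_tendsto {A B C l : ℂ} {f f₁ f₂ g g₁ g₂ : ℂ → ℂ}
    (hf : IsHypSolution A B C f f₁ f₂) (hg : IsHypSolution A B C g g₁ g₂) {φ : ℝ → ℂ}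
    (hφ : ∀ᶠ x in 𝓝[>] 0, φ x ∈ lens)
    (h : Tendsto (fun x => normWronskian A B C f f₁ g g₁ (φ x)) (𝓝[>] 0) (𝓝 l)) {y : ℂ}
    (hy : y ∈ lens) : normWronskian A B C f f₁ g g₁ y = l := by
  refine tendsto_nhds_unique (tendsto_const_nhds.congr' ?_) h
  filter_upwards [hφ] with x hx
  exact hf.normWronskian_eq hg hy hx

theorem eventually_mem_Ioo_zero_one : ∀ᶠ x : ℝ in 𝓝[>] 0, x ∈ Ioo (0 : ℝ) 1 :=
  Ioo_mem_nhdsGT one_pos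

theorem tendsto_ofReal_nhdsGT_zero : Tendsto (fun x : ℝ => (x : ℂ)) (𝓝[>] 0) (𝓝 0) := by
  have := (continuous_ofReal.tendsto 0).mono_left (nhdsWithin_le_nhds (s := Ioi (0 : ℝ)))
  simpa using this

theorem tendsto_comp_ofReal {f : ℂ → ℂ} (hf : ContinuousAt f 0) :
    Tendsto (fun x : ℝ => f x) (𝓝[>] 0) (𝓝 (f 0)) :=
  hf.tendsto.comp tendsto_ofReal_nhdsGT_zero

theorem continuousAt_one_sub_cpow (w : ℂ) : ContinuousAt (fun y : ℂ => (1 - y) ^ w) 0 :=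
  ContinuousAt.cpow (f := fun y : ℂ => 1 - y) (by fun_prop) continuousAt_const (by simp)

/-- The Wronskian of the regular solution at `y = 0` with a solution `g` is read off from the
behaviour of `g` at `y = 0`. -/
theorem tendsto_normWronskian_hyp {A B C l : ℂ} (hA : NotNonposInt A) (hB : NotNonposInt B)
    (hC : NotNonposInt C) {g g₁ : ℂ → ℂ}
    (hg : Tendsto (fun x : ℝ => (x : ℂ) ^ C * g x) (𝓝[>] 0) (𝓝 0))
    (hg₁ : Tendsto (fun x : ℝ => (x : ℂ) ^ C * g₁ x) (𝓝[>] 0) (𝓝 l)) :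
    Tendsto (fun x : ℝ => normWronskian A B C (hyp A B C)
      (fun y => A * B / C * hyp (A + 1) (B + 1) (C + 1) y) g g₁ x) (𝓝[>] 0) (𝓝 l) := by
  have h0 : ‖(0 : ℂ)‖ < 1 := by simp
  have t1 := tendsto_comp_ofReal (continuousAt_one_sub_cpow (A + B - C + 1))
  have t2 := tendsto_comp_ofReal (continuousAt_hyp hA hB hC h0)
  have t3 := tendsto_comp_ofReal
    ((continuousAt_hyp hA.add_one hB.add_one hC.add_one h0).const_mul (A * B / C))
  have := t1.mul ((t2.mul hg₁).sub (t3.mul hg))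
  simp only [sub_zero, one_cpow, hyp_zero, mul_zero, one_mul] at this
  refine this.congr fun x => ?_
  rw [normWronskian]; ring

theorem Gamma_add_one_mul {z : ℂ} (hz : NotNonposInt z) : Gamma (z + 1) = z * Gamma z :=
  Gamma_add_one z hz.ne_zero

/-- The connection formula for `Re C > 0`: the coefficients are quotients of Wronskians, which are
computed at the boundary points `y = 0` and `y = 1`. -/
theorem hyp_connection_of_re_pos {A B C : ℂ} (hA : NotNonposInt A) (hB : NotNonposInt B)
    (hC : 0 < C.re) (hCA : NotNonposInt (C - A)) (hCB : NotNonposInt (C - B))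
    (hCAB : ∀ k : ℤ, C - A - B ≠ k) {y : ℂ} (hy : y ∈ lens) :
    hyp A B C y =
      Gamma C * Gamma (C - A - B) / (Gamma (C - A) * Gamma (C - B))
          * hyp A B (A + B - C + 1) (1 - y)
        + Gamma C * Gamma (A + B - C) / (Gamma A * Gamma B)
          * ((1 - y) ^ (C - A - B) * hyp (C - A) (C - B) (C - A - B + 1) (1 - y)) := by
  have hCN : NotNonposInt C := fun k h => by
    rw [h] at hC; simp only [neg_re, natCast_re] at hC
    linarith [Nat.cast_nonneg (α := ℝ) k]
  obtain ⟨κ, hκ⟩ : ∃ κ, κ = C - A - B := ⟨_, rfl⟩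
  obtain ⟨D, hD⟩ : ∃ D, D = A + B - C + 1 := ⟨_, rfl⟩
  rw [← hκ] at hCAB ⊢
  rw [← hD, show A + B - C = -κ by rw [hκ]; ring]
  have hκN : NotNonposInt κ := fun k => by exact_mod_cast hCAB (-k)
  have hnκN : NotNonposInt (-κ) := fun k h => hCAB k (by push_cast; linear_combination -h)
  have hDκ : D = -κ + 1 := by rw [hD, hκ]; ring
  have hDN : NotNonposInt D := hDκ ▸ hnκN.add_one
  have su := isHypSolution_hyp hA hB hCN
  have s1 := isHypSolution_hyp_one_sub hA hB hDN hD
  have s2 := isHypSolution_cpow_mul_hyp hCA hCB hκN.add_one hκ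
  have hcont := tendsto_comp_ofReal (continuousAt_one_sub_cpow κ)
  simp only [sub_zero, one_cpow] at hcont
  -- the Wronskian of the regular solutions at the two points
  have w1 := su.normWronskian_eq_of_tendsto s1 (φ := fun x => (x : ℂ))
    (eventually_mem_Ioo_zero_one.mono fun x hx => ofReal_mem_lens hx)
    (tendsto_normWronskian_hyp (l := -(A * B / D *
        (Gamma (D + 1) * Gamma C / (Gamma (A + 1) * Gamma (B + 1))))) hA hB hCN
      (tendsto_cpow_mul_hyp_zero hA hB hDN hC (by rw [hD]; ring))
      (by
        have := ((tendsto_cpow_mul_hyp hA.add_one hB.add_one hDN.add_one hC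
          (by rw [hD]; ring)).const_mul (A * B / D)).neg
        refine this.congr fun x => ?_
        ring)) hy
  -- the Wronskian of the regular solution at `0` and the singular solution at `1`
  have w2 := su.normWronskian_eq_of_tendsto s2 (φ := fun x => (x : ℂ))
    (eventually_mem_Ioo_zero_one.mono fun x hx => ofReal_mem_lens hx)
    (tendsto_normWronskian_hyp (l := -(κ *
        (Gamma κ * Gamma C / (Gamma (C - A) * Gamma (C - B))))) hA hB hCN
      (by
        have := hcont.mul (tendsto_cpow_mul_hyp_zero hCA hCB hκN.add_one hC (by rw [hκ]; ring))
        rw [mul_zero] at this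
        refine this.congr fun x => ?_
        ring)
      (by
        have hcont' := tendsto_comp_ofReal (continuousAt_one_sub_cpow (κ - 1))
        simp only [sub_zero, one_cpow] at hcont'
        have := ((hcont'.mul (tendsto_cpow_mul_hyp hCA hCB hκN hC
          (by rw [hκ]; ring))).const_mul κ).neg
        rw [one_mul] at this
        refine this.congr' ?_
        filter_upwards [eventually_mem_Ioo_zero_one] with x hx
        have hl := ofReal_mem_lens hx
        have h1 := cpow_mul_hyp_deriv_eq hCA hCB hκN hl.2
          (slitPlane_ne_zero (mem_slitPlane_of_mem_lens hl).2)
        rw [h1]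
        ring)) hy
  -- the Wronskian of the two solutions at `1`
  have w12 : normWronskian A B C _ _ _ _ y = -κ :=
    s1.normWronskian_eq_of_tendsto s2 (φ := fun x => 1 - (x : ℂ))
    (eventually_mem_Ioo_zero_one.mono fun x hx => one_sub_mem_lens (ofReal_mem_lens hx))
    (by
      have h0 : ‖(0 : ℂ)‖ < 1 := by simp
      have t0 := tendsto_comp_ofReal (continuousAt_one_sub_cpow C)
      have t1 := tendsto_comp_ofReal (continuousAt_hyp hA hB hDN h0)
      have t2 := tendsto_comp_ofReal (continuousAt_hyp hCA hCB hκN h0)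
      have t3 := tendsto_comp_ofReal
        ((continuousAt_hyp hA.add_one hB.add_one hDN.add_one h0).const_mul (A * B / D))
      have t4 := tendsto_comp_ofReal (continuousAt_hyp hCA hCB hκN.add_one h0)
      have := t0.mul (((t1.mul t2).const_mul (-κ)).add
        (tendsto_ofReal_nhdsGT_zero.mul (t3.mul t4)))
      simp only [sub_zero, one_cpow, hyp_zero, mul_one, zero_mul, add_zero, one_mul] at this
      refine this.congr' ?_
      filter_upwards [eventually_mem_Ioo_zero_one] with x hx
      have hl := ofReal_mem_lens hx
      have hx0 : (x : ℂ) ≠ 0 := slitPlane_ne_zero (mem_slitPlane_of_mem_lens hl).1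
      have h1 := cpow_mul_hyp_deriv_eq hCA hCB hκN hl.1 hx0
      have p1 : (x : ℂ) ^ (A + B - C + 1) * (x : ℂ) ^ (κ - 1) = 1 := by
        rw [← cpow_add _ _ hx0, show A + B - C + 1 + (κ - 1) = 0 by rw [hκ]; ring, cpow_zero]
      have p2 := cpow_sub_one_mul hx0 κ
      simp only [normWronskian, sub_sub_cancel]
      rw [h1, ← p2]
      linear_combination (-((1 - (x : ℂ)) ^ C) * (-κ * hyp A B D x * hyp (C - A) (C - B) κ x +
        x * (A * B / D * hyp (A + 1) (B + 1) (D + 1) x * hyp (C - A) (C - B) (κ + 1) x))) * p1) hy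
  have hκ0 := hκN.ne_zero
  -- the linear relation between three solutions, with the Wronskians as its coefficients
  have hrel : hyp A B C y * (-κ) =
      hyp A B D (1 - y) * (-(κ * (Gamma κ * Gamma C / (Gamma (C - A) * Gamma (C - B)))))
      - (1 - y) ^ κ * hyp (C - A) (C - B) (κ + 1) (1 - y) *
        (-(A * B / D * (Gamma (D + 1) * Gamma C / (Gamma (A + 1) * Gamma (B + 1))))) := by
    rw [← w1, ← w2, ← w12]
    simp only [normWronskian]
    ring
  have hA0 := hA.ne_zero
  have hB0 := hB.ne_zero
  have hD0 := hDN.ne_zero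
  have gA := Gamma_ne_zero hA
  have gB := Gamma_ne_zero hB
  have gCA := Gamma_ne_zero hCA
  have gCB := Gamma_ne_zero hCB
  have hGD : Gamma D = -κ * Gamma (-κ) := by rw [hDκ, Gamma_add_one_mul hnκN]
  rw [Gamma_add_one_mul hDN, Gamma_add_one_mul hA, Gamma_add_one_mul hB, hGD] at hrel
  refine mul_right_cancel₀ (neg_ne_zero.2 hκ0) ?_
  rw [hrel]
  field_simp
  ring

/-- The connection formula of Gauss. The derivative of the formula for `(A, B, C)` is the formula
for `(A + 1, B + 1, C + 1)`, and the differential equation recovers a solution from its first two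
derivatives; so the real part of `C` may be assumed positive. -/
theorem hyp_connection {A B C : ℂ} (hA : NotNonposInt A) (hB : NotNonposInt B)
    (hC : NotNonposInt C) (hCA : NotNonposInt (C - A)) (hCB : NotNonposInt (C - B))
    (hCAB : ∀ k : ℤ, C - A - B ≠ k) {y : ℂ} (hy : y ∈ lens) :
    hyp A B C y =
      Gamma C * Gamma (C - A - B) / (Gamma (C - A) * Gamma (C - B))
          * hyp A B (A + B - C + 1) (1 - y)
        + Gamma C * Gamma (A + B - C) / (Gamma A * Gamma B)
          * ((1 - y) ^ (C - A - B) * hyp (C - A) (C - B) (C - A - B + 1) (1 - y)) := by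
  obtain ⟨n, hn⟩ : ∃ n : ℕ, -(n : ℝ) < C.re := by
    obtain ⟨n, hn⟩ := exists_nat_gt (-C.re)
    exact ⟨n, by linarith⟩
  induction n generalizing A B C y with
  | zero => exact hyp_connection_of_re_pos hA hB (by simpa using hn) hCA hCB hCAB hy
  | succ n ih =>
    have ih' := fun {y : ℂ} (hy : y ∈ lens) => ih hA.add_one hB.add_one hC.add_one
      (by rwa [add_sub_add_right_eq_sub]) (by rwa [add_sub_add_right_eq_sub])
      (fun k h => hCAB (k + 1) (by push_cast; linear_combination h)) hy
      (by push_cast at hn; simp only [add_re, one_re]; linarith)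
    obtain ⟨κ, hκ⟩ : ∃ κ, κ = C - A - B := ⟨_, rfl⟩
    obtain ⟨D, hD⟩ : ∃ D, D = A + B - C + 1 := ⟨_, rfl⟩
    simp only [add_sub_add_right_eq_sub, show C - A - (B + 1) = κ - 1 by rw [hκ]; ring,
      show A + 1 + (B + 1) - (C + 1) = D by rw [hD]; ring, sub_add_cancel] at ih'
    rw [← hκ] at hCAB ⊢
    rw [← hD, show A + B - C = -κ by rw [hκ]; ring]
    have hκN : NotNonposInt κ := fun k => by exact_mod_cast hCAB (-k)
    have hnκN : NotNonposInt (-κ) := fun k h => hCAB k (by push_cast; linear_combination -h)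
    have hDκ : D = -κ + 1 := by rw [hD, hκ]; ring
    have hDN : NotNonposInt D := hDκ ▸ hnκN.add_one
    have su := isHypSolution_hyp hA hB hC
    have s1 := isHypSolution_hyp_one_sub hA hB hDN hD
    have s2 := isHypSolution_cpow_mul_hyp hCA hCB hκN.add_one hκ
    set α := Gamma C * Gamma κ / (Gamma (C - A) * Gamma (C - B)) with hα
    set β := Gamma C * Gamma (-κ) / (Gamma A * Gamma B) with hβ
    have hA0 := hA.ne_zero
    have hB0 := hB.ne_zero
    have hC0 := hC.ne_zero
    have hD0 := hDN.ne_zero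
    have hκ0 := hκN.ne_zero
    have gA := Gamma_ne_zero hA
    have gB := Gamma_ne_zero hB
    have gCA := Gamma_ne_zero hCA
    have gCB := Gamma_ne_zero hCB
    have hκ1 : κ - 1 ≠ 0 := fun h => hCAB 1 (by push_cast; linear_combination h)
    have hGD : Gamma D = -κ * Gamma (-κ) := by rw [hDκ, Gamma_add_one_mul hnκN]
    have hGκ : Gamma κ = (κ - 1) * Gamma (κ - 1) := by
      have := Gamma_add_one (κ - 1) hκ1
      rwa [sub_add_cancel] at this
    have hD1 : D = -(κ - 1) := by rw [hDκ]; ring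
    -- the formula holds for the first derivatives
    have h1 : ∀ z ∈ lens, A * B / C * hyp (A + 1) (B + 1) (C + 1) z
        - (α * -(A * B / D * hyp (A + 1) (B + 1) (D + 1) (1 - z))
        + β * -(κ * (1 - z) ^ (κ - 1) * hyp (C - A) (C - B) (κ + 1) (1 - z) +
        (1 - z) ^ κ * ((C - A) * (C - B) / (κ + 1) *
          hyp (C - A + 1) (C - B + 1) (κ + 1 + 1) (1 - z)))) = 0 := by
      intro z hz
      rw [cpow_mul_hyp_deriv_eq hCA hCB hκN hz.2
        (slitPlane_ne_zero (mem_slitPlane_of_mem_lens hz).2), ih' hz, hα, hβ,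
        Gamma_add_one_mul hC, Gamma_add_one_mul hA, Gamma_add_one_mul hB, hGD, hGκ, hD1]
      field_simp
      ring
    have h2 := (su.deriv₂ y hy).sub (((s1.deriv₂ y hy).const_mul α).add
      ((s2.deriv₂ y hy).const_mul β))
    have h3 := h2.unique ((hasDerivAt_const y (0 : ℂ)).congr_of_eventuallyEq
      (Filter.eventuallyEq_of_mem (isOpen_lens.mem_nhds hy) h1))
    have o0 := su.ode y hy
    have o1 := s1.ode y hy
    have o2 := s2.ode y hy
    have h4 := h1 y hy
    have hAB := mul_ne_zero hA0 hB0
    refine mul_left_cancel₀ hAB ?_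
    linear_combination (y * (1 - y)) * h3 + (C - (A + B + 1) * y) * h4 - o0 + α * o1 + β * o2

/-! ### The connection formula for Horn's function -/

theorem Gamma_add_natCast_eq {z : ℂ} (hz : NotNonposInt z) (n : ℕ) :
    Gamma (z + n) = poch z n * Gamma z := by
  induction n with
  | zero => simp
  | succ n ih =>
    have h := Gamma_add_one (z + n) (hz.add_natCast_ne_zero n)
    push_cast
    rw [← add_assoc, h, ih, poch_natCast_succ]
    ring

/-- The functional equation of the Gamma function in terms of `(z)_{-n}`. -/
theorem Gamma_sub_natCast_eq {z : ℂ} (hz : ∀ k : ℤ, z ≠ (k : ℂ)) (n : ℕ) :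
    Gamma (z - n) = poch z (-(n : ℤ)) * Gamma z := by
  have hz' : NotNonposInt (z - n) := fun k h =>
    hz (n - k) (by push_cast; linear_combination h)
  have h1 := Gamma_add_natCast_eq hz' n
  have h2 := poch_add_natCast hz (-(n : ℤ)) n
  rw [neg_add_cancel, poch_zero, Int.cast_neg, Int.cast_natCast, ← sub_eq_add_neg] at h2
  rw [sub_add_cancel] at h1
  rw [h1, ← mul_assoc, ← h2, one_mul]

/-- The terms of degree `m` in `x` of `H₅` sum up to a hypergeometric function of `y`. -/
theorem tsum_hornH5Term_row {a b c : ℂ} (hb : ∀ k : ℤ, b ≠ (k : ℂ)) (x y : ℂ) (m : ℕ) :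
    ∑' n : ℕ, hornH5Term a b c x y (m, n) =
      poch a (2 * m) * poch b (-(m : ℤ)) * (x ^ m / m.factorial)
        * hyp (a + 2 * m) (b - m) c y := by
  rw [hyp, ← tsum_mul_left]
  refine tsum_congr fun n => ?_
  have h1 := poch_natCast_add_natCast a (2 * m) n
  have h2 := poch_add_natCast hb (-(m : ℤ)) n
  push_cast at h1 h2
  rw [hornH5Term, hypCoeff, h1, sub_eq_neg_add, h2, ← sub_eq_add_neg]
  ring

/-- The terms of degree `m` in `x` of the first series sum up to a hypergeometric function of
`1 - y`. -/
theorem tsum_firstTerm_row {a b c : ℂ} (hb : ∀ k : ℤ, b ≠ (k : ℂ)) (x y : ℂ) (m : ℕ) :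
    ∑' n : ℕ, firstTerm a b c x y (m, n) =
      poch (a - c + 1) (2 * m) * poch a (2 * m) * poch b (-(m : ℤ))
        / (poch (c - b) m * poch (a + b - c + 1) m) * ((-x) ^ m / m.factorial)
        * hyp (a + 2 * m) (b - m) (a + b - c + 1 + m) (1 - y) := by
  rw [hyp, ← tsum_mul_left]
  refine tsum_congr fun n => ?_
  have h1 := poch_natCast_add_natCast a (2 * m) n
  have h2 := poch_add_natCast hb (-(m : ℤ)) n
  have h3 := poch_natCast_add_natCast (a + b - c + 1) m n
  push_cast at h1 h2
  rw [firstTerm, hypCoeff, h1, show (n : ℤ) - m = -m + n by ring, h2, h3, ← sub_eq_add_neg]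
  simp only [div_eq_mul_inv, mul_inv]
  ring

/-- The terms of degree `m` in `x` of the second series sum up to a hypergeometric function of
`1 - y`. The product `(a - c + 1)_{2m} (c - a)_{n - 2m}` is `(c - a - 2 m)_n`. -/
theorem tsum_secondTerm_row {a b c : ℂ} (hca : ∀ k : ℤ, c - a ≠ (k : ℂ))
    (hcb : ∀ k : ℕ, c - b ≠ -(k : ℂ)) (hcab : ∀ k : ℤ, c - a - b ≠ (k : ℂ)) (x y : ℂ) (m : ℕ) :
    ∑' n : ℕ, secondTerm a b c x y (m, n) =
      poch (-(c - a - b)) m * ((x / (1 - y)) ^ m / m.factorial)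
        * hyp (c - a - 2 * m) (c - b + m) (c - a - b - m + 1) (1 - y) := by
  rw [hyp, ← tsum_mul_left]
  refine tsum_congr fun n => ?_
  have hκ : ∀ k : ℤ, -a - b + c + 1 ≠ (k : ℂ) := fun k h =>
    hcab (k - 1) (by push_cast; linear_combination h)
  have h1 := poch_add_natCast hca (-(2 * m : ℕ) : ℤ) n
  have h2 := poch_natCast_add_natCast (c - b) m n
  have h3 := poch_add_natCast hκ (-(m : ℤ)) n
  have h4 := poch_neg_natCast (c - a) (2 * m)
  have h5 := poch_neg_natCast (-a - b + c + 1) m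
  have h6 := poch_natCast_ne_zero hcb m
  have h7 : poch (a - c + 1) ((2 * m : ℕ) : ℤ) ≠ 0 := poch_natCast_ne_zero (fun k h =>
    hca (k + 1) (by push_cast; linear_combination -h)) _
  rw [show 1 - (c - a) = a - c + 1 by ring, pow_mul] at h4
  rw [show 1 - (-a - b + c + 1) = -(c - a - b) by ring] at h5
  rw [h4] at h1
  rw [h5] at h3
  push_cast at h1 h3 h7
  rw [secondTerm, hypCoeff, show (n : ℤ) - 2 * m = -(2 * m) + n by ring,
    show (n : ℤ) - m = -m + n by ring, h1, h2, h3, ← sub_eq_add_neg, ← sub_eq_add_neg,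
    show -a - b + c + 1 - m = c - a - b - m + 1 by ring]
  dsimp only at *
  have h8 : ((-1 : ℂ) ^ m) * (-1) ^ m = 1 := by rw [← mul_pow]; simp
  have h9 := mul_inv_cancel₀ h6
  have h10 := mul_inv_cancel₀ h7
  rw [neg_pow (x / (1 - y))]
  simp only [div_eq_mul_inv, mul_inv, inv_inv, neg_one_sq, one_pow, one_mul]
  generalize (poch (a - c + 1) (2 * (m : ℤ)))⁻¹ = p' at *
  generalize (poch (c - b) (m : ℤ))⁻¹ = q' at *
  generalize (x * (1 - y)⁻¹) ^ m = t at *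
  generalize (-1 : ℂ) ^ m = s at *
  set K := poch (c - a - 2 * m) n * poch (c - b + m) n * (m.factorial : ℂ)⁻¹
    * (n.factorial : ℂ)⁻¹ * poch (-(c - a - b)) m * (poch (c - a - b - m + 1) n)⁻¹ * t
    * (1 - y) ^ n with hK
  calc _ = (poch (a - c + 1) (2 * m) * p') * (poch (c - b) m * q') * (s * s) * K := by
        rw [hK]; ring
    _ = K := by rw [h8, h9, h10]; ring
    _ = _ := by rw [hK]; ring

/-- The terms of a fixed degree in `x` on both sides of the connection formula for `H₅` are
related by the connection formula of Gauss. -/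
theorem hornH5_row_connection {a b c : ℂ}
    (ha : ∀ k : ℕ, a ≠ -(k : ℂ)) (hb : ∀ k : ℤ, b ≠ (k : ℂ)) (hc : ∀ k : ℕ, c ≠ -(k : ℂ))
    (hca : ∀ k : ℤ, c - a ≠ (k : ℂ)) (hcb : ∀ k : ℕ, c - b ≠ -(k : ℂ))
    (hcab : ∀ k : ℤ, c - a - b ≠ (k : ℂ)) (x : ℂ) {y : ℂ} (hy : y ∈ lens) (m : ℕ) :
    ∑' n : ℕ, hornH5Term a b c x y (m, n) =
      Gamma c * Gamma (-a - b + c) / (Gamma (c - a) * Gamma (c - b))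
          * ∑' n : ℕ, firstTerm a b c x y (m, n)
        + (1 - y) ^ (-a - b + c) * (Gamma c * Gamma (a + b - c) / (Gamma a * Gamma b)
          * ∑' n : ℕ, secondTerm a b c x y (m, n)) := by
  have hy1 : 1 - y ≠ 0 := slitPlane_ne_zero (mem_slitPlane_of_mem_lens hy).2
  have hA : NotNonposInt (a + 2 * m) := fun k h =>
    ha (k + 2 * m) (by push_cast; linear_combination h)
  have hB : NotNonposInt (b - m) := fun k h => hb (m - k) (by push_cast; linear_combination h)
  have hCA : NotNonposInt (c - (a + 2 * m)) := fun k h =>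
    hca (2 * m - k) (by push_cast; linear_combination h)
  have hCB : NotNonposInt (c - (b - m)) := fun k h =>
    hcb (k + m) (by push_cast; linear_combination h)
  have hCAB : ∀ k : ℤ, c - (a + 2 * m) - (b - m) ≠ k := fun k h =>
    hcab (k + m) (by push_cast; linear_combination h)
  have hκ : ∀ k : ℤ, -a - b + c ≠ (k : ℂ) := fun k h => hcab k (by rw [← h]; ring)
  have hκ' : NotNonposInt (a + b - c) := fun k h =>
    hcab k (by push_cast; linear_combination -h)
  have g1 := Gamma_sub_natCast_eq hκ m
  have g2 := Gamma_sub_natCast_eq hca (2 * m)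
  have g3 := Gamma_add_natCast_eq hcb m
  have g4 := Gamma_add_natCast_eq hκ' m
  have g5 := Gamma_add_natCast_eq ha (2 * m)
  have g6 := Gamma_sub_natCast_eq hb m
  have p1 := poch_neg_natCast (-a - b + c) m
  have p2 := poch_neg_natCast (c - a) (2 * m)
  rw [show 1 - (-a - b + c) = a + b - c + 1 by ring] at p1
  rw [show 1 - (c - a) = a - c + 1 by ring] at p2
  rw [p1] at g1
  rw [p2] at g2
  have n1 := poch_natCast_ne_zero ha (2 * m)
  have n2 := poch_ne_zero hb (-(m : ℤ))
  have n3 := poch_natCast_ne_zero hcb m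
  have n4 : poch (a + b - c + 1) m ≠ 0 := poch_natCast_ne_zero hκ'.add_one m
  have n5 : poch (a - c + 1) ((2 * m : ℕ) : ℤ) ≠ 0 := poch_natCast_ne_zero (fun k h =>
    hca (k + 1) (by push_cast; linear_combination -h)) _
  have n6 := Gamma_ne_zero ha
  have n7 := Gamma_ne_zero (ne_neg_natCast_of_ne_intCast hb)
  have n8 := Gamma_ne_zero hcb
  have n9 := Gamma_ne_zero (ne_neg_natCast_of_ne_intCast hca)
  have hpow : (1 - y) ^ (-a - b + c - m) = (1 - y) ^ (-a - b + c) * ((1 - y) ^ m)⁻¹ := by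
    rw [cpow_sub _ _ hy1, cpow_natCast, div_eq_mul_inv]
  push_cast at g2 g5 n1 n5
  rw [tsum_hornH5Term_row hb, tsum_firstTerm_row hb, tsum_secondTerm_row hca hcb hcab,
    hyp_connection hA hB hc hCA hCB hCAB hy,
    show c - (a + 2 * m) - (b - m) = -a - b + c - m by ring,
    show c - (a + 2 * m) = c - a - 2 * m by ring, show c - (b - m) = c - b + m by ring,
    show a + 2 * m + (b - m) - c + 1 = a + b - c + 1 + m by ring,
    show a + 2 * m + (b - m) - c = a + b - c + m by ring,
    show -a - b + c - m + 1 = c - a - b - m + 1 by ring,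
    show -(c - a - b) = a + b - c by ring, hpow, g1, g2, g3, g4, g5, g6, neg_pow x, div_pow]
  generalize hyp (a + 2 * m) (b - m) (a + b - c + 1 + m) (1 - y) = F
  generalize hyp (c - a - 2 * m) (c - b + m) (c - a - b - m + 1) (1 - y) = S
  have h8 : ((-1 : ℂ) ^ m) * (-1) ^ m = 1 := by rw [← mul_pow]; simp
  have h11 : ((-1 : ℂ) ^ m)⁻¹ = (-1) ^ m := inv_eq_of_mul_eq_one_left h8
  rw [mul_inv ((-1 : ℂ) ^ m), h11, pow_mul (-1 : ℂ), neg_one_sq, one_pow, one_mul]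
  have hym : (1 - y) ^ m ≠ 0 := pow_ne_zero _ hy1
  have hfac : (m.factorial : ℂ) ≠ 0 := by exact_mod_cast m.factorial_ne_zero
  rw [mul_add]
  congr 1
  · field_simp
  · field_simp

/-- The connection formula for `H₅` at all points where the three series converge absolutely. -/
theorem hornH5_eq_hornH5At01 {a b c : ℂ}
    (ha : ∀ k : ℕ, a ≠ -(k : ℂ)) (hb : ∀ k : ℤ, b ≠ (k : ℂ)) (hc : ∀ k : ℕ, c ≠ -(k : ℂ))
    (hca : ∀ k : ℤ, c - a ≠ (k : ℂ)) (hcb : ∀ k : ℕ, c - b ≠ -(k : ℂ))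
    (hcab : ∀ k : ℤ, c - a - b ≠ (k : ℂ)) {x y : ℂ} (hy : y ∈ lens)
    (h₀ : Summable (hornH5Term a b c x y)) (h₁ : Summable (firstTerm a b c x y))
    (h₂ : Summable (secondTerm a b c x y)) :
    hornH5 a b c x y = hornH5At01 a b c x y := by
  rw [hornH5, hornH5At01, firstPart, secondPart, h₀.tsum_prod, h₁.tsum_prod, h₂.tsum_prod,
    ← tsum_mul_left, ← tsum_mul_left, ← tsum_mul_left,
    ← (h₁.prod.mul_left _).tsum_add ((h₂.prod.mul_left _).mul_left _)]
  exact tsum_congr fun m => hornH5_row_connection ha hb hc hca hcb hcab x hy m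

/-! ### Connectedness of the regions -/

/-- In the parametrization of the curve, `√ρ` decreases and `epsPlus ρ` increases with `σ`. -/
theorem epsPlus_antitone {ρ₀ ρ : ℝ} (h₀ : 0 < ρ₀) (h : ρ₀ ≤ ρ) : epsPlus ρ ≤ epsPlus ρ₀ := by
  obtain ⟨σ, hσ, hσ3, hs, he⟩ := exists_epsPlus_param (h₀.trans_le h)
  obtain ⟨σ₀, hσ₀, hσ₀3, hs₀, he₀⟩ := exists_epsPlus_param h₀
  have h1 := Real.sqrt_le_sqrt h
  rw [hs, hs₀, div_le_div_iff₀ (by positivity) (by positivity)] at h1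
  have h2 : σ ≤ σ₀ := by
    by_contra! hlt
    nlinarith [mul_pos hσ hσ₀, mul_pos (mul_pos hσ hσ₀) (sub_pos.2 hlt)]
  have h3 : σ ^ 2 ≤ σ₀ ^ 2 := pow_le_pow_left₀ hσ.le h2 2
  rw [he, he₀]
  have h4 : 0 < 1 - 3 * σ₀ ^ 2 := by linarith
  gcongr

theorem secondBound_antitone {r₀ r s : ℝ} (h₀ : 0 < r₀) (h : r₀ ≤ r) (hs : 0 < s) :
    secondBound r s ≤ secondBound r₀ s := by
  have h1 : r₀ / s ≤ r / s := by gcongr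
  have h2 : 0 < r₀ / s := by positivity
  have h3 := epsPlus_antitone h2 h1
  rw [secondBound_eq h₀ hs, secondBound_eq (h₀.trans_le h) hs]
  split_ifs with h4 h5 h5
  · exact min_le_min (epsMinus_antitone h5.le h1) h3
  · exact (min_le_right _ _).trans h3
  · linarith
  · exact h3

/-- A fibre of the common region over a fixed `y` is star-shaped with respect to `x = 0`. -/
theorem smul_mem_commonRegion {x y : ℂ} (h : (x, y) ∈ commonRegion) {t : ℝ}
    (ht : t ∈ Icc (0 : ℝ) 1) :
    ((t : ℂ) * x, y) ∈ commonRegion := by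
  obtain ⟨⟨h1, h2, h3⟩, h4, h5, -, h6⟩ := h
  dsimp only at *
  have hn : ‖(t : ℂ) * x‖ ≤ ‖x‖ := by
    rw [norm_mul, norm_real, Real.norm_of_nonneg ht.1]
    exact mul_le_of_le_one_left (norm_nonneg _) ht.2
  have hs : 0 < ‖1 - y‖ := norm_pos_iff.2 (sub_ne_zero.2 (Ne.symm h4))
  refine ⟨⟨hn.trans_lt h1, h2, fun htx => ?_⟩, h4, ?_, h2, fun htx => ?_⟩
  · have hx : x ≠ 0 := right_ne_zero_of_mul htx
    have hx0 := norm_pos_iff.2 hx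
    have htx0 := norm_pos_iff.2 htx
    have h7 := h3 hx
    dsimp only at *
    rw [lt_div_iff₀ (by positivity)] at h7 ⊢
    have h8 : (1 - 12 * ‖x‖) ^ (3 / 2 : ℝ) ≤ (1 - 12 * ‖(t : ℂ) * x‖) ^ (3 / 2 : ℝ) :=
      Real.rpow_le_rpow (by linarith) (by linarith) (by norm_num)
    have h9 : ‖1 - y‖ * (54 * ‖(t : ℂ) * x‖) ≤ ‖1 - y‖ * (54 * ‖x‖) := by gcongr
    linarith
  · rw [norm_div] at h5 ⊢
    exact (div_le_div_of_nonneg_right hn (norm_nonneg _)).trans_lt h5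
  · exact (h6 (right_ne_zero_of_mul htx)).trans_le
      (secondBound_antitone (norm_pos_iff.2 htx) hn hs)

/-- Close to `x = 0` the bounds that depend on `|x|` exceed one, and so impose nothing. -/
theorem mem_commonRegion_of_small {x y : ℂ} (hy0 : y ≠ 1) (hy : ‖1 - y‖ < 1)
    (hx : 400 * ‖x‖ ≤ ‖1 - y‖) : (x, y) ∈ commonRegion := by
  have hs : 0 < ‖1 - y‖ := norm_pos_iff.2 (sub_ne_zero.2 hy0.symm)
  refine ⟨⟨by dsimp only; linarith, hy, fun hx0 => ?_⟩, hy0, ?_, hy, fun hx0 => ?_⟩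
  · have hx0 := norm_pos_iff.2 hx0
    dsimp only at *
    have : 0 ≤ (1 - 12 * ‖x‖) ^ (3 / 2 : ℝ) := Real.rpow_nonneg (by linarith) _
    refine hy.trans_le ?_
    rw [le_div_iff₀ (by positivity)]
    linarith
  · dsimp only
    rw [norm_div, norm_sub_rev, div_lt_one hs]
    linarith [norm_nonneg x]
  · have hx0 := norm_pos_iff.2 hx0
    dsimp only at *
    have hρ : ‖x‖ / ‖1 - y‖ ≤ 1 / 400 := by
      rw [div_le_iff₀ hs]; linarith
    have hρ0 : 0 < ‖x‖ / ‖1 - y‖ := by positivity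
    rw [secondBound_eq hx0 hs, if_neg (by linarith)]
    exact hy.trans (one_lt_epsPlus.trans_le (epsPlus_antitone hρ0 hρ))

theorem mem_commonRegion_zero_iff {y : ℂ} : (0, y) ∈ commonRegion ↔ y ≠ 1 ∧ ‖1 - y‖ < 1 :=
  ⟨fun h => ⟨h.2.1, h.1.2.1⟩, fun h => mem_commonRegion_of_small h.1 h.2 (by simp)⟩

theorem mem_coverRegion_zero_iff {w : ℂ} : (0, w) ∈ coverRegion ↔ w.re < 0 := by
  have : (0, w) ∈ coverRegion ↔ (0, 1 - exp w) ∈ commonRegion := Iff.rfl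
  rw [this, mem_commonRegion_zero_iff, sub_sub_cancel, norm_exp, Real.exp_lt_one_iff]
  simp

/-- The part of the covering over a convex set of logarithms of `1 - y` is connected: each of its
points can be moved to `x = 0` with fixed `y`, and the part over `x = 0` is convex. -/
theorem isPreconnected_coverRegion_inter {T : Set ℂ} (hT : Convex ℝ T) {w₀ : ℂ} (hw₀ : w₀ ∈ T)
    (hw₀' : w₀.re < 0) : IsPreconnected (coverRegion ∩ {q | q.2 ∈ T}) := by
  refine isPreconnected_of_forall ((0 : ℂ), w₀) fun q hq => ?_
  obtain ⟨x, w⟩ := q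
  obtain ⟨hq, hw⟩ := hq
  have hseg : ∀ t ∈ Icc (0 : ℝ) 1, ((t : ℂ) * x, w) ∈ coverRegion := fun t ht =>
    smul_mem_commonRegion (x := x) (y := 1 - exp w) hq ht
  have hw' : w.re < 0 := by
    have := hseg 0 (by simp)
    rwa [ofReal_zero, zero_mul, mem_coverRegion_zero_iff] at this
  refine ⟨(fun t : ℝ => ((t : ℂ) * x, w)) '' Icc 0 1 ∪
    (fun w : ℂ => ((0 : ℂ), w)) '' (T ∩ {w | w.re < 0}), ?_, ?_, ?_, ?_⟩
  · rintro _ (⟨t, ht, rfl⟩ | ⟨v, hv, rfl⟩)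
    · exact ⟨hseg t ht, hw⟩
    · exact ⟨mem_coverRegion_zero_iff.2 hv.2, hv.1⟩
  · exact Or.inr ⟨w₀, ⟨hw₀, hw₀'⟩, rfl⟩
  · exact Or.inl ⟨1, by simp, by simp⟩
  · refine IsPreconnected.union ((0 : ℂ), w) ⟨0, by simp, by simp⟩ ⟨w, ⟨hw, hw'⟩, rfl⟩ ?_ ?_
    · exact isPreconnected_Icc.image _ (by fun_prop)
    · exact (hT.inter (convex_halfSpace_re_lt 0)).isPreconnected.image _ (by fun_prop)

theorem convex_abs_im_lt (r : ℝ) : Convex ℝ {w : ℂ | |w.im| < r} := by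
  have : {w : ℂ | |w.im| < r} = {w | -r < w.im} ∩ {w | w.im < r} := by
    ext w; exact abs_lt (a := w.im) (b := r)
  rw [this]
  exact (convex_halfSpace_im_gt _).inter (convex_halfSpace_im_lt _)

theorem log_one_half_re_neg : (log (1 / 2)).re < 0 := by
  rw [log_re]
  exact Real.log_neg (by norm_num) (by norm_num)

theorem abs_im_log_lt_pi {z : ℂ} (hz : z ∈ slitPlane) : |(log z).im| < Real.pi := by
  rw [log_im, abs_lt]
  exact ⟨neg_pi_lt_arg z, lt_of_le_of_ne (arg_le_pi z) (slitPlane_arg_ne_pi hz)⟩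

theorem log_exp_of_abs_im_lt {w : ℂ} (hw : |w.im| < Real.pi) : log (exp w) = w :=
  log_exp (abs_lt.1 hw).1 (abs_lt.1 hw).2.le

theorem exp_mem_slitPlane_of_abs_im_lt {w : ℂ} (hw : |w.im| < Real.pi) : exp w ∈ slitPlane := by
  rw [mem_slitPlane_iff_arg, ← log_im, log_exp_of_abs_im_lt hw]
  exact ⟨(abs_lt.1 hw).2.ne, exp_ne_zero w⟩

theorem one_half_mem_slitPlane : (1 / 2 : ℂ) ∈ slitPlane := Or.inl (by norm_num)

theorem isPreconnected_coverRegion : IsPreconnected coverRegion := by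
  simpa using isPreconnected_coverRegion_inter convex_univ (mem_univ _) log_one_half_re_neg

theorem isPreconnected_cutRegion : IsPreconnected cutRegion := by
  have h := isPreconnected_coverRegion_inter (convex_abs_im_lt Real.pi)
    (abs_im_log_lt_pi one_half_mem_slitPlane) log_one_half_re_neg
  have : cutRegion = (fun q : ℂ × ℂ => (q.1, 1 - exp q.2)) ''
      (coverRegion ∩ {q | q.2 ∈ {w : ℂ | |w.im| < Real.pi}}) := by
    ext ⟨x, y⟩
    constructor
    · rintro ⟨h1, h2⟩
      have h3 : exp (log (1 - y)) = 1 - y := exp_log (slitPlane_ne_zero h2)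
      refine ⟨(x, log (1 - y)), ⟨?_, ?_⟩, ?_⟩
      · show (x, 1 - exp (log (1 - y))) ∈ commonRegion
        rwa [h3, sub_sub_cancel]
      · exact abs_im_log_lt_pi h2
      · simp [h3]
    · rintro ⟨⟨x', w⟩, ⟨h1, h2⟩, h3⟩
      simp only [Prod.mk.injEq] at h3
      obtain ⟨rfl, rfl⟩ := h3
      refine ⟨h1, ?_⟩
      show 1 - (1 - exp w) ∈ slitPlane
      rw [sub_sub_cancel]
      exact exp_mem_slitPlane_of_abs_im_lt h2
  rw [this]
  exact h.image _ (by fun_prop)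

theorem hornH5Region_mem_nhds : hornH5Region ∈ 𝓝 ((0 : ℂ), (1 / 2 : ℂ)) := by
  have h : IsOpen {p : ℂ × ℂ | ‖p.1‖ < 1 / 100 ∧ ‖p.2‖ < 3 / 4} :=
    (isOpen_lt continuous_fst.norm continuous_const).inter
      (isOpen_lt continuous_snd.norm continuous_const)
  filter_upwards [h.mem_nhds (by norm_num)] with p hp
  exact ⟨by linarith [hp.1], by linarith [hp.2], fun h0 =>
    lt_hornH5Bound (norm_pos_iff.2 h0) hp.1.le (by linarith [hp.1, hp.2])⟩

theorem commonRegion_mem_nhds : commonRegion ∈ 𝓝 ((0 : ℂ), (1 / 2 : ℂ)) := by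
  have h : IsOpen {p : ℂ × ℂ | (400 * ‖p.1‖ < ‖1 - p.2‖) ∧ ‖1 - p.2‖ < 1} :=
    (isOpen_lt (continuous_const.mul continuous_fst.norm)
      (continuous_const.sub continuous_snd).norm).inter
      (isOpen_lt (continuous_const.sub continuous_snd).norm continuous_const)
  filter_upwards [h.mem_nhds (by norm_num)] with p hp
  refine mem_commonRegion_of_small (fun h1 => ?_) hp.2 hp.1.le
  have := hp.1
  rw [h1] at this
  simp only [sub_self, norm_zero] at this
  linarith [norm_nonneg p.1]

/-! ### Analytic continuation -/

theorem hornH5_eq_doubleSeries (a b c : ℂ) (p : ℂ × ℂ) :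
    hornH5 a b c p.1 p.2 = doubleSeries (hornCoeff a b c) p :=
  tsum_congr fun k => hornH5Term_eq a b c p.1 p.2 k

theorem tsum_firstTerm_eq_doubleSeries (a b c : ℂ) (p : ℂ × ℂ) :
    ∑' k, firstTerm a b c p.1 p.2 k = doubleSeries (firstCoeff a b c) (-p.1, 1 - p.2) :=
  tsum_congr fun k => firstTerm_eq a b c p.1 p.2 k

theorem tsum_secondTerm_eq_doubleSeries (a b c : ℂ) (p : ℂ × ℂ) :
    ∑' k, secondTerm a b c p.1 p.2 k =
      doubleSeries (secondCoeff a b c) (-(p.1 / (1 - p.2)), 1 - p.2) :=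
  tsum_congr fun k => secondTerm_eq a b c p.1 p.2 k

/-- An open set that contains the region of convergence of `H₅`, and on which the series of `H₅`
converges absolutely. -/
def hornDomain (a b c : ℂ) : Set (ℂ × ℂ) := convDomain (hornCoeff a b c) ∩ {p | ‖p.2‖ < 1}

/-- An open set that contains the common region, and on which the two series around `(0, 1)`
converge absolutely. -/
def commonDomain (a b c : ℂ) : Set (ℂ × ℂ) :=
  {p | p.2 ≠ 1 ∧ ‖1 - p.2‖ < 1 ∧ (-p.1, 1 - p.2) ∈ convDomain (firstCoeff a b c) ∧
    (-(p.1 / (1 - p.2)), 1 - p.2) ∈ convDomain (secondCoeff a b c)}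

theorem isOpen_hornDomain (a b c : ℂ) : IsOpen (hornDomain a b c) :=
  (isOpen_convDomain _).inter (isOpen_lt continuous_snd.norm continuous_const)

theorem isOpen_commonDomain (a b c : ℂ) : IsOpen (commonDomain a b c) := by
  have h1 : IsOpen {p : ℂ × ℂ | p.2 ≠ 1 ∧ ‖1 - p.2‖ < 1 ∧
      (-p.1, 1 - p.2) ∈ convDomain (firstCoeff a b c)} :=
    (isOpen_ne_fun continuous_snd continuous_const).inter
      ((isOpen_lt (continuous_const.sub continuous_snd).norm continuous_const).inter
        ((isOpen_convDomain _).preimage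
          (continuous_fst.neg.prodMk (continuous_const.sub continuous_snd))))
  have hc : ContinuousOn (fun p : ℂ × ℂ => (-(p.1 / (1 - p.2)), 1 - p.2))
      {p : ℂ × ℂ | p.2 ≠ 1 ∧ ‖1 - p.2‖ < 1 ∧
        (-p.1, 1 - p.2) ∈ convDomain (firstCoeff a b c)} := by
    intro p hp
    have : 1 - p.2 ≠ 0 := sub_ne_zero.2 hp.1.symm
    refine ContinuousAt.continuousWithinAt ?_
    fun_prop (disch := assumption)
  have h2 := hc.isOpen_inter_preimage h1 (isOpen_convDomain (secondCoeff a b c))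
  convert h2 using 1
  ext p
  simp only [commonDomain, mem_inter_iff, mem_preimage, mem_ofPred_eq, and_assoc]

section

variable {a b c : ℂ}

theorem hornH5Region_subset (ha : ∀ k : ℕ, a ≠ -(k : ℂ)) (hb : ∀ k : ℤ, b ≠ (k : ℂ))
    (hc : ∀ k : ℕ, c ≠ -(k : ℂ)) : hornH5Region ⊆ hornDomain a b c := fun _ hp =>
  ⟨mem_convDomain_hornCoeff ha hb hc hp, hp.2.1⟩

theorem commonRegion_subset (ha : ∀ k : ℕ, a ≠ -(k : ℂ)) (hb : ∀ k : ℤ, b ≠ (k : ℂ))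
    (hca : ∀ k : ℤ, c - a ≠ (k : ℂ)) (hcb : ∀ k : ℕ, c - b ≠ -(k : ℂ))
    (hcab : ∀ k : ℤ, c - a - b ≠ (k : ℂ)) : commonRegion ⊆ commonDomain a b c := fun _ hp =>
  ⟨hp.2.1, hp.1.2.1, mem_convDomain_firstCoeff ha hb hca hcb hcab hp.1,
    mem_convDomain_secondCoeff hca hcb hcab hp.2⟩

theorem summable_hornH5Term {p : ℂ × ℂ} (hp : p ∈ convDomain (hornCoeff a b c)) :
    Summable (hornH5Term a b c p.1 p.2) :=
  (summable_of_mem_convDomain hp).congr fun k => (hornH5Term_eq a b c p.1 p.2 k).symm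

theorem summable_firstTerm {p : ℂ × ℂ}
    (hp : (-p.1, 1 - p.2) ∈ convDomain (firstCoeff a b c)) :
    Summable (firstTerm a b c p.1 p.2) :=
  (summable_of_mem_convDomain hp).congr fun k => (firstTerm_eq a b c p.1 p.2 k).symm

theorem summable_secondTerm {p : ℂ × ℂ}
    (hp : (-(p.1 / (1 - p.2)), 1 - p.2) ∈ convDomain (secondCoeff a b c)) :
    Summable (secondTerm a b c p.1 p.2) :=
  (summable_of_mem_convDomain hp).congr fun k => (secondTerm_eq a b c p.1 p.2 k).symm

/-- The connection formula on the overlap of the two open sets, which both contain the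
corresponding regions. -/
theorem eqOn_hornDomain_inter_commonDomain
    (ha : ∀ k : ℕ, a ≠ -(k : ℂ)) (hb : ∀ k : ℤ, b ≠ (k : ℂ)) (hc : ∀ k : ℕ, c ≠ -(k : ℂ))
    (hca : ∀ k : ℤ, c - a ≠ (k : ℂ)) (hcb : ∀ k : ℕ, c - b ≠ -(k : ℂ))
    (hcab : ∀ k : ℤ, c - a - b ≠ (k : ℂ)) :
    EqOn (fun p => hornH5 a b c p.1 p.2) (fun p => hornH5At01 a b c p.1 p.2)
      (hornDomain a b c ∩ commonDomain a b c) := fun _ hp =>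
  hornH5_eq_hornH5At01 ha hb hc hca hcb hcab ⟨hp.1.2, hp.2.2.1⟩ (summable_hornH5Term hp.1.1)
    (summable_firstTerm hp.2.2.2.1) (summable_secondTerm hp.2.2.2.2)

theorem analyticAt_hornH5 {p : ℂ × ℂ} (hp : p ∈ hornDomain a b c) :
    AnalyticAt ℂ (fun p : ℂ × ℂ => hornH5 a b c p.1 p.2) p := by
  simp only [hornH5_eq_doubleSeries]
  exact analyticAt_doubleSeries hp.1

theorem analyticAt_firstPart {p : ℂ × ℂ} (hp : p ∈ commonDomain a b c) :
    AnalyticAt ℂ (fun p : ℂ × ℂ => firstPart a b c p.1 p.2) p := by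
  simp only [firstPart, tsum_firstTerm_eq_doubleSeries]
  exact analyticAt_const.mul ((analyticAt_doubleSeries hp.2.2.1).fun_comp
    (f := fun p : ℂ × ℂ => (-p.1, 1 - p.2))
    (analyticAt_fst.neg.prod (analyticAt_const.sub analyticAt_snd)))

theorem analyticAt_secondPart {p : ℂ × ℂ} (hp : p ∈ commonDomain a b c) :
    AnalyticAt ℂ (fun p : ℂ × ℂ => secondPart a b c p.1 p.2) p := by
  have h1 : AnalyticAt ℂ (fun p : ℂ × ℂ => 1 - p.2) p := analyticAt_const.sub analyticAt_snd
  simp only [secondPart, tsum_secondTerm_eq_doubleSeries]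
  exact analyticAt_const.mul ((analyticAt_doubleSeries hp.2.2.2).fun_comp
    (f := fun p : ℂ × ℂ => (-(p.1 / (1 - p.2)), 1 - p.2))
    ((analyticAt_fst.div h1 (sub_ne_zero.2 hp.1.symm)).neg.prod h1))

theorem analyticAt_hornH5At01 {p : ℂ × ℂ} (hp : p ∈ commonDomain a b c)
    (hp' : 1 - p.2 ∈ slitPlane) :
    AnalyticAt ℂ (fun p : ℂ × ℂ => hornH5At01 a b c p.1 p.2) p :=
  (analyticAt_firstPart hp).add (((analyticAt_const.sub analyticAt_snd).cpow analyticAt_const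
    hp').mul (analyticAt_secondPart hp))

theorem analyticAt_hornH5At01Cover {q : ℂ × ℂ} (hq : (q.1, 1 - exp q.2) ∈ commonDomain a b c) :
    AnalyticAt ℂ (fun q : ℂ × ℂ => hornH5At01Cover a b c q.1 q.2) q := by
  have h : AnalyticAt ℂ (fun q : ℂ × ℂ => (q.1, 1 - exp q.2)) q :=
    analyticAt_fst.prod (analyticAt_const.sub analyticAt_snd.cexp')
  exact ((analyticAt_firstPart hq).fun_comp (f := fun q : ℂ × ℂ => (q.1, 1 - exp q.2)) h).add
    ((analyticAt_const.mul analyticAt_snd).cexp'.mul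
      ((analyticAt_secondPart hq).fun_comp (f := fun q : ℂ × ℂ => (q.1, 1 - exp q.2)) h))

/-- On the sheet `|Im w| < π` the branch of the power is the principal one. -/
theorem hornH5At01Cover_eq (x : ℂ) {w : ℂ} (hw : |w.im| < Real.pi) :
    hornH5At01Cover a b c x w = hornH5At01 a b c x (1 - exp w) := by
  rw [hornH5At01Cover, hornH5At01, sub_sub_cancel, cpow_def_of_ne_zero (exp_ne_zero w),
    log_exp_of_abs_im_lt hw, mul_comm w]

end

theorem mainTheorem3 (a b c : ℂ)
    (ha : ∀ k : ℕ, a ≠ -(k : ℂ)) (hb : ∀ k : ℤ, b ≠ (k : ℂ)) (hc : ∀ k : ℕ, c ≠ -(k : ℂ))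
    (hca : ∀ k : ℤ, c - a ≠ (k : ℂ)) (hcb : ∀ k : ℕ, c - b ≠ -(k : ℂ))
    (hcab : ∀ k : ℤ, c - a - b ≠ (k : ℂ)) :
    -- absolute convergence of the three double series in their regions
    (∀ x y : ℂ, (x, y) ∈ hornH5Region → Summable (hornH5Term a b c x y)) ∧
    (∀ x y : ℂ, (x, y) ∈ firstRegion → Summable (firstTerm a b c x y)) ∧
    (∀ x y : ℂ, (x, y) ∈ secondRegion → Summable (secondTerm a b c x y)) ∧
    -- the formula, wherever all three series converge
    (hornH5Region ∩ commonRegion).Nonempty ∧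
    (∀ x y : ℂ, (x, y) ∈ hornH5Region ∩ commonRegion →
      hornH5 a b c x y = hornH5At01 a b c x y) ∧
    -- on the whole common region, cut along `y ∈ [1, ∞)`, the right-hand side is the analytic
    -- continuation of `H₅`: the continuation exists, and it is unique
    (∃ G : ℂ × ℂ → ℂ, AnalyticOnNhd ℂ G (hornH5Region ∪ cutRegion) ∧
      EqOn G (fun p => hornH5 a b c p.1 p.2) hornH5Region ∧
      EqOn G (fun p => hornH5At01 a b c p.1 p.2) cutRegion) ∧
    (∀ G : ℂ × ℂ → ℂ, AnalyticOnNhd ℂ G (hornH5Region ∪ cutRegion) →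
      EqOn G (fun p => hornH5 a b c p.1 p.2) hornH5Region →
      EqOn G (fun p => hornH5At01 a b c p.1 p.2) cutRegion) ∧
    -- the same without a cut, for all branches of `(1 - y)^(c - a - b)` at once
    AnalyticOnNhd ℂ (fun q => hornH5At01Cover a b c q.1 q.2) coverRegion ∧
    (∀ x w : ℂ, (x, w) ∈ coverRegion → |w.im| < Real.pi → (x, 1 - exp w) ∈ hornH5Region →
      hornH5At01Cover a b c x w = hornH5 a b c x (1 - exp w)) ∧
    (∀ G : ℂ × ℂ → ℂ, AnalyticOnNhd ℂ G coverRegion →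
      (∀ x w : ℂ, (x, w) ∈ coverRegion → |w.im| < Real.pi → (x, 1 - exp w) ∈ hornH5Region →
        G (x, w) = hornH5 a b c x (1 - exp w)) →
      EqOn G (fun q => hornH5At01Cover a b c q.1 q.2) coverRegion) := by
  have hH := hornH5Region_subset ha hb hc
  have hR := commonRegion_subset ha hb hca hcb hcab
  have hEq := eqOn_hornDomain_inter_commonDomain ha hb hc hca hcb hcab
  have hbaseH : ((0 : ℂ), (1 / 2 : ℂ)) ∈ hornH5Region := mem_of_mem_nhds hornH5Region_mem_nhds
  have hbaseR : ((0 : ℂ), (1 / 2 : ℂ)) ∈ commonRegion := mem_of_mem_nhds commonRegion_mem_nhds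
  have hformula : ∀ x y : ℂ, (x, y) ∈ hornH5Region ∩ commonRegion →
      hornH5 a b c x y = hornH5At01 a b c x y := fun x y h => @hEq (x, y) ⟨hH h.1, hR h.2⟩
  have hcover : ∀ x w : ℂ, (x, w) ∈ coverRegion → |w.im| < Real.pi →
      (x, 1 - exp w) ∈ hornH5Region →
      hornH5At01Cover a b c x w = hornH5 a b c x (1 - exp w) := fun x w h hw h' =>
    (hornH5At01Cover_eq x hw).trans (hformula x (1 - exp w) ⟨h', h⟩).symm
  have hcut : AnalyticOnNhd ℂ (fun p => hornH5At01 a b c p.1 p.2) cutRegion := fun p hp =>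
    analyticAt_hornH5At01 (hR hp.1) hp.2
  have hcovAn : AnalyticOnNhd ℂ (fun q => hornH5At01Cover a b c q.1 q.2) coverRegion := fun q hq =>
    analyticAt_hornH5At01Cover (hR hq)
  refine ⟨fun x y h => summable_hornH5Term (p := (x, y)) (hH h).1,
    fun x y h => summable_firstTerm (p := (x, y)) (mem_convDomain_firstCoeff ha hb hca hcb hcab h),
    fun x y h => summable_secondTerm (p := (x, y)) (mem_convDomain_secondCoeff hca hcb hcab h),
    ⟨_, hbaseH, hbaseR⟩, hformula, ?_, ?_, hcovAn, hcover, ?_⟩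
  · -- the two functions agree on the overlap of the open sets where they are analytic
    classical
    refine ⟨fun p => if p ∈ hornDomain a b c then hornH5 a b c p.1 p.2 else
      hornH5At01 a b c p.1 p.2, ?_, fun p hp => if_pos (hH hp), fun p hp => ?_⟩
    · rintro p (hp | hp)
      · refine (analyticAt_hornH5 (hH hp)).congr ?_
        filter_upwards [(isOpen_hornDomain a b c).mem_nhds (hH hp)] with q hq
        exact (if_pos hq).symm
      · refine (hcut p hp).congr ?_
        filter_upwards [(isOpen_commonDomain a b c).mem_nhds (hR hp.1)] with q hq
        split_ifs with h
        · exact (@hEq q ⟨h, hq⟩).symm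
        · rfl
    · dsimp only
      split_ifs with h
      · exact @hEq p ⟨h, hR hp.1⟩
      · rfl
  · intro G hG hGH
    refine (hG.mono subset_union_right).eqOn_of_preconnected_of_eventuallyEq hcut
      isPreconnected_cutRegion (z₀ := ((0 : ℂ), (1 / 2 : ℂ)))
      ⟨hbaseR, Or.inl (by norm_num)⟩ ?_
    filter_upwards [hornH5Region_mem_nhds, commonRegion_mem_nhds] with p h1 h2
    exact (hGH h1).trans (@hEq p ⟨hH h1, hR h2⟩)
  · intro G hG hGH
    have hc₀ : Tendsto (fun q : ℂ × ℂ => (q.1, 1 - exp q.2)) (𝓝 ((0 : ℂ), log (1 / 2)))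
        (𝓝 ((0 : ℂ), (1 / 2 : ℂ))) := by
      have : ContinuousAt (fun q : ℂ × ℂ => (q.1, 1 - exp q.2)) ((0 : ℂ), log (1 / 2)) := by
        fun_prop
      have h2 := this.tendsto
      rwa [exp_log (by norm_num), show (1 : ℂ) - 1 / 2 = 1 / 2 by norm_num] at h2
    have him : IsOpen {q : ℂ × ℂ | |q.2.im| < Real.pi} :=
      isOpen_lt (continuous_im.comp continuous_snd).abs continuous_const
    refine hG.eqOn_of_preconnected_of_eventuallyEq hcovAn isPreconnected_coverRegion
      (z₀ := ((0 : ℂ), log (1 / 2))) (mem_coverRegion_zero_iff.2 log_one_half_re_neg) ?_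
    filter_upwards [hc₀ hornH5Region_mem_nhds, hc₀ commonRegion_mem_nhds,
      him.mem_nhds (abs_im_log_lt_pi one_half_mem_slitPlane)] with q h1 h2 h3
    exact (hGH q.1 q.2 h2 h3 h1).trans (hcover q.1 q.2 h2 h3 h1).symm
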